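/- Let $T,\theta,\theta_1>0$, $c_1\ge 0$, $\beta\in(0,1)$, $f(m)=m^\theta$, $g(m)=c_1Tm^{\theta_1}$, and let $m_0$ be a continuous, compactly supported probability density on $\mathbb R$. Let $u$ be a bounded Lipschitz function and $m\ge 0$ a bounded continuous function on $\mathbb R\times[0,T]$ such that $$-u_t+\tfrac12u_x^2=f(m)\ \text{ in the viscosity sense},\qquad m_t-(mu_x)_x=0\ \text{ in the sense of distributions, in }\mathbb R\times(0,T),$$ and $m(\cdot,0)=m_0$. Assume that one of the following holds. (a) (Mean field game.) $u(\cdot,T)=g(m(\cdot,T))$. (b) (Planning problem.) $m(\cdot,T)=m_T$ for a continuous, compactly supported probability density $m_T$ on $\mathbb R$, and $u$, which is not unique in $\{m=0\}$, is selected by approximation: for some $R>0$ there are classical solutions $(u^k,m^k)\in C^2\times C^1$, up to the boundary of $[-R,R]\times[0,T]$ and with $m^k>0$, of the same two equations with $u^k_x(\pm R,\cdot)=0$, such that $(u^k,m^k)\to(u,m)$ uniformly on $[-R,R]\times[0,T]$; moreover, for all $t\in[0,T]$, $m(x,t)=0$ if $|x|\ge R$, $u(x,t)=u(R,t)$ if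 $x>R$, and $u(x,t)=u(-R,t)$ if $x<-R$. If $f(m)\in C^{\beta}_{\rm loc}(\mathbb R\times(0,T))$, then $u\in C^{1,\beta/2}_{\rm loc}(\mathbb R\times(0,T))$. Moreover, $u$ is both locally semiconcave and locally semiconvex in $\mathbb R\times(0,T)$ with modulus $Cr^{\beta/2}$: for every compact $K\subset\mathbb R\times(0,T)$ there is a constant $C$ such that, for $w=u$ and for $w=-u$, for all $p,q$ with $[p,q]\subset K$ and all $\lambda\in[0,1]$, $$\lambda w(p)+(1-\lambda)w(q)-w(\lambda p+(1-\lambda)q)\le \lambda(1-\lambda)\,C\,|p-q|^{1+\beta/2}.$$ -/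

import Mathlib

open scoped ContDiff

namespace MFG

/-- The closed strip `ℝ × [0, T]`; points of `ℝ × ℝ` are written `p = (x, t)`. -/
def closedStrip (T : ℝ) : Set (ℝ × ℝ) := Set.univ ×ˢ Set.Icc 0 T

/-- The open strip `ℝ × (0, T)`. -/
def openStrip (T : ℝ) : Set (ℝ × ℝ) := Set.univ ×ˢ Set.Ioo 0 T

/-- The space derivative `w_x`. -/
noncomputable def dx (w : ℝ × ℝ → ℝ) (p : ℝ × ℝ) : ℝ := deriv (fun y => w (y, p.2)) p.1

/-- The time derivative `w_t`. -/
noncomputable def dt (w : ℝ × ℝ → ℝ) (p : ℝ × ℝ) : ℝ := deriv (fun s => w (p.1, s)) p.2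

/-- Continuous, compactly supported probability densities on `ℝ`. -/
structure IsDensity (μ : ℝ → ℝ) : Prop where
  continuous : Continuous μ
  compactSupport : HasCompactSupport μ
  nonneg : ∀ x, 0 ≤ μ x
  mass : ∫ x, μ x = 1

/-- `u` is a viscosity solution of `-u_t + u_x ^ 2 / 2 = F` in `ℝ × (0, T)`
(`u` and `F` are continuous wherever this is used). -/
def IsViscositySolution (T : ℝ) (F u : ℝ × ℝ → ℝ) : Prop :=
  ∀ φ : ℝ × ℝ → ℝ, ContDiff ℝ 1 φ → ∀ p ∈ openStrip T,
    (IsLocalMax (fun q => u q - φ q) p → -dt φ p + (dx φ p) ^ 2 / 2 ≤ F p) ∧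
    (IsLocalMin (fun q => u q - φ q) p → F p ≤ -dt φ p + (dx φ p) ^ 2 / 2)

/-- `m_t - (m u_x)_x = 0` in `ℝ × (0, T)` in the sense of distributions. It is used for `u`
Lipschitz in the strip, whose weak derivative `u_x` is the a.e. defined classical one. -/
def IsContinuitySolution (T : ℝ) (u m : ℝ × ℝ → ℝ) : Prop :=
  ∀ φ : ℝ × ℝ → ℝ, ContDiff ℝ ∞ φ → HasCompactSupport φ → tsupport φ ⊆ openStrip T →
    ∫ p : ℝ × ℝ, (m p * dt φ p - m p * dx u p * dx φ p) = 0

/-- The conditions common to the two problems, with coupling `f(m) = m ^ θ`: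
`u ∈ W^{1,∞}(ℝ × (0, T))` (the bounded Lipschitz functions, with their continuous extension to
the closed strip), `m ≥ 0` is in `C_b(ℝ × [0, T])`, the Hamilton-Jacobi equation holds in the
viscosity sense, the continuity equation in the sense of distributions, and `m(·, 0) = m₀`. -/
structure IsSystemSolution (T θ : ℝ) (m₀ : ℝ → ℝ) (u m : ℝ × ℝ → ℝ) : Prop where
  u_bounded : ∃ C : ℝ, ∀ p ∈ closedStrip T, |u p| ≤ C
  u_lipschitz : ∃ L : NNReal, LipschitzOnWith L u (closedStrip T)
  m_continuous : ContinuousOn m (closedStrip T)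
  m_bounded : ∃ C : ℝ, ∀ p ∈ closedStrip T, m p ≤ C
  m_nonneg : ∀ p ∈ closedStrip T, 0 ≤ m p
  hamiltonJacobi : IsViscositySolution T (fun p => m p ^ θ) u
  continuity : IsContinuitySolution T u m
  initial : ∀ x, m (x, 0) = m₀ x

/-- Solutions of the mean field game with initial density `m₀` and terminal cost coupling `g`. -/
structure IsMFGSolution (T θ : ℝ) (g : ℝ → ℝ) (m₀ : ℝ → ℝ) (u m : ℝ × ℝ → ℝ) : Prop
    extends IsSystemSolution T θ m₀ u m where
  terminal : ∀ x, u (x, T) = g (m (x, T))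

/-- Solutions of the planning problem with initial density `m₀` and terminal density `mT`. -/
structure IsPlanningSolution (T θ : ℝ) (m₀ mT : ℝ → ℝ) (u m : ℝ × ℝ → ℝ) : Prop
    extends IsSystemSolution T θ m₀ u m where
  terminal : ∀ x, m (x, T) = mT x

/-- The closed rectangle `[-R, R] × [0, T]`. -/
def rect (R T : ℝ) : Set (ℝ × ℝ) := Set.Icc (-R) R ×ˢ Set.Icc 0 T

/-- `(v, n)`, with `n > 0`, is a classical solution of the system on `[-R, R] × [0, T]`, smooth
up to the boundary, with the Neumann condition `v_x(±R, ·) = 0`. -/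
structure IsNeumannSolution (R T θ : ℝ) (v n : ℝ × ℝ → ℝ) : Prop where
  v_contDiff : ContDiffOn ℝ 2 v (rect R T)
  n_contDiff : ContDiffOn ℝ 1 n (rect R T)
  n_pos : ∀ p ∈ rect R T, 0 < n p
  hamiltonJacobi : ∀ p ∈ Set.Ioo (-R) R ×ˢ Set.Ioo 0 T, -dt v p + (dx v p) ^ 2 / 2 = n p ^ θ
  continuity : ∀ p ∈ Set.Ioo (-R) R ×ˢ Set.Ioo 0 T, dt n p - dx (fun q => n q * dx v q) p = 0
  neumann_left : ∀ t ∈ Set.Icc 0 T, derivWithin (fun x => v (x, t)) (Set.Icc (-R) R) (-R) = 0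
  neumann_right : ∀ t ∈ Set.Icc 0 T, derivWithin (fun x => v (x, t)) (Set.Icc (-R) R) R = 0

/-- A solution of the planning problem in which `u`, not unique where `m` vanishes, is selected by
approximation: `(u, m)` is on some `[-R, R] × [0, T]` the uniform limit of classical solutions of
the Neumann problem with positive densities, `m` vanishes for `|x| ≥ R`, and `u` is extended
constantly in `x` to `|x| > R`. -/
structure IsSelectedPlanningSolution (T θ : ℝ) (m₀ mT : ℝ → ℝ) (u m : ℝ × ℝ → ℝ) : Prop
    extends IsPlanningSolution T θ m₀ mT u m where
  selected : ∃ R : ℝ, 0 < R ∧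
    (∃ v n : ℕ → ℝ × ℝ → ℝ, (∀ k, IsNeumannSolution R T θ (v k) (n k)) ∧
      TendstoUniformlyOn v u Filter.atTop (rect R T) ∧
      TendstoUniformlyOn n m Filter.atTop (rect R T)) ∧
    (∀ p ∈ closedStrip T, R ≤ |p.1| → m p = 0) ∧
    (∀ p ∈ closedStrip T, p.1 < -R → u p = u (-R, p.2)) ∧
    (∀ p ∈ closedStrip T, R < p.1 → u p = u (R, p.2))

/-- `w ∈ C^r_loc(Ω)`, for an exponent `0 < r < 1` and `Ω` open. -/
def IsLocHolder {E : Type*} [NormedAddCommGroup E] (Ω : Set (ℝ × ℝ)) (r : ℝ)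
    (w : ℝ × ℝ → E) : Prop :=
  ∀ K ⊆ Ω, IsCompact K → ∃ C : ℝ, ∀ p ∈ K, ∀ q ∈ K, ‖w p - w q‖ ≤ C * ‖p - q‖ ^ r

/-- `w ∈ C^{1,r}_loc(Ω)`, for an exponent `0 < r < 1` and `Ω` open. -/
def IsLocC1Holder (Ω : Set (ℝ × ℝ)) (r : ℝ) (w : ℝ × ℝ → ℝ) : Prop :=
  DifferentiableOn ℝ w Ω ∧ IsLocHolder Ω r (fderiv ℝ w)

/-- `w` is locally semiconcave in `Ω` with a modulus of the form `ω(ρ) = C ρ ^ r`. -/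
def IsLocSemiconcave (Ω : Set (ℝ × ℝ)) (r : ℝ) (w : ℝ × ℝ → ℝ) : Prop :=
  ∀ K ⊆ Ω, IsCompact K → ∃ C : ℝ, ∀ p q : ℝ × ℝ, segment ℝ p q ⊆ K →
    ∀ l ∈ Set.Icc (0 : ℝ) 1,
      l * w p + (1 - l) * w q - w (l • p + (1 - l) • q)
        ≤ l * (1 - l) * ‖p - q‖ * (C * ‖p - q‖ ^ r)

end MFG

/-! Write `F = m ^ θ`. The Hamilton-Jacobi equation makes `u` the value function of the control
problem with running cost `v ^ 2 / 2 + F`. Its subsolution half bounds `u` at the start of any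
straight line by the cost along it plus `u` at the end (`SubLine`). Its supersolution half gives,
from every point, a curve for which the opposite inequality holds (`IsCalibrated`,
`IsSupersolution.exists_calibrated`).

Let such a curve leave `z`, and move it by `±(1 - s / τ) e`: the moved curves start at `z ± e` and
rejoin it after time `τ`. Comparing costs, the second difference of `u` at `z` is at most of order
`|e| ^ 2 / τ` (kinetic energy) plus `τ |e| ^ β` (Hölder continuity of `F`). The choice `τ ~ |e| ^ (1
- β / 2)` makes both terms of order `|e| ^ (1 + β / 2)`, which is the semiconcavity
(`SubLine.second_diff_le`, `exists_second_diff_le`). Under time reversal, a minimizing curve that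
arrives at `z` gives the opposite bound (`exists_second_diff_ge`), hence semiconvexity. The two
bounds together give differentiability with a Hölder gradient (`isLocC1Holder_of_second_diff`).

What remains is that some minimizing curve arrives at every point, which the viscosity equation
alone does not provide. In the planning problem the approximating solutions are classical, so their
equation survives time reversal and passes to the limit; for `|x| ≥ R` there is no mass and `u` is
constant in time (`isSupersolution_timeReversal_of_selected`). In the mean field game the continuity
equation forbids mass between two minimizing curves with a common start (`mass_between_eq_zero`).
The running cost vanishes there, and so does the terminal cost since `g(0) = 0`, so strict convexity
of the kinetic energy makes the curves coincide (`eq_of_calibrated`). With uniqueness, the curves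
starting at a fixed time sweep out the whole line at each later time before `T`, by connectedness
(`exists_calibrated_of_unique`). -/

namespace MFG

open Set Filter Topology

/-! ### Inf- and sup-convolutions of viscosity solutions -/

/-- The squared Euclidean distance of the plane. -/
def sqDist (P Q : ℝ × ℝ) : ℝ := (P.1 - Q.1) ^ 2 + (P.2 - Q.2) ^ 2

lemma dist_sq_le_sqDist (P Q : ℝ × ℝ) : dist P Q ^ 2 ≤ sqDist P Q := by
  rw [Prod.dist_eq, Real.dist_eq, Real.dist_eq]
  unfold sqDist
  rcases max_choice |P.1 - Q.1| |P.2 - Q.2| with h | h <;> rw [h, sq_abs]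
  · nlinarith [sq_nonneg (P.2 - Q.2)]
  · nlinarith [sq_nonneg (P.1 - Q.1)]

/-- This minimum is the inf-convolution of `w` at `P`. Beyond distance `2 * L * ε` the quadratic
penalty exceeds any gain that a Lipschitz function allows over the competitor `P` itself, so
minimizing over a closed ball suffices. -/
lemma exists_forall_add_sqDist_le {L : NNReal} {w : ℝ × ℝ → ℝ} (hw : LipschitzWith L w)
    {ε : ℝ} (hε : 0 < ε) (P : ℝ × ℝ) :
    ∃ Q, (∀ Q', w Q + sqDist P Q / (2 * ε) ≤ w Q' + sqDist P Q' / (2 * ε)) ∧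
      dist P Q ≤ 2 * L * ε := by
  have hr : 0 ≤ 2 * (L : ℝ) * ε := by positivity
  have hcont : Continuous fun Q => w Q + sqDist P Q / (2 * ε) := by
    have := hw.continuous
    unfold sqDist
    fun_prop
  obtain ⟨Q, hQ, hmin⟩ := (isCompact_closedBall P (2 * L * ε)).exists_isMinOn
    ⟨P, Metric.mem_closedBall_self hr⟩ hcont.continuousOn
  refine ⟨Q, fun Q' => ?_, by rw [dist_comm]; exact hQ⟩
  by_cases hQ' : dist Q' P ≤ 2 * L * ε
  · exact hmin hQ'
  · have h1 : w Q + sqDist P Q / (2 * ε) ≤ w P + sqDist P P / (2 * ε) :=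
      hmin (Metric.mem_closedBall_self hr)
    have h0 : sqDist P P = 0 := by simp [sqDist]
    have h2 : w P - w Q' ≤ L * dist P Q' :=
      (le_abs_self _).trans (by simpa [Real.dist_eq] using hw.dist_le_mul P Q')
    have h3 : L * dist P Q' ≤ sqDist P Q' / (2 * ε) := by
      rw [le_div_iff₀ (by positivity)]
      have := dist_sq_le_sqDist P Q'
      rw [dist_comm, not_le] at hQ'
      nlinarith [dist_nonneg (x := P) (y := Q')]
    rw [h0, zero_div, add_zero] at h1
    linarith

/-- Viscosity subsolutions of `-u_t + u_x ^ 2 / 2 = F`. -/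
def IsSubsolution (T : ℝ) (F u : ℝ × ℝ → ℝ) : Prop :=
  ∀ φ : ℝ × ℝ → ℝ, ContDiff ℝ 1 φ → ∀ p ∈ openStrip T,
    IsLocalMax (fun q => u q - φ q) p → -dt φ p + (dx φ p) ^ 2 / 2 ≤ F p

/-- Viscosity supersolutions of `-u_t + u_x ^ 2 / 2 = F`. -/
def IsSupersolution (T : ℝ) (F u : ℝ × ℝ → ℝ) : Prop :=
  ∀ φ : ℝ × ℝ → ℝ, ContDiff ℝ 1 φ → ∀ p ∈ openStrip T,
    IsLocalMin (fun q => u q - φ q) p → F p ≤ -dt φ p + (dx φ p) ^ 2 / 2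

lemma contDiff_sqDist_div (P : ℝ × ℝ) (c : ℝ) : ContDiff ℝ 1 fun Q => sqDist P Q / c := by
  unfold sqDist
  fun_prop

lemma dx_sqDist_div (P Q : ℝ × ℝ) (c : ℝ) :
    dx (fun Q => sqDist P Q / (2 * c)) Q = -((P.1 - Q.1) / c) := by
  have h : HasDerivAt (fun y => sqDist P (y, Q.2) / (2 * c))
      (((2 : ℕ) * (P.1 - Q.1) ^ (2 - 1) * (-1)) / (2 * c)) Q.1 :=
    (((((hasDerivAt_id' Q.1).const_sub P.1).fun_pow 2).add_const ((P.2 - Q.2) ^ 2)).div_const (2 * c))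
  unfold dx
  rw [h.deriv]
  by_cases hc : c = 0
  · simp [hc]
  · push_cast
    field_simp

lemma dt_sqDist_div (P Q : ℝ × ℝ) (c : ℝ) :
    dt (fun Q => sqDist P Q / (2 * c)) Q = -((P.2 - Q.2) / c) := by
  have h : HasDerivAt (fun y => sqDist P (Q.1, y) / (2 * c))
      (((2 : ℕ) * (P.2 - Q.2) ^ (2 - 1) * (-1)) / (2 * c)) Q.2 :=
    (((((hasDerivAt_id' Q.2).const_sub P.2).fun_pow 2).const_add ((P.1 - Q.1) ^ 2)).div_const (2 * c))
  unfold dt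
  rw [h.deriv]
  by_cases hc : c = 0
  · simp [hc]
  · push_cast
    field_simp

lemma dx_neg (w : ℝ × ℝ → ℝ) (Q : ℝ × ℝ) : dx (fun Q => -w Q) Q = -dx w Q := deriv.fun_neg

lemma dt_neg (w : ℝ × ℝ → ℝ) (Q : ℝ × ℝ) : dt (fun Q => -w Q) Q = -dt w Q := deriv.fun_neg

lemma sqDist_shift (P Q : ℝ × ℝ) (v h : ℝ) {ε : ℝ} (hε : 0 < ε) :
    sqDist (P.1 + h * v, P.2 + h) Q / (2 * ε) = sqDist P Q / (2 * ε) +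
      h * ((P.1 - Q.1) / ε * v + (P.2 - Q.2) / ε) + h ^ 2 * (v ^ 2 + 1) / (2 * ε) := by
  unfold sqDist
  field_simp
  ring

lemma abs_div_le_of_dist_le {L : NNReal} {P Q : ℝ × ℝ} {ε : ℝ} (hε : 0 < ε)
    (h : dist P Q ≤ 2 * L * ε) : |(P.1 - Q.1) / ε| ≤ 2 * L := by
  rw [abs_div, abs_of_pos hε, div_le_iff₀ hε]
  exact (le_max_left _ _).trans h

lemma mem_openStrip_of_dist_le {T r : ℝ} {P Q : ℝ × ℝ} (h : dist P Q ≤ r) (h0 : r < P.2)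
    (hT : P.2 + r < T) : Q ∈ openStrip T := by
  have h2 : |P.2 - Q.2| ≤ r := (le_max_right _ _).trans h
  rw [abs_le] at h2
  exact ⟨mem_univ _, by constructor <;> linarith⟩

/-- The inf-convolution of a supersolution decreases along a suitable velocity. -/
lemma IsSupersolution.exists_step {T : ℝ} {F u : ℝ × ℝ → ℝ} {L : NNReal}
    (hu : LipschitzWith L u) (hF : IsSupersolution T F u) {ε : ℝ} (hε : 0 < ε) :
    ∃ E : ℝ × ℝ → ℝ, (∀ P, u P - 2 * L ^ 2 * ε ≤ E P ∧ E P ≤ u P) ∧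
      ∀ P : ℝ × ℝ, 2 * L * ε < P.2 → P.2 + 2 * L * ε < T → ∃ (v : ℝ) (Q : ℝ × ℝ),
        |v| ≤ 2 * L ∧ dist P Q ≤ 2 * L * ε ∧ ∀ h, 0 ≤ h →
          E (P.1 + h * v, P.2 + h) ≤
            E P - h * (v ^ 2 / 2 + F Q) + h ^ 2 * (4 * L ^ 2 + 1) / (2 * ε) := by
  choose Q hQ hd using exists_forall_add_sqDist_le hu hε
  refine ⟨fun P => u (Q P) + sqDist P (Q P) / (2 * ε), fun P => ⟨?_, ?_⟩, fun P h0 hT => ?_⟩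
  · have h2 : u P - u (Q P) ≤ L * dist P (Q P) :=
      (le_abs_self _).trans (by simpa [Real.dist_eq] using hu.dist_le_mul P (Q P))
    have h3 : 0 ≤ sqDist P (Q P) / (2 * ε) := by unfold sqDist; positivity
    have h4 : L * dist P (Q P) ≤ L * (2 * L * ε) := by gcongr; exact hd P
    simp only
    nlinarith
  · simpa [sqDist] using hQ P P
  · have hmem := mem_openStrip_of_dist_le (hd P) h0 hT
    have hvis := hF (fun Q' => -(sqDist P Q' / (2 * ε))) (contDiff_sqDist_div P _).neg (Q P) hmem
      (Eventually.of_forall fun Q' => by simpa using hQ P Q')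
    rw [dx_neg, dt_neg, dx_sqDist_div, dt_sqDist_div] at hvis
    have hp := abs_div_le_of_dist_le hε (hd P)
    -- The velocity is minus the space slope of the penalty at its minimizer, the optimal control
    -- for the Hamiltonian `p ^ 2 / 2`. Keeping `Q P` as competitor at the shifted point gives the
    -- decrease, with an error quadratic in `h`.
    refine ⟨-((P.1 - (Q P).1) / ε), Q P, by rwa [abs_neg], hd P, fun h hh => ?_⟩
    have h1 := hQ (P.1 + h * -((P.1 - (Q P).1) / ε), P.2 + h) (Q P)
    rw [sqDist_shift P (Q P) _ h hε] at h1
    set p := (P.1 - (Q P).1) / ε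
    set q := (P.2 - (Q P).2) / ε
    have h3 : h ^ 2 * ((-p) ^ 2 + 1) / (2 * ε) ≤ h ^ 2 * (4 * L ^ 2 + 1) / (2 * ε) := by
      have : (-p) ^ 2 ≤ 4 * L ^ 2 := by
        rw [neg_sq, ← sq_abs]
        nlinarith [abs_nonneg p]
      gcongr
    have h4 : h * (p * -p + q) ≤ -(h * ((-p) ^ 2 / 2 + F (Q P))) := by nlinarith
    simp only
    linarith

/-- The sup-convolution of a subsolution decreases at most at the prescribed rate. -/
lemma IsSubsolution.exists_step {T : ℝ} {F u : ℝ × ℝ → ℝ} {L : NNReal}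
    (hu : LipschitzWith L u) (hF : IsSubsolution T F u) {ε : ℝ} (hε : 0 < ε) :
    ∃ E : ℝ × ℝ → ℝ, (∀ P, u P ≤ E P ∧ E P ≤ u P + 2 * L ^ 2 * ε) ∧
      ∀ P : ℝ × ℝ, 2 * L * ε < P.2 → P.2 + 2 * L * ε < T → ∃ Q : ℝ × ℝ,
        dist P Q ≤ 2 * L * ε ∧ ∀ v h, 0 ≤ h →
          E P ≤ E (P.1 + h * v, P.2 + h) + h * (v ^ 2 / 2 + F Q)
            + h ^ 2 * (v ^ 2 + 1) / (2 * ε) := by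
  choose Q hQ hd using exists_forall_add_sqDist_le hu.neg hε
  simp only [Pi.neg_apply] at hQ
  refine ⟨fun P => u (Q P) - sqDist P (Q P) / (2 * ε), fun P => ⟨?_, ?_⟩, fun P h0 hT => ?_⟩
  · have := hQ P P
    simp only [sqDist, sub_self] at this ⊢
    norm_num at this
    linarith
  · have h2 : u (Q P) - u P ≤ L * dist P (Q P) :=
      (le_abs_self _).trans (by
        rw [dist_comm P, ← Real.dist_eq]; exact hu.dist_le_mul (Q P) P)
    have h3 : 0 ≤ sqDist P (Q P) / (2 * ε) := by unfold sqDist; positivity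
    have h4 : L * dist P (Q P) ≤ L * (2 * L * ε) := by gcongr; exact hd P
    simp only
    nlinarith
  · have hmem := mem_openStrip_of_dist_le (hd P) h0 hT
    have hvis := hF (fun Q' => sqDist P Q' / (2 * ε)) (contDiff_sqDist_div P _) (Q P) hmem
      (Eventually.of_forall fun Q' => by
        have := hQ P Q'
        simp only
        linarith)
    rw [dx_sqDist_div, dt_sqDist_div] at hvis
    refine ⟨Q P, hd P, fun v h hh => ?_⟩
    have h1 := hQ (P.1 + h * v, P.2 + h) (Q P)
    rw [sqDist_shift P (Q P) _ h hε] at h1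
    set p := (P.1 - (Q P).1) / ε
    set q := (P.2 - (Q P).2) / ε
    -- The equation gives `q ≤ F - p ^ 2 / 2`, and `p * v - p ^ 2 / 2 ≤ v ^ 2 / 2` holds for every
    -- velocity: this is Legendre duality.
    have h4 : h * (p * v + q) ≤ h * (v ^ 2 / 2 + F (Q P)) + 0 := by
      nlinarith [sq_nonneg (p + v), mul_nonneg hh (sq_nonneg (p - v))]
    simp only
    linarith

/-! ### The dynamic programming inequality of subsolutions -/

lemma le_of_forall_pos_le_add_mul {a b K : ℝ} (h : ∀ ζ > 0, a ≤ b + ζ * K) : a ≤ b := by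
  refine le_of_forall_pos_le_add fun δ hδ => ?_
  have hK : 0 < |K| + 1 := by positivity
  have h1 := h (δ / (|K| + 1)) (by positivity)
  have h2 : δ / (|K| + 1) * K ≤ δ := by
    rw [div_mul_eq_mul_div, div_le_iff₀ hK]
    nlinarith [le_abs_self K]
  linarith

lemma exists_small_scale (L : NNReal) {δ : ℝ} (hδ : 0 < δ) :
    ∃ ε : ℝ, 0 < ε ∧ 2 * L * ε < δ ∧ 2 * L ^ 2 * ε < δ := by
  have hL : 0 ≤ (L : ℝ) := L.2
  have hD : 0 < 2 * (L : ℝ) ^ 2 + 2 * L + 1 := by positivity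
  refine ⟨δ / (2 * L ^ 2 + 2 * L + 1), by positivity, ?_, ?_⟩
  · rw [mul_div_assoc', div_lt_iff₀ hD]
    nlinarith [sq_nonneg (L : ℝ)]
  · rw [mul_div_assoc', div_lt_iff₀ hD]
    nlinarith [sq_nonneg (L : ℝ)]

lemma exists_dist_le_imp_abs_sub_le {F : ℝ × ℝ → ℝ} (hF : Continuous F) {K : Set (ℝ × ℝ)}
    (hK : IsCompact K) {ζ : ℝ} (hζ : 0 < ζ) :
    ∃ ρ > 0, ∀ P ∈ K, ∀ Q, dist P Q ≤ ρ → |F P - F Q| ≤ ζ := by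
  have h := hK.uniformContinuousAt_of_continuousAt F (fun a _ => hF.continuousAt)
    (Metric.dist_mem_uniformity hζ)
  obtain ⟨ρ, hρ, hsub⟩ := Metric.mem_uniformity_dist.1 h
  refine ⟨ρ / 2, by positivity, fun P hP Q hPQ => ?_⟩
  have := hsub (a := P) (b := Q) (by linarith) hP
  exact (le_of_lt (by simpa [Real.dist_eq] using this))

/-- The dynamic programming inequality of a subsolution along straight lines. -/
def SubLine (T : ℝ) (F u : ℝ × ℝ → ℝ) : Prop :=
  ∀ x v s t C : ℝ, 0 ≤ s → s ≤ t → t ≤ T → (∀ r ∈ Icc s t, F (x + v * r, r) ≤ C) →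
    u (x + v * s, s) ≤ u (x + v * t, t) + (v ^ 2 / 2 + C) * (t - s)

/-- The one-step inequality of the sup-convolution telescopes along a subdivision of the line. Away
from times `0` and `T` the maximizers stay inside the strip. -/
lemma IsSubsolution.line_interior {T : ℝ} {F u : ℝ × ℝ → ℝ} {L : NNReal}
    (hu : LipschitzWith L u) (hFc : Continuous F) (hF : IsSubsolution T F u)
    {x v s t C : ℝ} (hs : 0 < s) (hst : s ≤ t) (ht : t < T)
    (hC : ∀ r ∈ Icc s t, F (x + v * r, r) ≤ C) :
    u (x + v * s, s) ≤ u (x + v * t, t) + (v ^ 2 / 2 + C) * (t - s) := by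
  -- One `ζ` pays for the sup-convolution, one for the accumulated quadratic errors, and `ζ * (t -
  -- s)` for evaluating `F` at the maximizers instead of on the line.
  refine le_of_forall_pos_le_add_mul (K := 2 + (t - s)) fun ζ hζ => ?_
  obtain ⟨ρ, hρ, hFρ⟩ := exists_dist_le_imp_abs_sub_le hFc
    ((isCompact_Icc (a := s) (b := t)).image
      (show Continuous fun r : ℝ => (x + v * r, r) by fun_prop)) hζ
  obtain ⟨ε, hε, hε1, hε2⟩ := exists_small_scale L
    (show 0 < min (min s (T - t)) (min ρ ζ) by
      simp only [lt_min_iff]; exact ⟨⟨hs, by linarith⟩, hρ, hζ⟩)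
  simp only [lt_min_iff] at hε1 hε2
  obtain ⟨E, hE, hstep⟩ := hF.exists_step hu hε
  -- The convolution scale `ε` is fixed before the number of steps: the quadratic errors sum to a
  -- quantity of order `1 / (ε * N)`.
  obtain ⟨N, hN⟩ := exists_nat_gt ((t - s) ^ 2 * (v ^ 2 + 1) / (2 * ε) / ζ)
  have hN0 : (0 : ℝ) < N := lt_of_le_of_lt (by positivity) hN
  set h := (t - s) / N with hh
  have hh0 : 0 ≤ h := div_nonneg (by linarith) hN0.le
  have hNh : N * h = t - s := by rw [hh]; field_simp
  have key : ∀ k : ℕ, k ≤ N → E (x + v * s, s) ≤ E (x + v * (s + k * h), s + k * h) +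
      k * (h * (v ^ 2 / 2 + (C + ζ)) + h ^ 2 * (v ^ 2 + 1) / (2 * ε)) := by
    intro k
    induction k with
    | zero => intro _; simp
    | succ k ih =>
      intro hk
      have hk' : (k : ℝ) + 1 ≤ N := by exact_mod_cast hk
      have hr0 : s ≤ s + k * h := by nlinarith [(Nat.cast_nonneg k : (0 : ℝ) ≤ k)]
      have hr1 : s + k * h ≤ t := by nlinarith
      have h1 := ih (by omega)
      obtain ⟨Q, hQ, hst⟩ := hstep (x + v * (s + k * h), s + k * h)
        (by simp only; linarith [hε1.1.1]) (by simp only; linarith [hε1.1.2])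
      have h2 := hst v h hh0
      have h3 : F Q ≤ C + ζ := by
        have h4 := hFρ (x + v * (s + k * h), s + k * h) ⟨_, ⟨hr0, hr1⟩, rfl⟩ Q (by linarith)
        have h5 := hC _ ⟨hr0, hr1⟩
        rw [abs_le] at h4
        linarith
      have e : ((x + v * (s + k * h), s + k * h).1 + h * v,
          (x + v * (s + k * h), s + k * h).2 + h) =
          (x + v * (s + ((k + 1 : ℕ) : ℝ) * h), s + ((k + 1 : ℕ) : ℝ) * h) := by
        ext <;> push_cast <;> ring
      rw [e] at h2
      have h6 : h * (v ^ 2 / 2 + F Q) ≤ h * (v ^ 2 / 2 + (C + ζ)) := by gcongr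
      push_cast at h2 ⊢
      linarith
  have h1 := key N le_rfl
  rw [hNh, add_sub_cancel] at h1
  have h2 := (hE (x + v * s, s)).1
  have h3 := (hE (x + v * t, t)).2
  have h4 : (N : ℝ) * (h ^ 2 * (v ^ 2 + 1) / (2 * ε)) ≤ ζ := by
    have : (N : ℝ) * (h ^ 2 * (v ^ 2 + 1) / (2 * ε)) =
        (t - s) ^ 2 * (v ^ 2 + 1) / (2 * ε) / N := by
      rw [hh]; field_simp
    rw [this, div_le_iff₀ hN0]
    rw [div_lt_iff₀ hζ] at hN
    linarith
  have h5 : (N : ℝ) * (h * (v ^ 2 / 2 + (C + ζ)) + h ^ 2 * (v ^ 2 + 1) / (2 * ε)) =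
      (t - s) * (v ^ 2 / 2 + (C + ζ)) + N * (h ^ 2 * (v ^ 2 + 1) / (2 * ε)) := by
    rw [← hNh]; ring
  rw [h5] at h1
  linarith [hε2.2.2]

lemma IsSubsolution.subLine {T : ℝ} {F u : ℝ × ℝ → ℝ} {L : NNReal}
    (hu : LipschitzWith L u) (hFc : Continuous F) (hF : IsSubsolution T F u) :
    SubLine T F u := by
  intro x v s t C hs hst ht hC
  rcases hst.eq_or_lt with rfl | hst
  · simp
  have huc := hu.continuous
  have hl : Tendsto (fun η : ℝ => u (x + v * (s + η), s + η)) (𝓝[>] 0) (𝓝 (u (x + v * s, s))) :=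
    ((show Continuous fun η : ℝ => u (x + v * (s + η), s + η) by fun_prop).tendsto' 0 _
      (by simp)).mono_left nhdsWithin_le_nhds
  have hr : Tendsto (fun η : ℝ => u (x + v * (t - η), t - η) +
      (v ^ 2 / 2 + C) * ((t - η) - (s + η))) (𝓝[>] 0)
      (𝓝 (u (x + v * t, t) + (v ^ 2 / 2 + C) * (t - s))) :=
    ((show Continuous fun η : ℝ => u (x + v * (t - η), t - η) +
      (v ^ 2 / 2 + C) * ((t - η) - (s + η)) by fun_prop).tendsto' 0 _
      (by simp)).mono_left nhdsWithin_le_nhds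
  refine le_of_tendsto_of_tendsto hl hr ?_
  filter_upwards [Ioo_mem_nhdsGT (show (0 : ℝ) < (t - s) / 2 by linarith)] with η hη
  exact hF.line_interior hu hFc (by linarith [hη.1]) (by linarith [hη.2])
    (by linarith [hη.1]) fun r hr => hC r ⟨by linarith [hr.1, hη.1], by linarith [hr.2, hη.1]⟩

/-- The form used for comparison curves: the endpoints are prescribed and the velocity is that of
the chord. -/
lemma SubLine.segment {T : ℝ} {F u : ℝ × ℝ → ℝ} (h : SubLine T F u) {x y s t C : ℝ}
    (hs : 0 ≤ s) (hst : s < t) (ht : t ≤ T)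
    (hC : ∀ l ∈ Icc (0 : ℝ) 1, F (x + l * (y - x), s + l * (t - s)) ≤ C) :
    u (x, s) ≤ u (y, t) + (y - x) ^ 2 / (2 * (t - s)) + C * (t - s) := by
  have hts : 0 < t - s := by linarith
  have h1 := h (x - (y - x) / (t - s) * s) ((y - x) / (t - s)) s t C hs hst.le ht (by
    intro r hr
    have h2 := hC ((r - s) / (t - s)) ⟨div_nonneg (by linarith [hr.1]) hts.le,
      (div_le_one hts).2 (by linarith [hr.2])⟩
    have e : (x + (r - s) / (t - s) * (y - x), s + (r - s) / (t - s) * (t - s)) =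
        (x - (y - x) / (t - s) * s + (y - x) / (t - s) * r, r) := by
      ext
      · simp only; ring
      · simp only; field_simp; ring
    rwa [e] at h2)
  have e1 : x - (y - x) / (t - s) * s + (y - x) / (t - s) * s = x := by ring
  have e2 : x - (y - x) / (t - s) * s + (y - x) / (t - s) * t = y := by field_simp; ring
  have e3 : (((y - x) / (t - s)) ^ 2 / 2 + C) * (t - s) =
      (y - x) ^ 2 / (2 * (t - s)) + C * (t - s) := by field_simp
  rw [e1, e2, e3] at h1
  linarith

/-! ### Minimizing trajectories of supersolutions -/

/-- `γ` is a minimizing trajectory for `u` on `[a, b]`: the optimality inequality is required on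
all subintervals, the kinetic energy being replaced by that of the chord and `F` by a constant
lower bound. -/
structure IsCalibrated (F u : ℝ × ℝ → ℝ) (Λ : NNReal) (γ : ℝ → ℝ) (a b : ℝ) : Prop where
  lipschitz : LipschitzWith Λ γ
  le : ∀ s t, a ≤ s → s < t → t ≤ b → ∀ c, (∀ r ∈ Icc s t, c ≤ F (γ r, r)) →
    u (γ t, t) + (γ t - γ s) ^ 2 / (2 * (t - s)) + c * (t - s) ≤ u (γ s, s)

/-- The optimality inequality of `IsCalibrated` up to an error `η`. -/
def IsApproxCalibrated (F u : ℝ × ℝ → ℝ) (γ : ℝ → ℝ) (a b η : ℝ) : Prop :=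
  ∀ s t, a ≤ s → s + 2 * η < t → t ≤ b - η → ∃ s' ∈ Icc s (s + η), ∃ t' ∈ Icc (t - η) t,
    ∀ c, (∀ r ∈ Icc s' t', ∀ Q, dist (γ r, r) Q ≤ η → c ≤ F Q) →
      u (γ t', t') + (γ t' - γ s') ^ 2 / (2 * (t' - s')) + c * (t' - s') ≤ u (γ s', s') + η

lemma IsCalibrated.approx {F u : ℝ × ℝ → ℝ} {Λ : NNReal} {γ : ℝ → ℝ} {a b η : ℝ}
    (h : IsCalibrated F u Λ γ a b) (hη : 0 ≤ η) : IsApproxCalibrated F u γ a b η := by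
  intro s t hs hst ht
  refine ⟨s, ⟨le_rfl, by linarith⟩, t, ⟨by linarith, le_rfl⟩, fun c hc => ?_⟩
  have := h.le s t hs (by linarith) (by linarith) c fun r hr => hc r hr _ (by simpa using hη)
  linarith

/-- Joint convexity of `A ^ 2 / t` bounds the energy of a polygon below by that of its chord, one
step at a time. For `n = 0` the junk value of the division is `0`, which is correct because then `A
= 0`. -/
lemma add_sq_div_le {A v h : ℝ} (n : ℕ) (hh : 0 < h) (hA : n = 0 → A = 0) :
    (A + h * v) ^ 2 / (2 * ((n + 1) * h)) ≤ A ^ 2 / (2 * (n * h)) + h * (v ^ 2 / 2) := by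
  rcases Nat.eq_zero_or_pos n with rfl | hn
  · rw [hA rfl]
    simp only [Nat.cast_zero]
    refine le_of_eq ?_
    field_simp
    ring
  · have hn' : (0 : ℝ) < n := by exact_mod_cast hn
    have e : A ^ 2 / (2 * (n * h)) + h * (v ^ 2 / 2) - (A + h * v) ^ 2 / (2 * ((n + 1) * h)) =
        (A - n * h * v) ^ 2 / (2 * n * (n + 1) * h) := by
      field_simp
      ring
    have : 0 ≤ (A - n * h * v) ^ 2 / (2 * n * (n + 1) * h) := by positivity
    linarith

/-- Follow the velocities along which the inf-convolution decreases, with time step `h`. The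
resulting Euler polygon is controlled at grid times only, hence the freedom to move both times by
`η` in `IsApproxCalibrated`. -/
lemma exists_approxCalibrated {T : ℝ} {F u : ℝ × ℝ → ℝ} {L : NNReal}
    (hu : LipschitzWith L u) (hF : IsSupersolution T F u)
    {P : ℝ × ℝ} (hP : P ∈ openStrip T) {η : ℝ} (hη : 0 < η) :
    ∃ γ : ℝ → ℝ, LipschitzWith (2 * L) γ ∧ γ P.2 = P.1 ∧
      IsApproxCalibrated F u γ P.2 T η := by
  have hT : 0 < T := hP.2.1.trans hP.2.2
  have hP0 : 0 < P.2 := hP.2.1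
  obtain ⟨ε, hε, hε1, hε2⟩ := exists_small_scale L
    (show 0 < min P.2 (η / 2) by simp only [lt_min_iff]; exact ⟨hP0, by linarith⟩)
  simp only [lt_min_iff] at hε1 hε2
  obtain ⟨E, hE, hstep⟩ := hF.exists_step hu hε
  -- The velocity field is made total, with value `0` at times too close to `0` or `T`.
  have htot : ∀ Q : ℝ × ℝ, ∃ (v : ℝ) (Q' : ℝ × ℝ), |v| ≤ 2 * L ∧
      (2 * L * ε < Q.2 → Q.2 + 2 * L * ε < T → dist Q Q' ≤ 2 * L * ε ∧ ∀ h, 0 ≤ h →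
        E (Q.1 + h * v, Q.2 + h) ≤
          E Q - h * (v ^ 2 / 2 + F Q') + h ^ 2 * (4 * L ^ 2 + 1) / (2 * ε)) := by
    intro Q
    by_cases hc : 2 * L * ε < Q.2 ∧ Q.2 + 2 * L * ε < T
    · obtain ⟨v, Q', hv, hd, hs⟩ := hstep Q hc.1 hc.2
      exact ⟨v, Q', hv, fun _ _ => ⟨hd, hs⟩⟩
    · exact ⟨0, 0, by simp, fun h1 h2 => absurd ⟨h1, h2⟩ hc⟩
  choose v Q hv hrest using htot
  set h := min η (η * ε / (T * (4 * L ^ 2 + 1))) with hh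
  have hh0 : 0 < h := by rw [hh, lt_min_iff]; exact ⟨hη, by positivity⟩
  have hherr : T * (h * (4 * L ^ 2 + 1) / (2 * ε)) ≤ η / 2 := by
    have h1 : h ≤ η * ε / (T * (4 * L ^ 2 + 1)) := min_le_right _ _
    rw [le_div_iff₀ (by positivity)] at h1
    rw [mul_div_assoc', div_le_iff₀ (by positivity)]
    linarith
  let X : ℕ → ℝ := fun n => Nat.rec P.1 (fun k y => y + h * v (y, P.2 + k * h)) n
  have hX0 : X 0 = P.1 := rfl
  have hXs : ∀ k : ℕ, X (k + 1) = X k + h * v (X k, P.2 + k * h) := fun k => rfl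
  have hXlip : ∀ i n : ℕ, |X (i + n) - X i| ≤ 2 * L * (n * h) := by
    intro i n
    induction n with
    | zero => simp
    | succ n ih =>
      rw [← add_assoc, hXs]
      have h1 : |h * v (X (i + n), P.2 + (i + n : ℕ) * h)| ≤ h * (2 * L) := by
        rw [abs_mul, abs_of_pos hh0]
        gcongr
        exact hv _
      calc |X (i + n) + h * v (X (i + n), P.2 + (i + n : ℕ) * h) - X i|
          = |(X (i + n) - X i) + h * v (X (i + n), P.2 + (i + n : ℕ) * h)| := by ring_nf
        _ ≤ 2 * L * (n * h) + h * (2 * L) := (abs_add_le _ _).trans (add_le_add ih h1)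
        _ = 2 * L * ((n + 1 : ℕ) * h) := by push_cast; ring
  have hgrid : ∀ k : ℕ, X ⌊((P.2 + k * h) - P.2) / h⌋₊ = X k := fun k => by
    rw [add_sub_cancel_left, mul_div_cancel_right₀ _ hh0.ne', Nat.floor_natCast]
  have hlip : LipschitzOnWith (2 * L) (fun r => X ⌊(r - P.2) / h⌋₊)
      (range fun k : ℕ => P.2 + k * h) := by
    have aux : ∀ i n : ℕ, |X (i + n) - X i| ≤
        ((2 * L : NNReal) : ℝ) * |(P.2 + (i + n : ℕ) * h) - (P.2 + i * h)| := by
      intro i n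
      have e : (P.2 + (i + n : ℕ) * h) - (P.2 + i * h) = n * h := by push_cast; ring
      rw [e, abs_of_nonneg (show (0 : ℝ) ≤ n * h by positivity)]
      push_cast
      exact hXlip i n
    refine LipschitzOnWith.of_dist_le_mul ?_
    rintro _ ⟨i, rfl⟩ _ ⟨j, rfl⟩
    simp only [hgrid, Real.dist_eq]
    rcases le_total i j with hij | hij
    · obtain ⟨n, rfl⟩ := Nat.exists_eq_add_of_le hij
      rw [abs_sub_comm, abs_sub_comm (P.2 + _)]
      exact aux i n
    · obtain ⟨n, rfl⟩ := Nat.exists_eq_add_of_le hij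
      exact aux j n
  -- Any Lipschitz extension off the grid will do, since costs are only read at grid times.
  obtain ⟨γ, hγ, hγX⟩ := hlip.extend_real
  have hγk : ∀ k : ℕ, γ (P.2 + k * h) = X k := fun k => by
    rw [← hγX ⟨k, rfl⟩]
    exact hgrid k
  refine ⟨γ, hγ, by simpa [hX0] using hγk 0, ?_⟩
  have hsum : ∀ (i n : ℕ) (c : ℝ), P.2 + (i + n : ℕ) * h ≤ T - η →
      (∀ k, i ≤ k → k < i + n → c ≤ F (Q (X k, P.2 + k * h))) →
      E (X (i + n), P.2 + (i + n : ℕ) * h) + (X (i + n) - X i) ^ 2 / (2 * (n * h)) +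
        c * (n * h) ≤ E (X i, P.2 + i * h) + n * h * (h * (4 * L ^ 2 + 1) / (2 * ε)) := by
    intro i n c
    induction n with
    | zero => intro _ _; simp
    | succ n ih =>
      intro hle hc
      push_cast at hle
      have h1 := ih (by push_cast; nlinarith) fun k hk hk' => hc k hk (by omega)
      have hpos : 0 ≤ ((i + n : ℕ) : ℝ) * h := by positivity
      have h2 := (hrest (X (i + n), P.2 + (i + n : ℕ) * h) (by simp only; linarith [hε1.1])
        (by simp only; push_cast; nlinarith [hε1.2])).2 h hh0.le
      have e1 : ((X (i + n), P.2 + (i + n : ℕ) * h).1 + h * v (X (i + n), P.2 + (i + n : ℕ) * h),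
          (X (i + n), P.2 + (i + n : ℕ) * h).2 + h) =
          (X (i + (n + 1)), P.2 + ((i + (n + 1) : ℕ) : ℝ) * h) := by
        ext
        · rw [← add_assoc, hXs]
        · push_cast; ring
      rw [e1] at h2
      have h3 := hc (i + n) (by omega) (by omega)
      have h4 := add_sq_div_le (A := X (i + n) - X i)
        (v := v (X (i + n), P.2 + (i + n : ℕ) * h)) n hh0 (by rintro rfl; simp)
      have e2 : X (i + n) - X i + h * v (X (i + n), P.2 + (i + n : ℕ) * h) =
          X (i + (n + 1)) - X i := by
        rw [← add_assoc, hXs]; ring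
      rw [e2] at h4
      have h5 : h * c ≤ h * F (Q (X (i + n), P.2 + (i + n : ℕ) * h)) := by gcongr
      have e3 : h ^ 2 * (4 * (L : ℝ) ^ 2 + 1) / (2 * ε) =
          h * (h * (4 * L ^ 2 + 1) / (2 * ε)) := by ring
      rw [e3] at h2
      push_cast at h1 h2 h4 h5 ⊢
      linarith
  intro s t hs hst ht
  have hhη : h ≤ η := min_le_left _ _
  have hi0 : 0 ≤ (s - P.2) / h := div_nonneg (by linarith) hh0.le
  have hj0 : 0 ≤ (t - P.2) / h := div_nonneg (by linarith) hh0.le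
  -- Both times are rounded inwards, `s` up and `t` down, so that the grid interval stays in `[s,
  -- t]`.
  have hi1 : s ≤ P.2 + ⌈(s - P.2) / h⌉₊ * h := by
    have := Nat.le_ceil ((s - P.2) / h)
    rw [div_le_iff₀ hh0] at this
    linarith
  have hi2 : P.2 + ⌈(s - P.2) / h⌉₊ * h ≤ s + h := by
    have := (Nat.ceil_lt_add_one hi0).le
    rw [div_add_one hh0.ne', le_div_iff₀ hh0] at this
    linarith
  have hj1 : P.2 + ⌊(t - P.2) / h⌋₊ * h ≤ t := by
    have := Nat.floor_le hj0
    rw [le_div_iff₀ hh0] at this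
    linarith
  have hj2 : t - h ≤ P.2 + ⌊(t - P.2) / h⌋₊ * h := by
    have := (Nat.lt_floor_add_one ((t - P.2) / h)).le
    rw [div_le_iff₀ hh0] at this
    linarith
  set i := ⌈(s - P.2) / h⌉₊
  set j := ⌊(t - P.2) / h⌋₊
  have hij : i ≤ j := by
    have : (i : ℝ) * h ≤ j * h := by linarith
    exact_mod_cast le_of_mul_le_mul_right this hh0
  obtain ⟨n, hn⟩ := Nat.exists_eq_add_of_le hij
  refine ⟨P.2 + i * h, ⟨hi1, by linarith⟩, P.2 + j * h, ⟨by linarith, hj1⟩, fun c hc => ?_⟩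
  have h1 := hsum i n c (by rw [← hn]; linarith) fun k hk hk' => by
    have hik : (i : ℝ) * h ≤ k * h := by gcongr
    have hkj : (k : ℝ) * h ≤ j * h := by gcongr; omega
    refine hc (P.2 + k * h) ⟨by linarith, by linarith⟩ _ ?_
    rw [hγk]
    have hpos : 0 ≤ (k : ℝ) * h := by positivity
    have := (hrest (X k, P.2 + k * h) (by simp only; linarith [hε1.1])
      (by simp only; linarith [hε1.2])).1
    linarith [hε1.2]
  rw [← hn] at h1
  have e : (P.2 + (j : ℝ) * h) - (P.2 + i * h) = n * h := by rw [hn]; push_cast; ring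
  rw [hγk, hγk, e]
  have hnT : (n : ℝ) * h ≤ T := by rw [← e]; linarith
  have h2 : n * h * (h * (4 * L ^ 2 + 1) / (2 * ε)) ≤ η / 2 :=
    le_trans (by gcongr) hherr
  have h3 := (hE (X j, P.2 + j * h)).1
  have h4 := (hE (X i, P.2 + i * h)).2
  linarith [hε2.2]

/-- Sequential compactness of uniformly Lipschitz curves. -/
lemma exists_subseq_lipschitz {Λ : NNReal} {γ : ℕ → ℝ → ℝ} {a b x : ℝ} (hab : a ≤ b)
    (hγ : ∀ n, LipschitzWith Λ (γ n)) (ha : Tendsto (fun n => γ n a) atTop (𝓝 x)) :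
    ∃ (γ' : ℝ → ℝ) (φ : ℕ → ℕ), StrictMono φ ∧ LipschitzWith Λ γ' ∧
      ∀ δ > 0, ∀ᶠ n in atTop, ∀ r ∈ Icc a b, |γ (φ n) r - γ' r| ≤ δ := by
  obtain ⟨B, hB⟩ := (Metric.isBounded_range_of_tendsto _ ha).subset_closedBall 0
  let f : ℕ → BoundedContinuousFunction (Icc a b) ℝ := fun n =>
    BoundedContinuousFunction.mkOfCompact ⟨fun r => γ n r, (hγ n).continuous.comp (by fun_prop)⟩
  have hf : ∀ n, LipschitzWith Λ (f n) := fun n => by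
    have := (hγ n).comp (LipschitzWith.subtype_val (Icc a b))
    rwa [mul_one] at this
  have hcpt : IsCompact (closure (range f)) := by
    refine BoundedContinuousFunction.arzela_ascoli (Metric.closedBall 0 (B + Λ * (b - a)))
      (isCompact_closedBall _ _) _ ?_ ?_
    · rintro _ r ⟨n, rfl⟩
      have h1 : |γ n a| ≤ B := by simpa using hB ⟨n, rfl⟩
      have h2 := (hγ n).dist_le_mul r a
      have h3 : Λ * dist (r : ℝ) a ≤ Λ * (b - a) := by
        have := r.2
        rw [Real.dist_eq, abs_of_nonneg (by linarith [this.1])]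
        gcongr
        exact this.2
      rw [mem_closedBall_zero_iff, Real.norm_eq_abs]
      change |γ n r| ≤ _
      rw [Real.dist_eq] at h2
      have h4 : |γ n r| ≤ |γ n r - γ n a| + |γ n a| := by
        simpa using abs_add_le (γ n r - γ n a) (γ n a)
      linarith
    · refine (LipschitzWith.uniformEquicontinuous _ Λ ?_).equicontinuous
      rintro ⟨_, n, rfl⟩
      exact hf n
  obtain ⟨g, -, φ, hφ, hlim⟩ := hcpt.tendsto_subseq fun n => subset_closure (mem_range_self n)
  have hpt : ∀ r, Tendsto (fun n => f (φ n) r) atTop (𝓝 (g r)) := fun r =>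
    (BoundedContinuousFunction.tendsto_iff_tendstoUniformly.1 hlim).tendsto_at r
  have hg : LipschitzWith Λ g := LipschitzWith.of_dist_le_mul fun r s =>
    le_of_tendsto ((hpt r).dist (hpt s)) (Eventually.of_forall fun n => (hf _).dist_le_mul r s)
  refine ⟨IccExtend hab g, φ, hφ, ?_, fun δ hδ => ?_⟩
  · have := hg.comp (LipschitzWith.projIcc hab)
    rwa [mul_one] at this
  · have hu := BoundedContinuousFunction.tendsto_iff_tendstoUniformly.1 hlim
    filter_upwards [Metric.tendstoUniformly_iff.1 hu δ hδ] with n hn r hr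
    rw [IccExtend_of_mem hab g hr, abs_sub_comm]
    exact (le_of_lt (by simpa [Real.dist_eq, f] using hn ⟨r, hr⟩))

/-- Limits of approximately calibrated curves are calibrated. -/
lemma exists_calibrated_of_approx {F u : ℝ × ℝ → ℝ} (huc : Continuous u) (hFc : Continuous F)
    {Λ : NNReal} {γ : ℕ → ℝ → ℝ} {η : ℕ → ℝ} {a b x : ℝ} (hab : a ≤ b)
    (hγ : ∀ n, LipschitzWith Λ (γ n)) (ha : Tendsto (fun n => γ n a) atTop (𝓝 x))
    (hη : Tendsto η atTop (𝓝 0))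
    (happ : ∀ n, IsApproxCalibrated F u (γ n) a b (η n)) :
    ∃ (γ' : ℝ → ℝ) (φ : ℕ → ℕ), StrictMono φ ∧ IsCalibrated F u Λ γ' a b ∧ γ' a = x ∧
      ∀ r ∈ Icc a b, Tendsto (fun n => γ (φ n) r) atTop (𝓝 (γ' r)) := by
  obtain ⟨γ', φ, hφ, hγ', hunif⟩ := exists_subseq_lipschitz hab hγ ha
  have hpt : ∀ r ∈ Icc a b, Tendsto (fun n => γ (φ n) r) atTop (𝓝 (γ' r)) := by
    intro r hr
    rw [Metric.tendsto_nhds]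
    intro δ hδ
    filter_upwards [hunif (δ / 2) (by linarith)] with n hn
    rw [Real.dist_eq]
    linarith [hn r hr]
  have hηφ : Tendsto (fun n => η (φ n)) atTop (𝓝 0) := hη.comp hφ.tendsto_atTop
  have haφ := ha.comp hφ.tendsto_atTop
  -- Approximate calibration says nothing on the last interval of length `η`, so `t < b` is treated
  -- first and `t = b` follows by continuity.
  have hint : ∀ s t, a ≤ s → s < t → t < b → ∀ c, (∀ r ∈ Icc s t, c ≤ F (γ' r, r)) →
      u (γ' t, t) + (γ' t - γ' s) ^ 2 / (2 * (t - s)) + c * (t - s) ≤ u (γ' s, s) := by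
    intro s t hs hst ht c hc
    -- Lowering `c` to `c - ζ` absorbs both the distance between the curves and the radius `η`, by
    -- uniform continuity of `F` along the limit.
    refine le_of_forall_pos_le_add_mul (K := t - s) fun ζ hζ => ?_
    obtain ⟨ρ, hρ, hFρ⟩ := exists_dist_le_imp_abs_sub_le hFc
      ((isCompact_Icc (a := s) (b := t)).image
        (show Continuous fun r : ℝ => (γ' r, r) from hγ'.continuous.prodMk continuous_id)) hζ
    have hbad : ∀ n, ∃ s' t', s + 2 * η (φ n) < t → t ≤ b - η (φ n) →
        s' ∈ Icc s (s + η (φ n)) ∧ t' ∈ Icc (t - η (φ n)) t ∧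
        ∀ c, (∀ r ∈ Icc s' t', ∀ Q, dist (γ (φ n) r, r) Q ≤ η (φ n) → c ≤ F Q) →
          u (γ (φ n) t', t') + (γ (φ n) t' - γ (φ n) s') ^ 2 / (2 * (t' - s')) + c * (t' - s')
            ≤ u (γ (φ n) s', s') + η (φ n) := by
      intro n
      by_cases h : s + 2 * η (φ n) < t ∧ t ≤ b - η (φ n)
      · obtain ⟨s', hs', t', ht', hc'⟩ := happ (φ n) s t hs h.1 h.2
        exact ⟨s', t', fun _ _ => ⟨hs', ht', hc'⟩⟩
      · exact ⟨0, 0, fun h1 h2 => absurd ⟨h1, h2⟩ h⟩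
    choose s' t' hst' using hbad
    have hev : ∀ᶠ n in atTop, s + 2 * η (φ n) < t ∧ t ≤ b - η (φ n) ∧ η (φ n) ≤ ρ / 2 := by
      have h1 := hηφ.eventually_lt_const (show (0 : ℝ) < (t - s) / 2 by linarith)
      have h2 := hηφ.eventually_lt_const (show (0 : ℝ) < b - t by linarith)
      have h3 := hηφ.eventually_lt_const (show (0 : ℝ) < ρ / 2 by linarith)
      filter_upwards [h1, h2, h3] with n hn1 hn2 hn3
      exact ⟨by linarith, by linarith, hn3.le⟩
    have hs'lim : Tendsto s' atTop (𝓝 s) := by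
      refine tendsto_of_tendsto_of_tendsto_of_le_of_le' tendsto_const_nhds
        (by simpa using hηφ.const_add s) ?_ ?_ <;>
      · filter_upwards [hev] with n hn
        have := (hst' n hn.1 hn.2.1).1
        first | exact this.1 | exact this.2
    have ht'lim : Tendsto t' atTop (𝓝 t) := by
      refine tendsto_of_tendsto_of_tendsto_of_le_of_le'
        (by simpa using hηφ.const_sub t) tendsto_const_nhds ?_ ?_ <;>
      · filter_upwards [hev] with n hn
        have := (hst' n hn.1 hn.2.1).2.1
        first | exact this.1 | exact this.2
    have hγlim : ∀ (q : ℕ → ℝ) (r : ℝ), r ∈ Icc a b → Tendsto q atTop (𝓝 r) →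
        Tendsto (fun n => γ (φ n) (q n)) atTop (𝓝 (γ' r)) := by
      intro q r hr hq
      have h1 : Tendsto (fun n => γ (φ n) (q n) - γ (φ n) r) atTop (𝓝 0) := by
        refine squeeze_zero_norm (a := fun n => Λ * dist (q n) r)
          (fun n => (hγ (φ n)).dist_le_mul _ _) ?_
        have h2 := hq.dist (tendsto_const_nhds (x := r))
        rw [dist_self] at h2
        simpa using h2.const_mul (Λ : ℝ)
      simpa using h1.add (hpt r hr)
    have hsI : s ∈ Icc a b := ⟨hs, by linarith⟩
    have htI : t ∈ Icc a b := ⟨by linarith, ht.le⟩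
    have l1 := hγlim s' s hsI hs'lim
    have l2 := hγlim t' t htI ht'lim
    have hR : Tendsto (fun n => u (γ (φ n) (s' n), s' n) + η (φ n)) atTop
        (𝓝 (u (γ' s, s) + 0)) :=
      ((huc.tendsto _).comp (l1.prodMk_nhds hs'lim)).add hηφ
    have hLh : Tendsto (fun n => u (γ (φ n) (t' n), t' n) +
        (γ (φ n) (t' n) - γ (φ n) (s' n)) ^ 2 / (2 * (t' n - s' n)) + (c - ζ) * (t' n - s' n))
        atTop (𝓝 (u (γ' t, t) + (γ' t - γ' s) ^ 2 / (2 * (t - s)) + (c - ζ) * (t - s))) := by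
      refine (((huc.tendsto _).comp (l2.prodMk_nhds ht'lim)).add
        (((l2.sub l1).pow 2).div ((ht'lim.sub hs'lim).const_mul 2) ?_)).add
        ((ht'lim.sub hs'lim).const_mul _)
      have : 0 < t - s := by linarith
      positivity
    have hfin := le_of_tendsto_of_tendsto hLh hR (by
      filter_upwards [hev, hunif (ρ / 2) (by linarith)] with n hn hclose
      obtain ⟨h1, h2, h3⟩ := hst' n hn.1 hn.2.1
      refine h3 (c - ζ) fun r hr Q hQ => ?_
      have hr' : r ∈ Icc s t := ⟨h1.1.trans hr.1, hr.2.trans h2.2⟩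
      have h4 : dist (γ' r, r) Q ≤ ρ := by
        have h5 : dist (γ' r, r) (γ (φ n) r, r) ≤ ρ / 2 := by
          rw [Prod.dist_eq, Real.dist_eq, abs_sub_comm]
          simp only [dist_self]
          exact max_le (hclose r ⟨by linarith [hr'.1], by linarith [hr'.2]⟩) (by linarith)
        linarith [dist_triangle (γ' r, r) (γ (φ n) r, r) Q, hn.2.2]
      have h6 := hFρ (γ' r, r) ⟨r, hr', rfl⟩ Q h4
      have h7 := hc r hr'
      rw [abs_le] at h6
      linarith)
    linarith
  refine ⟨γ', φ, hφ, ⟨hγ', fun s t hs hst ht c hc => ?_⟩,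
    tendsto_nhds_unique (hpt a ⟨le_rfl, hab⟩) haφ, hpt⟩
  rcases ht.lt_or_eq with ht | rfl
  · exact hint s t hs hst ht c hc
  · have hγc := hγ'.continuous
    have hl : Tendsto (fun t' => u (γ' t', t') + (γ' t' - γ' s) ^ 2 / (2 * (t' - s)) +
        c * (t' - s)) (𝓝[<] t)
        (𝓝 (u (γ' t, t) + (γ' t - γ' s) ^ 2 / (2 * (t - s)) + c * (t - s))) := by
      refine Tendsto.mono_left ?_ nhdsWithin_le_nhds
      refine ContinuousAt.tendsto (f := fun t' => u (γ' t', t') +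
        (γ' t' - γ' s) ^ 2 / (2 * (t' - s)) + c * (t' - s)) ?_
      have hne : 2 * (t - s) ≠ 0 := by linarith
      fun_prop (disch := assumption)
    refine le_of_tendsto hl ?_
    filter_upwards [Ioo_mem_nhdsLT hst] with t' ht'
    exact hint s t' hs ht'.1 ht'.2 c fun r hr => hc r ⟨hr.1, hr.2.trans ht'.2.le⟩

/-- Approximately calibrated curves with errors `1 / (n + 1)` share the Lipschitz constant `2 * L`,
which comes from the bound on the inf-convolution slopes; a limit exists by compactness. -/
theorem IsSupersolution.exists_calibrated {T : ℝ} {F u : ℝ × ℝ → ℝ} {L : NNReal}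
    (hu : LipschitzWith L u) (hFc : Continuous F) (hF : IsSupersolution T F u)
    {P : ℝ × ℝ} (hP : P ∈ openStrip T) :
    ∃ γ : ℝ → ℝ, IsCalibrated F u (2 * L) γ P.2 T ∧ γ P.2 = P.1 := by
  choose γ hγ h0 happ using fun n : ℕ => exists_approxCalibrated hu hF hP
    (show (0 : ℝ) < 1 / ((n : ℝ) + 1) by positivity)
  obtain ⟨γ', -, -, h1, h2, -⟩ := exists_calibrated_of_approx hu.continuous hFc hP.2.2.le hγ
    (x := P.1) (by simp [h0]) tendsto_one_div_add_atTop_nhds_zero_nat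
    happ
  exact ⟨γ', h1, h2⟩

/-! ### Upper bounds for second differences -/

/-- The kinetic cost `D ^ 2 / (2 * h)` is homogeneous of degree one in `(D, h)`, so its second
difference only sees the deviation `a * h - D * b` from the radial direction. The factor `4 / 3`
comes from `h ^ 2 - b ^ 2 ≥ 3 / 4 * h ^ 2`. -/
lemma kinetic_second_diff_le {D a b h M : ℝ} (hh : 0 < h) (hb : 2 * |b| ≤ h)
    (hM : |a * h - D * b| ≤ M * h) :
    (D - a) ^ 2 / (2 * (h - b)) + (D + a) ^ 2 / (2 * (h + b)) - 2 * (D ^ 2 / (2 * h)) ≤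
      4 / 3 * M ^ 2 / h := by
  have hb' := abs_le.1 (show |b| ≤ h / 2 by linarith)
  have h1 : 0 < h - b := by linarith
  have h2 : 0 < h + b := by linarith
  have e : (D - a) ^ 2 / (2 * (h - b)) + (D + a) ^ 2 / (2 * (h + b)) - 2 * (D ^ 2 / (2 * h)) =
      (a * h - D * b) ^ 2 / (h * ((h - b) * (h + b))) := by
    field_simp
    ring
  rw [e, div_le_div_iff₀ (by positivity) hh]
  have h3 : (a * h - D * b) ^ 2 ≤ M ^ 2 * h ^ 2 := by
    rw [← sq_abs, ← mul_pow]
    exact pow_le_pow_left₀ (abs_nonneg _) hM 2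
  have h4 : 3 / 4 * h ^ 2 ≤ (h - b) * (h + b) := by nlinarith
  calc (a * h - D * b) ^ 2 * h ≤ M ^ 2 * h ^ 2 * h := by gcongr
    _ = 4 / 3 * M ^ 2 * (h * (3 / 4 * h ^ 2)) := by ring
    _ ≤ 4 / 3 * M ^ 2 * (h * ((h - b) * (h + b))) := by gcongr

lemma IsCalibrated.abs_sub_le {F u : ℝ × ℝ → ℝ} {Λ : NNReal} {γ : ℝ → ℝ} {a b : ℝ}
    (hγ : IsCalibrated F u Λ γ a b) (s t : ℝ) : |γ s - γ t| ≤ Λ * |s - t| := by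
  simpa [Real.dist_eq] using hγ.lipschitz.dist_le_mul s t

lemma dist_le_of_abs {P Q : ℝ × ℝ} {r : ℝ} (h1 : |P.1 - Q.1| ≤ r) (h2 : |P.2 - Q.2| ≤ r) :
    dist P Q ≤ r := by
  rw [Prod.dist_eq]
  exact max_le h1 h2

set_option maxHeartbeats 1000000 in
/-- Second differences at the start of a minimizing trajectory, by comparison with the
trajectories moved by `±(1 - s / τ) e` in space-time. -/
lemma SubLine.second_diff_le {T : ℝ} {F u : ℝ × ℝ → ℝ} {Λ : NNReal} {γ : ℝ → ℝ} {z e : ℝ × ℝ}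
    {τ β H ρ : ℝ} (hsub : SubLine T F u) (hγ : IsCalibrated F u Λ γ z.2 (z.2 + τ))
    (hγz : γ z.2 = z.1) (hτ : 0 < τ) (he : 2 * |e.2| ≤ τ) (he0 : 0 < ‖e‖)
    (hz0 : |e.2| ≤ z.2) (hzT : z.2 + τ ≤ T) (hβ : 0 ≤ β) (hH : 0 ≤ H)
    (hF : ∀ P ∈ Metric.closedBall z ρ, ∀ Q ∈ Metric.closedBall z ρ,
      |F P - F Q| ≤ H * dist P Q ^ β)
    (hρ : (Λ + 1) * τ + 2 * ‖e‖ ≤ ρ) :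
    u (z + e) + u (z - e) - 2 * u z ≤
      4 / 3 * (|e.1| + Λ * |e.2|) ^ 2 / τ + 2 * H * τ * ((2 * ‖e‖) ^ β + ‖e‖ ^ β) := by
  -- `N` is so large that neither time nor curve moves by more than `‖e‖` in one step.
  obtain ⟨N, hN⟩ := exists_nat_gt ((Λ + 1) * τ / ‖e‖)
  have hΛ : (0 : ℝ) ≤ Λ := Λ.2
  have hN0 : (0 : ℝ) < N := lt_of_le_of_lt (by positivity) hN
  set h := τ / N with hh
  have hh0 : 0 < h := by positivity
  have hNh : N * h = τ := by rw [hh]; field_simp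
  have hsmall : (Λ + 1) * h ≤ ‖e‖ := by
    rw [div_lt_iff₀ he0] at hN
    rw [hh, mul_div_assoc', div_le_iff₀ hN0]
    linarith
  have hΛh : 0 ≤ Λ * h := by positivity
  rw [add_mul, one_mul] at hsmall
  let s : ℕ → ℝ := fun i => z.2 + i * h
  -- The displacement decreases linearly from `e` to `0`; in time it changes the duration of each
  -- step by `e.2 / N`.
  let θ : ℕ → ℝ := fun i => 1 - i / N
  have hss : ∀ i, s (i + 1) = s i + h := fun i => by simp only [s]; push_cast; ring
  have hθs : ∀ i, θ (i + 1) = θ i - 1 / N := fun i => by simp only [θ]; push_cast; ring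
  have hs_mem : ∀ i, i ≤ N → z.2 ≤ s i ∧ s i ≤ z.2 + τ := fun i hi => by
    have : (i : ℝ) * h ≤ N * h := by gcongr
    exact ⟨by simp only [s]; nlinarith [(Nat.cast_nonneg i : (0 : ℝ) ≤ i)],
      by simp only [s]; linarith⟩
  have hθ_mem : ∀ i, i ≤ N → 0 ≤ θ i ∧ θ i ≤ 1 := fun i hi => by
    have h1 : (i : ℝ) / N ≤ 1 := (div_le_one hN0).2 (by exact_mod_cast hi)
    have h2 : 0 ≤ (i : ℝ) / N := by positivity
    exact ⟨by simp only [θ]; linarith, by simp only [θ]; linarith⟩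
  have hball : ∀ i, i ≤ N → ∀ Q : ℝ × ℝ, dist (γ (s i), s i) Q ≤ 2 * ‖e‖ →
      Q ∈ Metric.closedBall z ρ := by
    intro i hi Q hQ
    have h1 := hs_mem i hi
    have h2 : dist (γ (s i), s i) z ≤ (Λ + 1) * τ := by
      have h3 := hγ.abs_sub_le (s i) z.2
      have h4 : |s i - z.2| ≤ τ := by rw [abs_le]; constructor <;> linarith
      have h5 : Λ * |s i - z.2| ≤ Λ * τ := by gcongr
      rw [hγz] at h3
      refine dist_le_of_abs ?_ ?_ <;> simp only <;> nlinarith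
    rw [Metric.mem_closedBall]
    linarith [dist_triangle Q (γ (s i), s i) z, dist_comm Q (γ (s i), s i)]
  have hHold : ∀ i, i ≤ N → ∀ (Q : ℝ × ℝ) (r : ℝ), dist (γ (s i), s i) Q ≤ r → r ≤ 2 * ‖e‖ →
      |F (γ (s i), s i) - F Q| ≤ H * r ^ β := by
    intro i hi Q r hQ hr
    refine (hF _ (hball i hi _ (by simp)) Q (hball i hi Q (hQ.trans hr))).trans ?_
    gcongr
  have hγstep : ∀ i (r : ℝ), s i ≤ r → r ≤ s (i + 1) → |γ r - γ (s i)| ≤ Λ * h := by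
    intro i r h1 h2
    rw [hss] at h2
    refine (hγ.abs_sub_le r (s i)).trans ?_
    gcongr
    rw [abs_le]
    constructor <;> linarith
  -- Cost of one step of a moved curve, for `e' = ± e`. Its points are within `2 * ‖e‖` of the base
  -- point: `‖e‖` from the displacement and `‖e‖` from the step.
  have side : ∀ e' : ℝ × ℝ, ‖e'‖ = ‖e‖ → |e'.2| = |e.2| → ∀ i, i < N →
      u (γ (s i) + θ i * e'.1, s i + θ i * e'.2) ≤
        u (γ (s (i + 1)) + θ (i + 1) * e'.1, s (i + 1) + θ (i + 1) * e'.2) +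
        (γ (s (i + 1)) - γ (s i) - e'.1 / N) ^ 2 / (2 * (h - e'.2 / N)) +
        (F (γ (s i), s i) + H * (2 * ‖e‖) ^ β) * (h - e'.2 / N) := by
    intro e' hn h2 i hi
    have hb : |e'.2 / N| ≤ h / 2 := by
      rw [abs_div, h2, hh, abs_of_pos hN0, div_right_comm]
      gcongr
      linarith
    have hb' := abs_le.1 hb
    have hmi := hs_mem i hi.le
    have hmi' := hs_mem (i + 1) hi
    have hti := hθ_mem i hi.le
    have hti' := hθ_mem (i + 1) hi
    have he2 := abs_le.1 h2.le
    have e1 : s (i + 1) + θ (i + 1) * e'.2 - (s i + θ i * e'.2) = h - e'.2 / N := by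
      rw [hss, hθs]; ring
    have e2 : γ (s (i + 1)) + θ (i + 1) * e'.1 - (γ (s i) + θ i * e'.1) =
        γ (s (i + 1)) - γ (s i) - e'.1 / N := by
      rw [hθs]; ring
    have habs1 : |e'.1| ≤ ‖e‖ := hn ▸ norm_fst_le e'
    have habs2 : |e'.2| ≤ ‖e‖ := hn ▸ norm_snd_le e'
    have habs : ∀ θ' c : ℝ, 0 ≤ θ' → θ' ≤ 1 → |c| ≤ |e.2| → |θ' * c| ≤ |e.2| := by
      intro θ' c h0 h1 hc
      rw [abs_mul, abs_of_nonneg h0]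
      nlinarith [abs_nonneg c]
    have hst0 : 0 ≤ s i + θ i * e'.2 := by
      have := abs_le.1 (habs (θ i) e'.2 hti.1 hti.2 h2.le)
      linarith
    have hstT : s (i + 1) + θ (i + 1) * e'.2 ≤ T := by
      have h4 : θ (i + 1) * e'.2 ≤ θ (i + 1) * τ := by
        gcongr
        · exact hti'.1
        · linarith [abs_nonneg e.2]
      -- A displacement by the remaining time would end exactly at `z.2 + τ`, so one with `|e.2| ≤
      -- τ` never passes `T`.
      have h5 : s (i + 1) + θ (i + 1) * τ = z.2 + τ := by
        simp only [s, θ, hh]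
        field_simp
        ring
      linarith
    have hseg := hsub.segment (x := γ (s i) + θ i * e'.1)
      (y := γ (s (i + 1)) + θ (i + 1) * e'.1) (s := s i + θ i * e'.2)
      (t := s (i + 1) + θ (i + 1) * e'.2) (C := F (γ (s i), s i) + H * (2 * ‖e‖) ^ β)
      hst0 (by linarith) hstT ?_
    · rw [e1, e2] at hseg
      exact hseg
    · intro l hl
      rw [e1, e2]
      have hc0 : 0 ≤ θ i - l / N := by
        have h6 : l / N ≤ 1 / N := by gcongr; exact hl.2
        rw [hθs] at hti'
        linarith
      have hc1 : θ i - l / N ≤ 1 := by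
        have : 0 ≤ l / N := div_nonneg hl.1 hN0.le
        linarith
      have hd : dist (γ (s i), s i) (γ (s i) + θ i * e'.1 +
          l * (γ (s (i + 1)) - γ (s i) - e'.1 / N), s i + θ i * e'.2 + l * (h - e'.2 / N)) ≤
          2 * ‖e‖ := by
        refine dist_le_of_abs ?_ ?_
        · have e3 : γ (s i) - (γ (s i) + θ i * e'.1 + l * (γ (s (i + 1)) - γ (s i) - e'.1 / N)) =
              -((θ i - l / N) * e'.1 + l * (γ (s (i + 1)) - γ (s i))) := by ring
          simp only
          rw [e3, abs_neg]
          refine (abs_add_le _ _).trans ?_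
          rw [abs_mul, abs_mul, abs_of_nonneg hc0, abs_of_nonneg hl.1]
          have h7 := hγstep i (s (i + 1)) (by rw [hss]; linarith) le_rfl
          have h8 : (θ i - l / N) * |e'.1| ≤ 1 * ‖e‖ := by gcongr
          have h9 : l * |γ (s (i + 1)) - γ (s i)| ≤ 1 * (Λ * h) := by gcongr; exact hl.2
          linarith
        · have e3 : s i - (s i + θ i * e'.2 + l * (h - e'.2 / N)) =
              -((θ i - l / N) * e'.2 + l * h) := by ring
          simp only
          rw [e3, abs_neg]
          refine (abs_add_le _ _).trans ?_
          rw [abs_mul, abs_mul, abs_of_nonneg hc0, abs_of_nonneg hl.1, abs_of_pos hh0]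
          have h8 : (θ i - l / N) * |e'.2| ≤ 1 * ‖e‖ := by gcongr
          have h9 : l * h ≤ 1 * h := by gcongr; exact hl.2
          linarith
      have := abs_le.1 (hHold i hi.le _ _ hd le_rfl)
      linarith
  have base : ∀ i, i < N →
      u (γ (s (i + 1)), s (i + 1)) + (γ (s (i + 1)) - γ (s i)) ^ 2 / (2 * h) +
        (F (γ (s i), s i) - H * ‖e‖ ^ β) * h ≤ u (γ (s i), s i) := by
    intro i hi
    have hmi := hs_mem i hi.le
    have hmi' := hs_mem (i + 1) hi
    have h1 := hγ.le (s i) (s (i + 1)) hmi.1 (by rw [hss]; linarith) hmi'.2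
      (F (γ (s i), s i) - H * ‖e‖ ^ β) (by
        intro r hr
        have h2 := hγstep i r hr.1 hr.2
        have hr2 := hr.2
        rw [hss] at hr2
        have h3 := abs_le.1 (hHold i hi.le (γ r, r) ‖e‖ (by
          rw [dist_comm]
          refine dist_le_of_abs ?_ ?_
          · simp only; linarith
          · simp only
            rw [abs_of_nonneg (by linarith [hr.1])]
            linarith) (by linarith))
        linarith)
    have e1 : s (i + 1) - s i = h := by rw [hss]; ring
    rw [e1] at h1
    exact h1
  let W : ℕ → ℝ := fun i => u (γ (s i) + θ i * e.1, s i + θ i * e.2) +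
    u (γ (s i) + θ i * (-e).1, s i + θ i * (-e).2) - 2 * u (γ (s i), s i)
  -- The durations `h ± e.2 / N` add up to `2 * h`, so the values of `F` cancel in the second
  -- difference of a step and only the Hölder errors remain.
  let c0 : ℝ := 4 / 3 * ((|e.1| + Λ * |e.2|) / N) ^ 2 / h +
    2 * H * h * ((2 * ‖e‖) ^ β + ‖e‖ ^ β)
  have hW : ∀ i, i < N → W i ≤ W (i + 1) + c0 := by
    intro i hi
    have h1 := side e rfl rfl i hi
    have h2 := side (-e) (norm_neg e) (by simp) i hi
    have h3 := base i hi
    have hD := hγstep i (s (i + 1)) (by rw [hss]; linarith) le_rfl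
    have h4 := kinetic_second_diff_le (D := γ (s (i + 1)) - γ (s i)) (a := e.1 / N)
      (b := e.2 / N) (h := h) (M := (|e.1| + Λ * |e.2|) / N) hh0 (by
        rw [abs_div, abs_of_pos hN0, hh, mul_div_assoc']
        gcongr) (by
        refine (abs_sub _ _).trans ?_
        rw [abs_mul, abs_mul, abs_of_pos hh0, abs_div, abs_div, abs_of_pos hN0]
        have h5 : |γ (s (i + 1)) - γ (s i)| * (|e.2| / N) ≤ Λ * h * (|e.2| / N) := by gcongr
        have e3 : (|e.1| + Λ * |e.2|) / N * h = |e.1| / N * h + Λ * h * (|e.2| / N) := by ring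
        linarith)
    simp only [Prod.fst_neg, Prod.snd_neg, neg_div, sub_neg_eq_add] at h2
    simp only [W, c0, Prod.fst_neg, Prod.snd_neg]
    have e4 : (F (γ (s i), s i) + H * (2 * ‖e‖) ^ β) * (h - e.2 / N) +
        (F (γ (s i), s i) + H * (2 * ‖e‖) ^ β) * (h + e.2 / N) -
        2 * ((F (γ (s i), s i) - H * ‖e‖ ^ β) * h) =
        2 * H * h * ((2 * ‖e‖) ^ β + ‖e‖ ^ β) := by ring
    linarith
  have hsum : ∀ k, k ≤ N → W 0 ≤ W k + k * c0 := by
    intro k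
    induction k with
    | zero => intro _; simp
    | succ k ih =>
      intro hk
      have h1 := ih (by omega)
      have h2 := hW k (by omega)
      push_cast
      linarith
  have h1 := hsum N le_rfl
  have hθN : θ N = 0 := by simp only [θ]; field_simp; ring
  have hWN : W N = 0 := by simp only [W, hθN]; simp; ring
  have hθ0 : θ 0 = 1 := by simp [θ]
  have hs0 : s 0 = z.2 := by simp [s]
  have hW0 : W 0 = u (z + e) + u (z - e) - 2 * u z := by
    simp only [W, hθ0, hs0, hγz, one_mul]
    rfl
  have hc0 : N * c0 = 4 / 3 * (|e.1| + Λ * |e.2|) ^ 2 / τ +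
      2 * H * τ * ((2 * ‖e‖) ^ β + ‖e‖ ^ β) := by
    simp only [c0]
    rw [← hNh]
    field_simp
  rw [hW0, hWN, hc0, zero_add] at h1
  exact h1

/-- The comparison time is adapted to the increment to balance kinetic and potential errors. For
increments bounded away from `0` the Lipschitz bound is already of the right form. -/
lemma exists_second_diff_le {T β τ₀ : ℝ} {F u : ℝ × ℝ → ℝ} {L : NNReal} (Λ : NNReal)
    (hu : LipschitzWith L u) (hsub : SubLine T F u) (hβ : 0 < β) (hβ' : β < 1)
    (hF : IsLocHolder (openStrip T) β F) {K : Set (ℝ × ℝ)} (hK : IsCompact K)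
    (hKT : K ⊆ openStrip T) (hτ₀ : 0 < τ₀) :
    ∃ C, 0 ≤ C ∧ ∀ z ∈ K, ∀ γ, IsCalibrated F u Λ γ z.2 (z.2 + τ₀) → γ z.2 = z.1 →
      ∀ e, u (z + e) + u (z - e) - 2 * u z ≤ C * ‖e‖ ^ (1 + β / 2) := by
  have hΛ : (0 : ℝ) ≤ Λ := Λ.2
  have hopen : IsOpen (openStrip T) := isOpen_univ.prod isOpen_Ioo
  obtain ⟨ρ, hρ, hsubs⟩ := hK.exists_cthickening_subset_open hopen hKT
  obtain ⟨H', hH'⟩ := hF _ hsubs hK.cthickening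
  set H := max H' 0 with hHdef
  have hball : ∀ z ∈ K, Metric.closedBall z ρ ⊆ Metric.cthickening ρ K := fun z hz =>
    Metric.closedBall_subset_cthickening hz ρ
  have hα1 : 0 < 1 - β / 2 := by linarith
  -- If `‖e‖ ^ (1 - β / 2) ≤ σ`, then `τ ≤ τ₀`, `‖e‖ ≤ 1`, and `(Λ + 1) * τ + 2 * ‖e‖ ≤ (2 * Λ + 4)
  -- * σ ≤ ρ`.
  set σ := min (min (τ₀ / 2) 1) (ρ / (2 * Λ + 4)) with hσdef
  have hσ : 0 < σ := by
    simp only [hσdef, lt_min_iff]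
    exact ⟨⟨by linarith, one_pos⟩, by positivity⟩
  set r₀ := σ ^ (1 / (1 - β / 2)) with hr₀def
  have hr₀ : 0 < r₀ := Real.rpow_pos_of_pos hσ _
  have hr₀σ : r₀ ^ (1 - β / 2) = σ := by
    rw [hr₀def, ← Real.rpow_mul hσ.le, one_div, inv_mul_cancel₀ hα1.ne', Real.rpow_one]
  have hr₀1 : r₀ ≤ 1 := Real.rpow_le_one hσ.le ((min_le_left _ _).trans (min_le_right _ _))
    (by positivity)
  set C₁ := 2 / 3 * (Λ + 1) ^ 2 + 4 * H * (2 ^ β + 1) with hC₁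
  have hH0 : 0 ≤ H := le_max_right _ _
  have hC₁0 : 0 ≤ C₁ := by positivity
  have hC₂0 : 0 ≤ 2 * L * r₀ ^ (-(β / 2)) := by positivity
  refine ⟨C₁ + 2 * L * r₀ ^ (-(β / 2)), by positivity, fun z hz γ hγ hγz e => ?_⟩
  rcases eq_or_ne e 0 with rfl | hne
  · have : (0 : ℝ) ≤ ‖(0 : ℝ × ℝ)‖ ^ (1 + β / 2) := by positivity
    simp only [add_zero, sub_zero]
    nlinarith
  have he0 : 0 < ‖e‖ := norm_pos_iff.2 hne
  have hpow : 0 < ‖e‖ ^ (1 + β / 2) := Real.rpow_pos_of_pos he0 _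
  rcases le_or_gt ‖e‖ r₀ with hsm | hbig
  -- With this exponent `‖e‖ ^ 2 / τ` and `τ * ‖e‖ ^ β` are both multiples of `‖e‖ ^ (1 + β / 2)`;
  -- the factor `2` ensures `2 * |e.2| ≤ τ`.
  · set τ := 2 * ‖e‖ ^ (1 - β / 2) with hτ
    have hτ0 : 0 < τ := by positivity
    have hpσ : ‖e‖ ^ (1 - β / 2) ≤ σ := by
      rw [← hr₀σ]
      exact Real.rpow_le_rpow he0.le hsm hα1.le
    have hep : ‖e‖ ≤ ‖e‖ ^ (1 - β / 2) := by
      conv_lhs => rw [← Real.rpow_one ‖e‖]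
      exact Real.rpow_le_rpow_of_exponent_ge he0 (hsm.trans hr₀1) (by linarith)
    have hστ : σ ≤ τ₀ / 2 := (min_le_left _ _).trans (min_le_left _ _)
    have hσρ : (2 * Λ + 4) * σ ≤ ρ := by
      have : σ ≤ ρ / (2 * Λ + 4) := min_le_right _ _
      rw [le_div_iff₀ (by positivity)] at this
      linarith
    have hρτ : (Λ + 1) * τ + 2 * ‖e‖ ≤ ρ := by nlinarith
    have he2 : |e.2| ≤ ‖e‖ := norm_snd_le e
    have he1 : |e.1| ≤ ‖e‖ := norm_fst_le e
    have hτρ : τ ≤ ρ := by nlinarith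
    have hm1 := hsubs (hball z hz (show (z.1, z.2 - ρ) ∈ Metric.closedBall z ρ from
      dist_le_of_abs (by simp [hρ.le]) (by simp [abs_of_pos hρ])))
    have hm2 := hsubs (hball z hz (show (z.1, z.2 + ρ) ∈ Metric.closedBall z ρ from
      dist_le_of_abs (by simp [hρ.le]) (by simp [abs_of_pos hρ])))
    have hmain := hsub.second_diff_le (z := z) (e := e) (τ := τ) (β := β) (H := H) (ρ := ρ)
      (Λ := Λ) (γ := γ) ⟨hγ.lipschitz, fun s t hs hst ht => hγ.le s t hs hst (by linarith)⟩
      hγz hτ0 (by linarith) he0 (by linarith [hm1.2.1, he0.le]) (by linarith [hm2.2.2]) hβ.le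
      hH0 (fun P hP Q hQ => by
        refine (hH' P (hball z hz hP) Q (hball z hz hQ)).trans ?_
        rw [← dist_eq_norm]
        gcongr
        exact le_max_left _ _) hρτ
    refine hmain.trans ?_
    have t1 : 4 / 3 * (|e.1| + Λ * |e.2|) ^ 2 / τ ≤
        2 / 3 * (Λ + 1) ^ 2 * ‖e‖ ^ (1 + β / 2) := by
      rw [div_le_iff₀ hτ0]
      have h1 : ‖e‖ ^ (1 + β / 2) * τ = 2 * ‖e‖ ^ 2 := by
        rw [hτ, mul_left_comm, ← Real.rpow_add he0,
          show 1 + β / 2 + (1 - β / 2) = ((2 : ℕ) : ℝ) by push_cast; ring, Real.rpow_natCast]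
      have h2 : |e.1| + Λ * |e.2| ≤ (Λ + 1) * ‖e‖ := by nlinarith
      calc 4 / 3 * (|e.1| + Λ * |e.2|) ^ 2 ≤ 4 / 3 * ((Λ + 1) * ‖e‖) ^ 2 := by gcongr
        _ = 2 / 3 * (Λ + 1) ^ 2 * (2 * ‖e‖ ^ 2) := by ring
        _ = _ := by rw [← h1]; ring
    have t2 : 2 * H * τ * ((2 * ‖e‖) ^ β + ‖e‖ ^ β) =
        4 * H * (2 ^ β + 1) * ‖e‖ ^ (1 + β / 2) := by
      have h1 : ‖e‖ ^ (1 + β / 2) = ‖e‖ ^ (1 - β / 2) * ‖e‖ ^ β := by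
        rw [← Real.rpow_add he0]; ring_nf
      rw [Real.mul_rpow (by norm_num) he0.le, h1, hτ]
      ring
    rw [t2]
    have : 0 ≤ 2 * L * r₀ ^ (-(β / 2)) * ‖e‖ ^ (1 + β / 2) := by positivity
    rw [add_mul, hC₁]
    linarith
  · have hl : ∀ e' : ℝ × ℝ, u (z + e') - u z ≤ L * ‖e'‖ := fun e' => by
      have := hu.dist_le_mul (z + e') z
      rw [dist_self_add_left, Real.dist_eq] at this
      exact (le_abs_self _).trans this
    have h1 := hl e
    have h2 := hl (-e)
    rw [norm_neg, ← sub_eq_add_neg] at h2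
    have h3 : ‖e‖ ≤ r₀ ^ (-(β / 2)) * ‖e‖ ^ (1 + β / 2) := by
      rw [Real.rpow_add he0, Real.rpow_one, Real.rpow_neg hr₀.le, inv_mul_eq_div,
        le_div_iff₀ (by positivity)]
      gcongr
    have h4 : 2 * L * ‖e‖ ≤ 2 * L * r₀ ^ (-(β / 2)) * ‖e‖ ^ (1 + β / 2) := by
      rw [mul_assoc (2 * (L : ℝ))]
      gcongr
    have : 0 ≤ C₁ * ‖e‖ ^ (1 + β / 2) := by positivity
    rw [add_mul]
    linarith

/-! ### From midpoint semiconcavity to semiconcavity -/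

/-- The constant relating midpoint semiconcavity to semiconcavity. -/
noncomputable def midpointConst (α : ℝ) : ℝ := 4 * (1 + 2 ^ α / (2 ^ α - 1))

lemma midpointConst_nonneg {α : ℝ} (hα : 0 < α) : 0 ≤ midpointConst α := by
  have : 0 < (2 : ℝ) ^ α - 1 := sub_pos.2 (Real.one_lt_rpow (by norm_num) hα)
  unfold midpointConst
  positivity

/-- A maximum principle for the doubling `y ↦ 2 * y`: the barrier `ψ` satisfies with equality the
midpoint relation between `0` and `2 * y`, so the maximum of `h - ψ` cannot be positive. -/
lemma le_mul_of_midpoint {h : ℝ → ℝ} {K α : ℝ} (hα : 0 < α) (hK : 0 ≤ K)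
    (hc : ContinuousOn h (Icc 0 1)) (h0 : h 0 = 0) (h1 : h 1 = 0)
    (hmid : ∀ a ∈ Icc (0 : ℝ) 1, ∀ b ∈ Icc (0 : ℝ) 1,
      2 * h ((a + b) / 2) ≤ h a + h b + K * |b - a| ^ (1 + α)) {x : ℝ} (hx : x ∈ Icc (0 : ℝ) 1) :
    h x ≤ 2 * (1 + 2 ^ α / (2 ^ α - 1)) * K * x := by
  have h2α : 0 < (2 : ℝ) ^ α - 1 := sub_pos.2 (Real.one_lt_rpow (by norm_num) hα)
  set B := K * (2 ^ α / (2 ^ α - 1)) with hB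
  have hB0 : 0 ≤ B := by positivity
  have hne : (Icc (0 : ℝ) 1).Nonempty := ⟨0, by simp⟩
  -- A maximum point is the midpoint of an endpoint of `[0, 1]` and another point of it, whence `2 *
  -- h y ≤ h y + K`.
  have hhK : ∀ y ∈ Icc (0 : ℝ) 1, h y ≤ K := by
    obtain ⟨y, hy, hmax⟩ := isCompact_Icc.exists_isMaxOn hne hc
    suffices hyK : h y ≤ K from fun y' hy' => (hmax hy').trans hyK
    have hb : ∀ c : ℝ, |c| ≤ 1 → K * |c| ^ (1 + α) ≤ K := fun c hc' =>
      mul_le_of_le_one_right hK (Real.rpow_le_one (abs_nonneg _) hc' (by linarith))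
    rcases le_total y (1 / 2) with hy2 | hy2
    · have hm : 2 * y ∈ Icc (0 : ℝ) 1 := ⟨by linarith [hy.1], by linarith⟩
      have h3 := hmid 0 (by simp) (2 * y) hm
      have h4 := hb (2 * y - 0) (by rw [abs_le]; constructor <;> linarith [hm.1, hm.2])
      have h5 : h (2 * y) ≤ h y := hmax hm
      rw [show (0 + 2 * y) / 2 = y by ring, h0] at h3
      linarith
    · have hm : 2 * y - 1 ∈ Icc (0 : ℝ) 1 := ⟨by linarith, by linarith [hy.2]⟩
      have h3 := hmid (2 * y - 1) hm 1 (by simp)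
      have h4 := hb (1 - (2 * y - 1)) (by rw [abs_le]; constructor <;> linarith [hm.1, hm.2])
      have h5 : h (2 * y - 1) ≤ h y := hmax hm
      rw [show (2 * y - 1 + 1) / 2 = y by ring, h1] at h3
      linarith
  set ψ : ℝ → ℝ := fun y => 2 * (K + B) * y - B * y ^ (1 + α) with hψ
  have hψc : ContinuousOn ψ (Icc 0 1) := by
    have : Continuous fun y : ℝ => y ^ (1 + α) := Real.continuous_rpow_const (by linarith)
    exact (by fun_prop : Continuous ψ).continuousOn
  have hle : ∀ y ∈ Icc (0 : ℝ) 1, h y - ψ y ≤ 0 := by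
    obtain ⟨y, hy, hmax⟩ := isCompact_Icc.exists_isMaxOn hne (hc.sub hψc)
    suffices hyK : h y - ψ y ≤ 0 from fun y' hy' => (hmax hy').trans hyK
    rcases le_total y (1 / 2) with hy2 | hy2
    · have hm : 2 * y ∈ Icc (0 : ℝ) 1 := ⟨by linarith [hy.1], by linarith⟩
      have h3 := hmid 0 (by simp) (2 * y) hm
      have h5 : h (2 * y) - ψ (2 * y) ≤ h y - ψ y := hmax hm
      rw [show (0 + 2 * y) / 2 = y by ring, h0, sub_zero, abs_of_nonneg hm.1,
        Real.mul_rpow (by norm_num) hy.1, Real.rpow_add (by norm_num), Real.rpow_one] at h3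
      have e1 : ψ (2 * y) = 4 * (K + B) * y - B * (2 * 2 ^ α * y ^ (1 + α)) := by
        simp only [hψ]
        rw [Real.mul_rpow (by norm_num) hy.1, Real.rpow_add (x := 2) (by norm_num),
          Real.rpow_one]
        ring
      -- This identity is what determines `B`.
      have e2 : B * 2 ^ α - B = K * 2 ^ α := by
        rw [hB]; field_simp
      have e3 : ψ (2 * y) = 2 * ψ y - 2 * (K * 2 ^ α) * y ^ (1 + α) := by
        rw [e1, ← e2]; simp only [hψ]; ring
      linarith
    · have h3 := hhK y hy
      have h4 : B * y ^ (1 + α) ≤ B * y := by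
        gcongr
        conv_rhs => rw [← Real.rpow_one y]
        exact Real.rpow_le_rpow_of_exponent_ge (by linarith) hy.2 (by linarith)
      have h5 : B * y ≤ B * 1 := by gcongr; exact hy.2
      simp only [hψ]
      nlinarith
  have h3 := hle x hx
  have h4 : 0 ≤ B * x ^ (1 + α) := mul_nonneg hB0 (Real.rpow_nonneg hx.1 _)
  have e : 2 * (1 + 2 ^ α / (2 ^ α - 1)) * K * x = 2 * (K + B) * x := by rw [hB]; ring
  rw [e]
  simp only [hψ] at h3
  linarith

/-- Midpoint semiconcavity implies semiconcavity, with a multiple of the modulus. -/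
lemma semiconcave_of_midpoint {w : ℝ × ℝ → ℝ} (hw : Continuous w) {α C : ℝ} (hα : 0 < α)
    (hC : 0 ≤ C) {p q : ℝ × ℝ}
    (hmid : ∀ z ∈ segment ℝ p q, ∀ e, w (z + e) + w (z - e) - 2 * w z ≤ C * ‖e‖ ^ (1 + α))
    {l : ℝ} (hl : l ∈ Icc (0 : ℝ) 1) :
    l * w p + (1 - l) * w q - w (l • p + (1 - l) • q) ≤
      l * (1 - l) * (midpointConst α * C * ‖p - q‖ ^ (1 + α)) := by
  set K := C * ‖p - q‖ ^ (1 + α) with hKdef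
  have hK : 0 ≤ K := by positivity
  let h : ℝ → ℝ := fun x => x * w p + (1 - x) * w q - w (x • p + (1 - x) • q)
  have hc : Continuous h := by fun_prop
  have h0 : h 0 = 0 := by simp [h]
  have h1 : h 1 = 0 := by simp [h]
  have hm : ∀ a ∈ Icc (0 : ℝ) 1, ∀ b ∈ Icc (0 : ℝ) 1,
      2 * h ((a + b) / 2) ≤ h a + h b + K * |b - a| ^ (1 + α) := by
    intro a ha b hb
    have hseg : ((a + b) / 2) • p + (1 - (a + b) / 2) • q ∈ segment ℝ p q :=
      ⟨(a + b) / 2, 1 - (a + b) / 2, by linarith [ha.1, hb.1], by linarith [ha.2, hb.2],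
        by ring, rfl⟩
    have h2 := hmid _ hseg (((a - b) / 2) • (p - q))
    have e1 : ((a + b) / 2) • p + (1 - (a + b) / 2) • q + ((a - b) / 2) • (p - q) =
        a • p + (1 - a) • q := by
      ext <;> simp <;> ring
    have e2 : ((a + b) / 2) • p + (1 - (a + b) / 2) • q - ((a - b) / 2) • (p - q) =
        b • p + (1 - b) • q := by
      ext <;> simp <;> ring
    rw [e1, e2] at h2
    have h3 : ‖((a - b) / 2) • (p - q)‖ ^ (1 + α) ≤ |b - a| ^ (1 + α) * ‖p - q‖ ^ (1 + α) := by
      rw [norm_smul, Real.mul_rpow (norm_nonneg _) (norm_nonneg _), Real.norm_eq_abs, abs_div,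
        abs_sub_comm]
      gcongr
      rw [abs_two]
      linarith [abs_nonneg (b - a)]
    have h4 : C * ‖((a - b) / 2) • (p - q)‖ ^ (1 + α) ≤ K * |b - a| ^ (1 + α) := by
      calc _ ≤ C * (|b - a| ^ (1 + α) * ‖p - q‖ ^ (1 + α)) := by gcongr
        _ = _ := by rw [hKdef]; ring
    simp only [h]
    linarith
  have hA := le_mul_of_midpoint hα hK hc.continuousOn h0 h1 hm hl
  have hB := le_mul_of_midpoint (h := fun x => h (1 - x)) (x := 1 - l) hα hK
    (by fun_prop) (by simpa using h1) (by simpa using h0) (by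
      intro a ha b hb
      have := hm (1 - a) ⟨by linarith [ha.2], by linarith [ha.1]⟩ (1 - b)
        ⟨by linarith [hb.2], by linarith [hb.1]⟩
      rw [show (1 - a + (1 - b)) / 2 = 1 - (a + b) / 2 by ring,
        show 1 - b - (1 - a) = -(b - a) by ring, abs_neg] at this
      exact this) ⟨by linarith [hl.2], by linarith [hl.1]⟩
  simp only [sub_sub_cancel] at hB
  change h l ≤ _
  have hA' : 0 ≤ 2 * (1 + 2 ^ α / (2 ^ α - 1)) * K := by
    have := midpointConst_nonneg hα
    unfold midpointConst at this
    nlinarith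
  have e : l * (1 - l) * (midpointConst α * C * ‖p - q‖ ^ (1 + α)) =
      2 * (2 * (1 + 2 ^ α / (2 ^ α - 1)) * K) * (l * (1 - l)) := by
    rw [hKdef, midpointConst]; ring
  rw [e]
  set A := 2 * (1 + 2 ^ α / (2 ^ α - 1)) * K
  -- The bounds from the two endpoints are linear in `l` and in `1 - l`. The smaller of these is at
  -- most `2 * l * (1 - l)`, which doubles the constant.
  rcases le_total l (1 / 2) with hl2 | hl2
  · nlinarith [mul_nonneg hA' hl.1]
  · nlinarith [mul_nonneg hA' (show 0 ≤ 1 - l by linarith [hl.2])]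

/-! ### Differentiability from two-sided second differences -/

/-- Semiconcavity on a set with power modulus. -/
def SemiconcaveOn (s : Set (ℝ × ℝ)) (α C : ℝ) (w : ℝ × ℝ → ℝ) : Prop :=
  ∀ p ∈ s, ∀ q ∈ s, ∀ l ∈ Icc (0 : ℝ) 1,
    l * w p + (1 - l) * w q - w (l • p + (1 - l) • q) ≤ l * (1 - l) * (C * ‖p - q‖ ^ (1 + α))

lemma SemiconcaveOn.second_diff_le {α C : ℝ} {w : ℝ × ℝ → ℝ} {s : Set (ℝ × ℝ)} {z y : ℝ × ℝ}
    (hw : SemiconcaveOn s α C w) (hα : α ≤ 1) (hC : 0 ≤ C)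
    (h1 : z + y ∈ s) (h2 : z - y ∈ s) :
    w (z + y) + w (z - y) - 2 * w z ≤ 2 * C * ‖y‖ ^ (1 + α) := by
  have h := hw _ h1 _ h2 (1 / 2) ⟨by norm_num, by norm_num⟩
  have e1 : (1 / 2 : ℝ) • (z + y) + (1 - 1 / 2 : ℝ) • (z - y) = z := by ext <;> simp <;> ring
  have e2 : z + y - (z - y) = (2 : ℝ) • y := by ext <;> simp <;> ring
  rw [e1, e2, norm_smul, Real.mul_rpow (norm_nonneg _) (norm_nonneg _)] at h
  have h3 : ‖(2 : ℝ)‖ ^ (1 + α) ≤ 4 := by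
    rw [Real.norm_two]
    calc (2 : ℝ) ^ (1 + α) ≤ 2 ^ (2 : ℝ) := by
          gcongr
          · norm_num
          · linarith
      _ = 4 := by norm_num
  have h4 : C * (‖(2 : ℝ)‖ ^ (1 + α) * ‖y‖ ^ (1 + α)) ≤ C * (4 * ‖y‖ ^ (1 + α)) := by gcongr
  linarith

/-- A semiconcave function whose second differences at `z` are bounded below has a directional
expansion at `z`. -/
lemma SemiconcaveOn.exists_directional {α C r : ℝ} {w : ℝ × ℝ → ℝ} {z e : ℝ × ℝ}
    (hw : SemiconcaveOn (Metric.closedBall z r) α C w) (hα : α ≤ 1) (hα0 : 0 < α) (hC : 0 ≤ C)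
    (hr : 0 < r) (he : ‖e‖ = 1)
    (hlow : ∀ y, ‖y‖ ≤ r → -(C * ‖y‖ ^ (1 + α)) ≤ w (z + y) + w (z - y) - 2 * w z) :
    ∃ a : ℝ, ∀ h : ℝ, |h| ≤ r → |w (z + h • e) - w z - a * h| ≤ 6 * C * |h| ^ (1 + α) := by
  have hmem : ∀ y : ℝ × ℝ, ‖y‖ ≤ r → z + y ∈ Metric.closedBall z r := fun y hy => by
    simpa using hy
  have hmem' : ∀ y : ℝ × ℝ, ‖y‖ ≤ r → z - y ∈ Metric.closedBall z r := fun y hy => by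
    rw [sub_eq_add_neg]; exact hmem _ (by rwa [norm_neg])
  have hn : ∀ h : ℝ, 0 < h → ‖h • e‖ = h := fun h hh => by
    rw [norm_smul, he, mul_one, Real.norm_eq_abs, abs_of_pos hh]
  have hz : z ∈ Metric.closedBall z r := Metric.mem_closedBall_self hr.le
  have hp : ∀ h : ℝ, 0 < h → h ^ (1 + α) = h * h ^ α := fun h hh => by
    rw [Real.rpow_add hh, Real.rpow_one]
  -- Forward and backward difference quotients. Semiconcavity makes each almost monotone, and the
  -- second differences keep them close to each other.
  let D : ℝ → ℝ := fun h => (w (z + h • e) - w z) / h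
  let D' : ℝ → ℝ := fun h => (w z - w (z - h • e)) / h
  have hD : ∀ h, 0 < h → w (z + h • e) - w z = h * D h := fun h hh => by
    simp only [D]; field_simp
  have hD' : ∀ h, 0 < h → w z - w (z - h • e) = h * D' h := fun h hh => by
    simp only [D']; field_simp
  have mono : ∀ k h : ℝ, 0 < k → k ≤ h → h ≤ r → D h - D k ≤ C * h ^ α := by
    intro k h hk hkh hhr
    have hh : 0 < h := hk.trans_le hkh
    have h1 := hw (z + h • e) (hmem _ (by rwa [hn h hh])) z hz (k / h)
      ⟨by positivity, (div_le_one hh).2 hkh⟩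
    have e1 : (k / h) • (z + h • e) + (1 - k / h) • z = z + k • e := by
      ext <;> simp <;> field_simp <;> ring
    rw [e1, add_sub_cancel_left, hn h hh, hp h hh] at h1
    have h2 := hD h hh
    have h3 := hD k hk
    have h4 : k / h * (1 - k / h) * (C * (h * h ^ α)) ≤ k * (C * h ^ α) := by
      have e2 : k / h * (1 - k / h) * (C * (h * h ^ α)) = k * (C * h ^ α) * (1 - k / h) := by
        field_simp
      rw [e2]
      refine mul_le_of_le_one_right (by positivity) ?_
      have : 0 ≤ k / h := by positivity
      linarith
    have e3 : k / h * w (z + h • e) + (1 - k / h) * w z - w (z + k • e) =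
        k / h * (w (z + h • e) - w z) - (w (z + k • e) - w z) := by ring
    rw [e3, h2, h3, show k / h * (h * D h) = k * D h by field_simp] at h1
    have : k * (D h - D k) ≤ k * (C * h ^ α) := by linarith
    exact le_of_mul_le_mul_left this hk
  have mono' : ∀ k h : ℝ, 0 < k → k ≤ h → h ≤ r → D' k - D' h ≤ C * h ^ α := by
    intro k h hk hkh hhr
    have hh : 0 < h := hk.trans_le hkh
    have h1 := hw (z - h • e) (hmem' _ (by rwa [hn h hh])) z hz (k / h)
      ⟨by positivity, (div_le_one hh).2 hkh⟩
    have e1 : (k / h) • (z - h • e) + (1 - k / h) • z = z - k • e := by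
      ext <;> simp <;> field_simp <;> ring
    rw [e1, sub_sub_cancel_left, norm_neg, hn h hh, hp h hh] at h1
    have h2 := hD' h hh
    have h3 := hD' k hk
    have h4 : k / h * (1 - k / h) * (C * (h * h ^ α)) ≤ k * (C * h ^ α) := by
      have e2 : k / h * (1 - k / h) * (C * (h * h ^ α)) = k * (C * h ^ α) * (1 - k / h) := by
        field_simp
      rw [e2]
      refine mul_le_of_le_one_right (by positivity) ?_
      have : 0 ≤ k / h := by positivity
      linarith
    have e3 : k / h * w (z - h • e) + (1 - k / h) * w z - w (z - k • e) =
        (w z - w (z - k • e)) - k / h * (w z - w (z - h • e)) := by ring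
    rw [e3, h2, h3, show k / h * (h * D' h) = k * D' h by field_simp] at h1
    have : k * (D' k - D' h) ≤ k * (C * h ^ α) := by linarith
    exact le_of_mul_le_mul_left this hk
  have low : ∀ h : ℝ, 0 < h → h ≤ r → -(C * h ^ α) ≤ D h - D' h ∧
      D h - D' h ≤ 2 * C * h ^ α := by
    intro h hh hhr
    have h1 := hlow (h • e) (by rwa [hn h hh])
    have h2 := hw.second_diff_le hα hC (hmem (h • e) (by rwa [hn h hh]))
      (hmem' (h • e) (by rwa [hn h hh]))
    have e1 : w (z + h • e) + w (z - h • e) - 2 * w z = h * (D h - D' h) := by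
      rw [mul_sub, ← hD h hh, ← hD' h hh]; ring
    rw [e1, hn h hh, hp h hh] at h1 h2
    constructor
    · have : h * -(C * h ^ α) ≤ h * (D h - D' h) := by linarith
      exact le_of_mul_le_mul_left this hh
    · have : h * (D h - D' h) ≤ h * (2 * C * h ^ α) := by linarith
      exact le_of_mul_le_mul_left this hh
  -- One side is almost monotonicity of `D`. The other passes from `D` to `D'` at `k` (cost `2`),
  -- along `D'` to `h` (cost `1`), and back to `D` (cost `1`).
  have cau : ∀ k h : ℝ, 0 < k → k ≤ h → h ≤ r → |D k - D h| ≤ 4 * C * h ^ α := by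
    intro k h hk hkh hhr
    have hh : 0 < h := hk.trans_le hkh
    have h1 := mono k h hk hkh hhr
    have h2 := mono' k h hk hkh hhr
    have h3 := low k hk (hkh.trans hhr)
    have h4 := low h hh hhr
    have h5 : 2 * C * k ^ α ≤ 2 * C * h ^ α := by gcongr
    have h6 : 0 ≤ C * h ^ α := by positivity
    rw [abs_le]
    constructor <;> linarith
  let k : ℕ → ℝ := fun n => r / (n + 1)
  have hk0 : ∀ n, 0 < k n := fun n => by simp only [k]; positivity
  have hkr : ∀ n, k n ≤ r := fun n => div_le_self hr.le (by simp)
  have hkanti : ∀ m n, m ≤ n → k n ≤ k m := fun m n hmn => by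
    simp only [k]; gcongr
  have hklim : Tendsto k atTop (𝓝 0) := by
    have := (tendsto_one_div_add_atTop_nhds_zero_nat (𝕜 := ℝ)).const_mul r
    simpa [k, div_eq_mul_inv] using this
  have hcs : CauchySeq fun n => D (k n) := by
    refine cauchySeq_of_le_tendsto_0' (fun n => 4 * C * k n ^ α) (fun m n hmn => ?_) ?_
    · rw [Real.dist_eq, abs_sub_comm]
      exact cau _ _ (hk0 n) (hkanti m n hmn) (hkr m)
    · have := (hklim.rpow_const (p := α) (Or.inr hα0.le)).const_mul (4 * C)
      simpa [Real.zero_rpow hα0.ne'] using this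
  obtain ⟨a, ha⟩ := cauchySeq_tendsto_of_complete hcs
  have hDa : ∀ h, 0 < h → h ≤ r → |D h - a| ≤ 4 * C * h ^ α := by
    intro h hh hhr
    rw [abs_sub_comm]
    refine le_of_tendsto ((ha.sub_const (D h)).abs) ?_
    filter_upwards [hklim.eventually_le_const hh] with n hn
    exact cau _ _ (hk0 n) hn hhr
  refine ⟨a, fun h hh => ?_⟩
  rcases lt_trichotomy h 0 with hneg | rfl | hpos
  · have hh' : 0 < -h := by linarith
    rw [abs_of_neg hneg] at hh ⊢
    have h1 := abs_le.1 (hDa (-h) hh' hh)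
    have h2 := low (-h) hh' hh
    have h3 := hD' (-h) hh'
    rw [neg_smul, sub_neg_eq_add] at h3
    have h6 : 0 ≤ C * (-h) ^ α := by positivity
    have e1 : w (z + h • e) - w z - a * h = -h * (a - D' (-h)) := by linarith
    rw [e1, hp _ hh', abs_mul, abs_of_pos hh', mul_left_comm]
    gcongr
    rw [abs_le]
    constructor <;> linarith
  · simp
    have : (0 : ℝ) ^ (1 + α) = 0 := Real.zero_rpow (by linarith)
    rw [this, mul_zero]
  · rw [abs_of_pos hpos] at hh ⊢
    have h1 := hDa h hpos hh
    have e1 : w (z + h • e) - w z - a * h = h * (D h - a) := by rw [hD h hpos]; ring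
    have h6 : 0 ≤ C * h ^ α := by positivity
    rw [e1, hp _ hpos, abs_mul, abs_of_pos hpos, mul_left_comm]
    gcongr
    linarith

/-- Expansions along the two axes suffice: `z + y` is the midpoint of points on the axes through
`z`, so semiconcavity bounds `w (z + y)` below. The upper bound is the lower bound at `-y` combined
with the second difference. -/
lemma SemiconcaveOn.exists_expansion {α C r : ℝ} {w : ℝ × ℝ → ℝ} {z : ℝ × ℝ}
    (hw : SemiconcaveOn (Metric.closedBall z r) α C w) (hα : α ≤ 1) (hα0 : 0 < α) (hC : 0 ≤ C)
    (hr : 0 < r)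
    (hlow : ∀ y, ‖y‖ ≤ r → -(C * ‖y‖ ^ (1 + α)) ≤ w (z + y) + w (z - y) - 2 * w z) :
    ∃ A : ℝ × ℝ →L[ℝ] ℝ, ∀ y, ‖y‖ ≤ r / 2 →
      |w (z + y) - w z - A y| ≤ 30 * C * ‖y‖ ^ (1 + α) := by
  obtain ⟨a, ha⟩ := hw.exists_directional hα hα0 hC hr (e := (1, 0)) (by simp [Prod.norm_def])
    hlow
  obtain ⟨b, hb⟩ := hw.exists_directional hα hα0 hC hr (e := (0, 1)) (by simp [Prod.norm_def])
    hlow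
  have h4 : (2 : ℝ) ^ (1 + α) ≤ 4 := by
    calc (2 : ℝ) ^ (1 + α) ≤ 2 ^ (2 : ℝ) := by
          gcongr
          · norm_num
          · linarith
      _ = 4 := by norm_num
  let A : ℝ × ℝ →L[ℝ] ℝ := a • ContinuousLinearMap.fst ℝ ℝ ℝ + b • ContinuousLinearMap.snd ℝ ℝ ℝ
  have hA : ∀ y : ℝ × ℝ, A y = a * y.1 + b * y.2 := fun y => by simp [A]
  have hmem : ∀ y : ℝ × ℝ, ‖y‖ ≤ r → z + y ∈ Metric.closedBall z r := fun y hy => by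
    simpa using hy
  have lower : ∀ y : ℝ × ℝ, ‖y‖ ≤ r / 2 →
      w z + A y - 25 * C * ‖y‖ ^ (1 + α) ≤ w (z + y) := by
    intro y hy
    have hy1 : |y.1| ≤ ‖y‖ := norm_fst_le y
    have hy2 : |y.2| ≤ ‖y‖ := norm_snd_le y
    have bound : ∀ c : ℝ, |c| ≤ ‖y‖ → |2 * c| ≤ r ∧
        6 * C * |2 * c| ^ (1 + α) ≤ 24 * C * ‖y‖ ^ (1 + α) := by
      intro c hc
      rw [abs_mul, abs_two]
      refine ⟨by linarith, ?_⟩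
      rw [Real.mul_rpow (by norm_num) (abs_nonneg _)]
      calc 6 * C * (2 ^ (1 + α) * |c| ^ (1 + α)) ≤ 6 * C * (4 * ‖y‖ ^ (1 + α)) := by gcongr
        _ = _ := by ring
    have b1 := bound y.1 hy1
    have b2 := bound y.2 hy2
    have h1 := abs_le.1 (ha (2 * y.1) b1.1)
    have h2 := abs_le.1 (hb (2 * y.2) b2.1)
    have h3 := hw (z + (2 * y.1) • (1, 0)) (hmem _ (by
        rw [norm_smul]; simpa [Prod.norm_def] using b1.1))
      (z + (2 * y.2) • (0, 1)) (hmem _ (by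
        rw [norm_smul]; simpa [Prod.norm_def] using b2.1)) (1 / 2) ⟨by norm_num, by norm_num⟩
    have e1 : (1 / 2 : ℝ) • (z + (2 * y.1) • ((1 : ℝ), (0 : ℝ))) +
        (1 - 1 / 2 : ℝ) • (z + (2 * y.2) • ((0 : ℝ), (1 : ℝ))) = z + y := by
      ext <;> simp <;> ring
    have e2 : ‖z + (2 * y.1) • ((1 : ℝ), (0 : ℝ)) - (z + (2 * y.2) • ((0 : ℝ), (1 : ℝ)))‖ =
        2 * ‖y‖ := by
      have : z + (2 * y.1) • ((1 : ℝ), (0 : ℝ)) - (z + (2 * y.2) • ((0 : ℝ), (1 : ℝ))) =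
          (2 : ℝ) • (y.1, -y.2) := by ext <;> simp
      rw [this, norm_smul]
      simp [Prod.norm_def]
    rw [e1, e2, Real.mul_rpow (by norm_num) (norm_nonneg _)] at h3
    have h5 : C * (2 ^ (1 + α) * ‖y‖ ^ (1 + α)) ≤ C * (4 * ‖y‖ ^ (1 + α)) := by gcongr
    rw [hA]
    linarith
  refine ⟨A, fun y hy => ?_⟩
  have h1 := lower y hy
  have h2 := lower (-y) (by rwa [norm_neg])
  have h3 := hw.second_diff_le hα hC (hmem y (by linarith)) (z := z) (y := y) (by
    rw [sub_eq_add_neg]; exact hmem _ (by rw [norm_neg]; linarith))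
  rw [norm_neg, ← sub_eq_add_neg, map_neg] at h2
  have : 0 ≤ C * ‖y‖ ^ (1 + α) := by positivity
  rw [abs_le]
  constructor <;> linarith

/-- Divide the semiconcavity inequality between `x` and `x + y` by the weight `t` of `x + y` and let
`t` tend to `0`. -/
lemma SemiconcaveOn.le_of_hasFDerivAt {α C r : ℝ} {w : ℝ × ℝ → ℝ} {x : ℝ × ℝ}
    {A : ℝ × ℝ →L[ℝ] ℝ} (hw : SemiconcaveOn (Metric.closedBall x r) α C w) (hC : 0 ≤ C)
    (hA : HasFDerivAt w A x) {y : ℝ × ℝ} (hy : ‖y‖ ≤ r) :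
    w (x + y) ≤ w x + A y + C * ‖y‖ ^ (1 + α) := by
  have hr : 0 ≤ r := (norm_nonneg _).trans hy
  have h1 : HasDerivAt (fun t : ℝ => w (x + t • y)) (A y) 0 := hA.hasLineDerivAt y
  have h2 := h1.tendsto_slope_zero_right
  simp only [zero_add, zero_smul, add_zero, smul_eq_mul] at h2
  have h3 : w (x + y) - w x - C * ‖y‖ ^ (1 + α) ≤ A y := by
    refine ge_of_tendsto h2 ?_
    filter_upwards [Ioo_mem_nhdsGT (show (0 : ℝ) < 1 by norm_num)] with t ht
    have h4 := hw (x + y) (by simpa using hy) x (Metric.mem_closedBall_self hr) t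
      ⟨ht.1.le, ht.2.le⟩
    have e1 : t • (x + y) + (1 - t) • x = x + t • y := by ext <;> simp <;> ring
    rw [e1, add_sub_cancel_left] at h4
    have h5 : t * (1 - t) * (C * ‖y‖ ^ (1 + α)) ≤ t * (C * ‖y‖ ^ (1 + α)) := by
      have h6 : 0 ≤ C * ‖y‖ ^ (1 + α) := by positivity
      have h7 : t * (1 - t) ≤ t := by nlinarith [ht.1]
      gcongr
    rw [inv_mul_eq_div, le_div_iff₀ ht.1]
    linarith
  linarith

/-- Comparison of a two-sided expansion at `z` with a one-sided one at a nearby point `x`. -/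
lemma norm_sub_le_of_expansions {α M r d : ℝ} {w : ℝ × ℝ → ℝ} {x z : ℝ × ℝ}
    {A A' : ℝ × ℝ →L[ℝ] ℝ} (hα : α ≤ 1) (hα0 : 0 < α) (hM : 0 ≤ M)
    (hA : ∀ y, ‖y‖ ≤ r → |w (z + y) - w z - A y| ≤ M * ‖y‖ ^ (1 + α))
    (hA' : ∀ y, ‖y‖ ≤ r → w (x + y) ≤ w x + A' y + M * ‖y‖ ^ (1 + α))
    (hd : 0 < d) (hdr : 2 * d ≤ r) (hxz : ‖x - z‖ ≤ d) : ‖A - A'‖ ≤ 6 * M * d ^ α := by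
  have h4 : (2 : ℝ) ^ (1 + α) ≤ 4 := by
    calc (2 : ℝ) ^ (1 + α) ≤ 2 ^ (2 : ℝ) := by
          gcongr
          · norm_num
          · linarith
      _ = 4 := by norm_num
  -- The value at `x + y` is expanded from `z` and from `x`, and the value at `x` from `z`. The
  -- three remainders are at most `4`, `1` and `1` times `M * d ^ (1 + α)`.
  have key : ∀ y, ‖y‖ ≤ d → (A - A') y ≤ 6 * M * d ^ (1 + α) := by
    intro y hy
    have hn : ‖x - z + y‖ ≤ 2 * d := (norm_add_le _ _).trans (by linarith)
    have h1 := abs_le.1 (hA (x - z) (by linarith))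
    have h2 := abs_le.1 (hA (x - z + y) (by linarith))
    have h3 := hA' y (by linarith)
    rw [show z + (x - z + y) = x + y by abel, map_add] at h2
    rw [show z + (x - z) = x by abel] at h1
    have b1 : M * ‖x - z‖ ^ (1 + α) ≤ M * d ^ (1 + α) := by gcongr
    have b2 : M * ‖y‖ ^ (1 + α) ≤ M * d ^ (1 + α) := by gcongr
    have b3 : M * ‖x - z + y‖ ^ (1 + α) ≤ M * (4 * d ^ (1 + α)) := by
      gcongr
      calc ‖x - z + y‖ ^ (1 + α) ≤ (2 * d) ^ (1 + α) := by gcongr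
        _ = 2 ^ (1 + α) * d ^ (1 + α) := Real.mul_rpow (by norm_num) hd.le
        _ ≤ _ := by gcongr
    change A y - A' y ≤ _
    linarith
  refine ContinuousLinearMap.opNorm_le_bound _ (by positivity) fun y => ?_
  rcases eq_or_ne y 0 with rfl | hy
  · simp
  have hy0 : 0 < ‖y‖ := norm_pos_iff.2 hy
  have hs : ‖(d / ‖y‖) • y‖ ≤ d := by
    rw [norm_smul, Real.norm_eq_abs, abs_of_pos (by positivity)]
    field_simp
    exact le_rfl
  have k1 := key _ hs
  have k2 := key (-((d / ‖y‖) • y)) (by rwa [norm_neg])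
  rw [map_neg] at k2
  rw [map_smul, smul_eq_mul] at k1 k2
  have k3 : d / ‖y‖ * |(A - A') y| ≤ 6 * M * d ^ (1 + α) := by
    rw [← abs_of_pos (show 0 < d / ‖y‖ by positivity), ← abs_mul, abs_le]
    constructor <;> linarith
  rw [Real.rpow_add hd, Real.rpow_one, div_mul_eq_mul_div, div_le_iff₀ hy0] at k3
  rw [Real.norm_eq_abs]
  have : d * |(A - A') y| ≤ d * (6 * M * d ^ α * ‖y‖) := by linarith
  exact le_of_mul_le_mul_left this hd

lemma hasFDerivAt_of_expansion {α M r : ℝ} {w : ℝ × ℝ → ℝ} {z : ℝ × ℝ}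
    {A : ℝ × ℝ →L[ℝ] ℝ} (hα0 : 0 < α) (hr : 0 < r)
    (hA : ∀ y, ‖y‖ ≤ r → |w (z + y) - w z - A y| ≤ M * ‖y‖ ^ (1 + α)) : HasFDerivAt w A z := by
  rw [hasFDerivAt_iff_isLittleO_nhds_zero]
  refine Asymptotics.IsLittleO.of_bound fun c hc => ?_
  have h1 : Tendsto (fun y : ℝ × ℝ => M * ‖y‖ ^ α) (𝓝 0) (𝓝 0) := by
    have h2 : Tendsto (fun y : ℝ × ℝ => ‖y‖) (𝓝 0) (𝓝 0) := tendsto_norm_zero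
    have := (h2.rpow_const (p := α) (Or.inr hα0.le)).const_mul M
    simpa [Real.zero_rpow hα0.ne'] using this
  filter_upwards [h1.eventually_le_const hc, Metric.closedBall_mem_nhds 0 hr] with y hy hyr
  refine (hA y (by simpa using hyr)).trans ?_
  rw [Real.rpow_one_add' (norm_nonneg _) (by linarith)]
  nlinarith [norm_nonneg y]

/-- The expansions are uniform on compact sets. Comparing those at two nearby points gives the
Hölder bound of the gradient; for distant points the Lipschitz bound suffices. -/
lemma isLocC1Holder_of_second_diff {Ω : Set (ℝ × ℝ)} (hΩ : IsOpen Ω) {u : ℝ × ℝ → ℝ}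
    {L : NNReal} (hu : LipschitzWith L u) {α : ℝ} (hα : α ≤ 1) (hα0 : 0 < α)
    (hup : ∀ K ⊆ Ω, IsCompact K → ∃ C, 0 ≤ C ∧ ∀ z ∈ K, ∀ e,
      u (z + e) + u (z - e) - 2 * u z ≤ C * ‖e‖ ^ (1 + α))
    (hlow : ∀ K ⊆ Ω, IsCompact K → ∃ C, 0 ≤ C ∧ ∀ z ∈ K, ∀ e,
      -(C * ‖e‖ ^ (1 + α)) ≤ u (z + e) + u (z - e) - 2 * u z) :
    IsLocC1Holder Ω α u := by
  have main : ∀ K ⊆ Ω, IsCompact K → ∃ M r, 0 ≤ M ∧ 0 < r ∧ ∀ z ∈ K, ∃ A : ℝ × ℝ →L[ℝ] ℝ,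
      ∀ y, ‖y‖ ≤ r → |u (z + y) - u z - A y| ≤ M * ‖y‖ ^ (1 + α) := by
    intro K hKΩ hK
    obtain ⟨ρ, hρ, hsubs⟩ := hK.exists_cthickening_subset_open hΩ hKΩ
    obtain ⟨C₁, hC₁, h1⟩ := hup _ hsubs hK.cthickening
    obtain ⟨C₂, hC₂, h2⟩ := hlow _ hsubs hK.cthickening
    have hm := midpointConst_nonneg hα0
    refine ⟨30 * (midpointConst α * C₁ + C₂), ρ / 2, by positivity, by positivity,
      fun z hz => ?_⟩
    have hball := Metric.closedBall_subset_cthickening hz ρ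
    refine SemiconcaveOn.exists_expansion ?_ hα hα0 (by positivity) hρ ?_
    · intro p hp q hq l hl
      have hseg : segment ℝ p q ⊆ Metric.cthickening ρ K :=
        ((convex_closedBall z ρ).segment_subset hp hq).trans hball
      refine (semiconcave_of_midpoint hu.continuous hα0 hC₁
        (fun x hx => h1 x (hseg hx)) hl).trans ?_
      have := hl.1
      have : 0 ≤ 1 - l := by linarith [hl.2]
      gcongr
      linarith
    · intro y _
      refine le_trans ?_ (h2 z (hball (Metric.mem_closedBall_self hρ.le)) y)
      rw [neg_le_neg_iff]
      gcongr
      have : 0 ≤ midpointConst α * C₁ := by positivity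
      linarith
  refine ⟨fun z hz => ?_, fun K hKΩ hK => ?_⟩
  · obtain ⟨M, r, -, hr, h⟩ := main {z} (by simpa using hz) isCompact_singleton
    obtain ⟨A, hA⟩ := h z rfl
    exact (hasFDerivAt_of_expansion hα0 hr hA).differentiableAt.differentiableWithinAt
  · obtain ⟨M, r, hM, hr, h⟩ := main K hKΩ hK
    have hfd : ∀ z ∈ K, ∀ y, ‖y‖ ≤ r →
        |u (z + y) - u z - fderiv ℝ u z y| ≤ M * ‖y‖ ^ (1 + α) := by
      intro z hz
      obtain ⟨A, hA⟩ := h z hz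
      rwa [(hasFDerivAt_of_expansion hα0 hr hA).fderiv]
    have hfar : 0 ≤ 2 * L * (r / 2) ^ (-α) := by positivity
    refine ⟨6 * M + 2 * L * (r / 2) ^ (-α), fun p hp q hq => ?_⟩
    rcases eq_or_ne p q with rfl | hne
    · simp only [sub_self, norm_zero]
      positivity
    have hpq : 0 < ‖p - q‖ := norm_pos_iff.2 (sub_ne_zero.2 hne)
    have hpow : 0 < ‖p - q‖ ^ α := Real.rpow_pos_of_pos hpq _
    rw [add_mul]
    rcases le_or_gt (2 * ‖p - q‖) r with hsm | hbig
    · have := norm_sub_le_of_expansions hα hα0 hM (hfd p hp)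
        (fun y hy => by linarith [(abs_le.1 (hfd q hq y hy)).2]) hpq hsm
        (by rw [norm_sub_rev])
      nlinarith
    · have h1 := norm_fderiv_le_of_lipschitz ℝ hu (x₀ := p)
      have h2 := norm_fderiv_le_of_lipschitz ℝ hu (x₀ := q)
      have h3 := norm_sub_le (fderiv ℝ u p) (fderiv ℝ u q)
      have h4 : 1 ≤ (r / 2) ^ (-α) * ‖p - q‖ ^ α := by
        rw [Real.rpow_neg (by positivity), inv_mul_eq_div, le_div_iff₀ (by positivity), one_mul]
        gcongr
        linarith
      have h5 : 0 ≤ 6 * M * ‖p - q‖ ^ α := by positivity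
      have h6 : 2 * L * 1 ≤ 2 * L * ((r / 2) ^ (-α) * ‖p - q‖ ^ α) := by gcongr
      linarith

/-! ### Time reversal and lower bounds for second differences -/

/-- The time-reversed function `-u(x, T - t)`, which formally solves an equation of the same
form. -/
def timeReversal (T : ℝ) (u : ℝ × ℝ → ℝ) (p : ℝ × ℝ) : ℝ := -u (p.1, T - p.2)

lemma isOpen_openStrip (T : ℝ) : IsOpen (openStrip T) := isOpen_univ.prod isOpen_Ioo

lemma lipschitzWith_timeReversal {T : ℝ} {u : ℝ × ℝ → ℝ} {L : NNReal} (hu : LipschitzWith L u) :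
    LipschitzWith L (timeReversal T u) := by
  refine LipschitzWith.of_dist_le_mul fun p q => ?_
  have h := hu.dist_le_mul (p.1, T - p.2) (q.1, T - q.2)
  simp only [timeReversal, dist_neg_neg]
  refine h.trans (le_of_eq ?_)
  simp only [Prod.dist_eq, dist_sub_left]

/-- An inequality between the ends of a line has no direction of time: reversal exchanges the ends
and changes `v` to `-v`, which leaves the cost unchanged. The viscosity inequalities have no such
symmetry. -/
lemma SubLine.timeReversal {T : ℝ} {F u : ℝ × ℝ → ℝ} (h : SubLine T F u) :
    SubLine T (fun p => F (p.1, T - p.2)) (timeReversal T u) := by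
  intro x v s t C hs hst ht hC
  have h1 := h (x + v * T) (-v) (T - t) (T - s) C (by linarith) (by linarith) (by linarith)
    (fun r hr => by
      have := hC (T - r) ⟨by linarith [hr.2], by linarith [hr.1]⟩
      simp only [sub_sub_cancel] at this
      rwa [show x + v * T + -v * r = x + v * (T - r) by ring])
  simp only [MFG.timeReversal]
  rw [show x + v * T + -v * (T - t) = x + v * t by ring,
    show x + v * T + -v * (T - s) = x + v * s by ring, neg_sq,
    show T - s - (T - t) = t - s by ring] at h1
  linarith

lemma IsCalibrated.timeReversal {F u : ℝ × ℝ → ℝ} {Λ : NNReal} {γ : ℝ → ℝ} {a b : ℝ}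
    (h : IsCalibrated F u Λ γ a b) (T : ℝ) :
    IsCalibrated (fun p => F (p.1, T - p.2)) (MFG.timeReversal T u) Λ (fun r => γ (T - r))
      (T - b) (T - a) := by
  refine ⟨LipschitzWith.of_dist_le_mul fun r s => ?_, fun s t hs hst ht c hc => ?_⟩
  · refine (h.lipschitz.dist_le_mul _ _).trans (le_of_eq ?_)
    rw [dist_sub_left]
  · have h1 := h.le (T - t) (T - s) (by linarith) (by linarith) (by linarith) c (fun r hr => by
      have := hc (T - r) ⟨by linarith [hr.2], by linarith [hr.1]⟩
      simpa using this)
    rw [show T - s - (T - t) = t - s by ring] at h1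
    simp only [MFG.timeReversal]
    rw [← neg_sq, neg_sub]
    linarith

lemma isLocHolder_timeReversal {T β : ℝ} {F : ℝ × ℝ → ℝ} (hF : IsLocHolder (openStrip T) β F) :
    IsLocHolder (openStrip T) β (fun p => F (p.1, T - p.2)) := by
  intro K hK hKc
  obtain ⟨C, hC⟩ := hF ((fun p : ℝ × ℝ => (p.1, T - p.2)) '' K) (by
    rintro _ ⟨p, hp, rfl⟩
    have := (hK hp).2
    exact ⟨mem_univ _, by constructor <;> linarith [this.1, this.2]⟩)
    (hKc.image (by fun_prop))
  refine ⟨C, fun p hp q hq => ?_⟩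
  have h := hC _ ⟨p, hp, rfl⟩ _ ⟨q, hq, rfl⟩
  simp only at h
  have e : ‖((p.1, T - p.2) - (q.1, T - q.2) : ℝ × ℝ)‖ = ‖p - q‖ := by
    simp [Prod.norm_def, abs_sub_comm]
  rwa [e] at h

/-- A curve that arrives at `z` leaves the reflected point after reversal, and the sign in
`timeReversal` turns the upper bound into a lower one. -/
lemma exists_second_diff_ge {T β τ₀ : ℝ} {F u : ℝ × ℝ → ℝ} {L : NNReal} (Λ : NNReal)
    (hu : LipschitzWith L u) (hsub : SubLine T F u) (hβ : 0 < β) (hβ' : β < 1)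
    (hF : IsLocHolder (openStrip T) β F) {K : Set (ℝ × ℝ)} (hK : IsCompact K)
    (hKT : K ⊆ openStrip T) (hτ₀ : 0 < τ₀) :
    ∃ C, 0 ≤ C ∧ ∀ z ∈ K, ∀ γ, IsCalibrated F u Λ γ (z.2 - τ₀) z.2 → γ z.2 = z.1 →
      ∀ e, -(C * ‖e‖ ^ (1 + β / 2)) ≤ u (z + e) + u (z - e) - 2 * u z := by
  obtain ⟨C, hC, h⟩ := exists_second_diff_le Λ (lipschitzWith_timeReversal (T := T) hu)
    hsub.timeReversal hβ hβ' (isLocHolder_timeReversal hF)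
    (hK.image (show Continuous fun p : ℝ × ℝ => (p.1, T - p.2) by fun_prop)) (by
      rintro _ ⟨p, hp, rfl⟩
      have := (hKT hp).2
      exact ⟨mem_univ _, by constructor <;> linarith [this.1, this.2]⟩) hτ₀
  refine ⟨C, hC, fun z hz γ hγ hγz e => ?_⟩
  have hγ' := hγ.timeReversal T
  rw [show T - (z.2 - τ₀) = T - z.2 + τ₀ by ring] at hγ'
  have h1 := h _ ⟨z, hz, rfl⟩ _ hγ' (by simpa using hγz) (e.1, -e.2)
  have e1 : ‖((e.1, -e.2) : ℝ × ℝ)‖ = ‖e‖ := by simp [Prod.norm_def]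
  rw [e1] at h1
  simp only [timeReversal, Prod.fst_add, Prod.snd_add, Prod.fst_sub, Prod.snd_sub] at h1
  rw [show T - (T - z.2 + -e.2) = z.2 + e.2 by ring, show T - (T - z.2 - -e.2) = z.2 - e.2 by ring,
    sub_sub_cancel] at h1
  have h2 : -u (z + e) + -u (z - e) - 2 * -u z ≤ C * ‖e‖ ^ (1 + β / 2) := h1
  linarith

lemma exists_uniform_time {T : ℝ} {K : Set (ℝ × ℝ)} (hK : IsCompact K)
    (hKT : K ⊆ openStrip T) : ∃ τ > 0, ∀ z ∈ K, τ ≤ z.2 ∧ z.2 + τ ≤ T := by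
  obtain ⟨ρ, hρ, hsubs⟩ := hK.exists_cthickening_subset_open (isOpen_openStrip T) hKT
  refine ⟨ρ, hρ, fun z hz => ?_⟩
  have hball := (Metric.closedBall_subset_cthickening hz ρ).trans hsubs
  have hm1 := hball (show (z.1, z.2 - ρ) ∈ Metric.closedBall z ρ from
    dist_le_of_abs (by simp [hρ.le]) (by simp [abs_of_pos hρ]))
  have hm2 := hball (show (z.1, z.2 + ρ) ∈ Metric.closedBall z ρ from
    dist_le_of_abs (by simp [hρ.le]) (by simp [abs_of_pos hρ]))
  exact ⟨by linarith [hm1.2.1], by linarith [hm2.2.2]⟩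

lemma IsCalibrated.mono {F u : ℝ × ℝ → ℝ} {Λ : NNReal} {γ : ℝ → ℝ} {a b a' b' : ℝ}
    (h : IsCalibrated F u Λ γ a b) (ha : a ≤ a') (hb : b' ≤ b) : IsCalibrated F u Λ γ a' b' :=
  ⟨h.lipschitz, fun s t hs hst ht => h.le s t (ha.trans hs) hst (ht.trans hb)⟩

/-- Regularity when minimizing trajectories leave from, and arrive at, every point. -/
theorem regularity_of_calibrated {T β : ℝ} {F u : ℝ × ℝ → ℝ} {L Λ : NNReal}
    (hu : LipschitzWith L u) (hsub : SubLine T F u) (hβ : 0 < β) (hβ' : β < 1)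
    (hF : IsLocHolder (openStrip T) β F)
    (hfwd : ∀ z ∈ openStrip T, ∃ γ, IsCalibrated F u Λ γ z.2 T ∧ γ z.2 = z.1)
    (hbwd : ∀ z ∈ openStrip T, ∀ a ∈ Ioo 0 z.2, ∃ γ, IsCalibrated F u Λ γ a z.2 ∧ γ z.2 = z.1) :
    IsLocC1Holder (openStrip T) (β / 2) u ∧ IsLocSemiconcave (openStrip T) (β / 2) u ∧
      IsLocSemiconcave (openStrip T) (β / 2) (fun p => -u p) := by
  have hup : ∀ K ⊆ openStrip T, IsCompact K → ∃ C, 0 ≤ C ∧ ∀ z ∈ K, ∀ e,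
      u (z + e) + u (z - e) - 2 * u z ≤ C * ‖e‖ ^ (1 + β / 2) := by
    intro K hKT hK
    obtain ⟨τ, hτ, h⟩ := exists_uniform_time hK hKT
    obtain ⟨C, hC, hz⟩ := exists_second_diff_le Λ hu hsub hβ hβ' hF hK hKT hτ
    refine ⟨C, hC, fun z hzK => ?_⟩
    obtain ⟨γ, hγ, hγz⟩ := hfwd z (hKT hzK)
    exact hz z hzK γ (hγ.mono le_rfl (h z hzK).2) hγz
  have hlow : ∀ K ⊆ openStrip T, IsCompact K → ∃ C, 0 ≤ C ∧ ∀ z ∈ K, ∀ e,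
      -(C * ‖e‖ ^ (1 + β / 2)) ≤ u (z + e) + u (z - e) - 2 * u z := by
    intro K hKT hK
    obtain ⟨τ, hτ, h⟩ := exists_uniform_time hK hKT
    obtain ⟨C, hC, hz⟩ := exists_second_diff_ge Λ hu hsub hβ hβ' hF hK hKT (half_pos hτ)
    refine ⟨C, hC, fun z hzK => ?_⟩
    obtain ⟨γ, hγ, hγz⟩ := hbwd z (hKT hzK) (z.2 - τ / 2)
      ⟨by linarith [(h z hzK).1], by linarith⟩
    exact hz z hzK γ hγ hγz
  have semi : ∀ w : ℝ × ℝ → ℝ, Continuous w → (∀ K ⊆ openStrip T, IsCompact K → ∃ C, 0 ≤ C ∧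
      ∀ z ∈ K, ∀ e, w (z + e) + w (z - e) - 2 * w z ≤ C * ‖e‖ ^ (1 + β / 2)) →
      IsLocSemiconcave (openStrip T) (β / 2) w := by
    intro w hw h K hKT hK
    obtain ⟨C, hC, hz⟩ := h K hKT hK
    refine ⟨midpointConst (β / 2) * C, fun p q hpq l hl => ?_⟩
    refine (semiconcave_of_midpoint hw (half_pos hβ) hC (fun z hzs => hz z (hpq hzs)) hl).trans
      (le_of_eq ?_)
    rw [Real.rpow_one_add' (norm_nonneg _) (by linarith)]
    ring
  refine ⟨isLocC1Holder_of_second_diff (isOpen_openStrip T) hu (by linarith) (half_pos hβ) hup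
    hlow, semi u hu.continuous hup, semi _ hu.continuous.neg fun K hKT hK => ?_⟩
  obtain ⟨C, hC, hz⟩ := hlow K hKT hK
  exact ⟨C, hC, fun z hzK e => by linarith [hz z hzK e]⟩

/-! ### The planning problem: reversing time in the equation -/

/-- If the reversed inequality holds wherever `u` is touched from above, the time reversal of `u`
is a supersolution. -/
lemma isSupersolution_timeReversal {T : ℝ} {F u : ℝ × ℝ → ℝ}
    (h : ∀ φ : ℝ × ℝ → ℝ, ContDiff ℝ 1 φ → ∀ p ∈ openStrip T,
      IsLocalMax (fun q => u q - φ q) p → F p ≤ -dt φ p + (dx φ p) ^ 2 / 2) :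
    IsSupersolution T (fun p => F (p.1, T - p.2)) (timeReversal T u) := by
  intro φ hφ p hp hmin
  have hφ' : ContDiff ℝ 1 (fun q : ℝ × ℝ => -φ (q.1, T - q.2)) :=
    (hφ.comp (contDiff_fst.prodMk (contDiff_const.sub contDiff_snd))).neg
  have h1 := h _ hφ' (p.1, T - p.2)
    ⟨mem_univ _, by constructor <;> linarith [hp.2.1, hp.2.2]⟩ (by
      have hc : Tendsto (fun q : ℝ × ℝ => (q.1, T - q.2)) (𝓝 (p.1, T - p.2)) (𝓝 p) :=
        (show Continuous fun q : ℝ × ℝ => (q.1, T - q.2) by fun_prop).tendsto' _ _ (by simp)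
      filter_upwards [hc.eventually hmin] with q hq
      simp only [timeReversal, sub_sub_cancel] at hq ⊢
      linarith)
  have e1 : dx (fun q : ℝ × ℝ => -φ (q.1, T - q.2)) (p.1, T - p.2) = -dx φ p := by
    simp [dx]
  have e2 : dt (fun q : ℝ × ℝ => -φ (q.1, T - q.2)) (p.1, T - p.2) = dt φ p := by
    have := deriv_comp_const_sub (f := fun s => φ (p.1, s)) T (T - p.2)
    simp only [dt, deriv.fun_neg]
    rw [this]
    simp
  rwa [e1, e2, neg_sq] at h1

lemma exists_calibrated_backward {T : ℝ} {F u : ℝ × ℝ → ℝ} {L : NNReal}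
    (hu : LipschitzWith L u) (hFc : Continuous F)
    (hF : IsSupersolution T (fun p => F (p.1, T - p.2)) (timeReversal T u))
    {z : ℝ × ℝ} (hz : z ∈ openStrip T) :
    ∃ γ, IsCalibrated F u (2 * L) γ 0 z.2 ∧ γ z.2 = z.1 := by
  obtain ⟨γ, hγ, hγz⟩ := hF.exists_calibrated (lipschitzWith_timeReversal hu)
    (hFc.comp (by fun_prop)) (P := (z.1, T - z.2))
    ⟨mem_univ _, by constructor <;> linarith [hz.2.1, hz.2.2]⟩
  have h := hγ.timeReversal T
  have e : timeReversal T (timeReversal T u) = u := by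
    funext p
    simp [timeReversal]
  refine ⟨fun r => γ (T - r), ?_, hγz⟩
  simpa [e, Function.comp_def] using h

lemma hasDerivAt_fst_slice {w : ℝ × ℝ → ℝ} {q : ℝ × ℝ} (h : DifferentiableAt ℝ w q) :
    HasDerivAt (fun y => w (y, q.2)) (fderiv ℝ w q (1, 0)) q.1 :=
  h.hasFDerivAt.comp_hasDerivAt q.1 ((hasDerivAt_id q.1).prodMk (hasDerivAt_const q.1 q.2))

lemma hasDerivAt_snd_slice {w : ℝ × ℝ → ℝ} {q : ℝ × ℝ} (h : DifferentiableAt ℝ w q) :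
    HasDerivAt (fun s => w (q.1, s)) (fderiv ℝ w q (0, 1)) q.2 :=
  h.hasFDerivAt.comp_hasDerivAt q.2 ((hasDerivAt_const q.2 q.1).prodMk (hasDerivAt_id q.2))

lemma dx_eq_fderiv {w : ℝ × ℝ → ℝ} {q : ℝ × ℝ} (h : DifferentiableAt ℝ w q) :
    dx w q = fderiv ℝ w q (1, 0) := (hasDerivAt_fst_slice h).deriv

lemma dt_eq_fderiv {w : ℝ × ℝ → ℝ} {q : ℝ × ℝ} (h : DifferentiableAt ℝ w q) :
    dt w q = fderiv ℝ w q (0, 1) := (hasDerivAt_snd_slice h).deriv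

/-- Uniform limits of classical solutions satisfy the equation wherever they are touched from
above. -/
lemma eq_of_touching_above_of_tendsto {R T θ : ℝ} (hθ : 0 < θ) {u m : ℝ × ℝ → ℝ}
    (hmc : Continuous m) {v n : ℕ → ℝ × ℝ → ℝ}
    (hvn : ∀ k, IsNeumannSolution R T θ (v k) (n k))
    (hv : TendstoUniformlyOn v u atTop (rect R T)) (hn : TendstoUniformlyOn n m atTop (rect R T))
    {φ : ℝ × ℝ → ℝ} (hφ : ContDiff ℝ 1 φ) {p : ℝ × ℝ}
    (hp : p ∈ Ioo (-R) R ×ˢ Ioo 0 T) (hmax : IsLocalMax (fun q => u q - φ q) p) :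
    m p ^ θ = -dt φ p + (dx φ p) ^ 2 / 2 := by
  set O : Set (ℝ × ℝ) := Ioo (-R) R ×ˢ Ioo 0 T with hO
  have hOo : IsOpen O := isOpen_Ioo.prod isOpen_Ioo
  have hOR : O ⊆ rect R T := prod_mono Ioo_subset_Icc_self Ioo_subset_Icc_self
  obtain ⟨r, hr, hball⟩ := Metric.nhds_basis_closedBall.mem_iff.1
    (Filter.inter_mem (hOo.mem_nhds hp) hmax)
  have hballO : Metric.closedBall p r ⊆ O := fun q hq => (hball hq).1
  have hballm : ∀ q ∈ Metric.closedBall p r, u q - φ q ≤ u p - φ p := fun q hq => (hball hq).2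
  have hpB : p ∈ Metric.closedBall p r := Metric.mem_closedBall_self hr.le
  -- The quadratic term makes the maximum at `p` strict, so maximizers for `v k` converge to `p`; it
  -- does not affect the first derivatives there.
  set ψ : ℝ × ℝ → ℝ := fun q => φ q + sqDist p q / (2 * 1) with hψ
  have hψ1 : ContDiff ℝ 1 ψ := hφ.add (contDiff_sqDist_div p _)
  have hψd : Differentiable ℝ ψ := hψ1.differentiable one_ne_zero
  have hex : ∀ k, ∃ q ∈ Metric.closedBall p r,
      IsMaxOn (fun q => v k q - ψ q) (Metric.closedBall p r) q := fun k =>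
    (isCompact_closedBall p r).exists_isMaxOn ⟨p, hpB⟩
      (((hvn k).v_contDiff.continuousOn.mono (hballO.trans hOR)).sub hψ1.continuous.continuousOn)
  choose q hqB hqmax using hex
  have hqp : Tendsto q atTop (𝓝 p) := by
    rw [Metric.tendsto_atTop]
    intro δ hδ
    obtain ⟨N, hN⟩ := eventually_atTop.1 (Metric.tendstoUniformlyOn_iff.1 hv (δ ^ 2 / 4)
      (by positivity))
    refine ⟨N, fun k hk => ?_⟩
    have h1 := hN k hk p (hOR hp)
    have h2 := hN k hk (q k) (hOR (hballO (hqB k)))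
    have h3 : v k p - ψ p ≤ v k (q k) - ψ (q k) := hqmax k hpB
    have h4 := hballm _ (hqB k)
    have h5 := dist_sq_le_sqDist p (q k)
    have h6 : sqDist p p = 0 := by simp [sqDist]
    rw [Real.dist_eq, abs_lt] at h1 h2
    simp only [hψ, h6] at h3
    rw [dist_comm]
    refine lt_of_pow_lt_pow_left₀ 2 hδ.le ?_
    linarith
  have hev : ∀ᶠ k in atTop, n k (q k) ^ θ = -dt ψ (q k) + (dx ψ (q k)) ^ 2 / 2 := by
    filter_upwards [hqp.eventually (Metric.closedBall_mem_nhds p (half_pos hr))] with k hk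
    have hkB : Metric.closedBall p r ∈ 𝓝 (q k) := by
      refine mem_of_superset (Metric.ball_mem_nhds (q k) (half_pos hr)) fun y hy => ?_
      have h1 : dist y (q k) < r / 2 := hy
      have h2 : dist (q k) p ≤ r / 2 := hk
      rw [Metric.mem_closedBall]
      linarith [dist_triangle y (q k) p]
    have hvd : DifferentiableAt ℝ (v k) (q k) :=
      ((hvn k).v_contDiff.contDiffAt (mem_of_superset hkB (hballO.trans hOR))).differentiableAt
        two_ne_zero
    have hloc : IsLocalMax (fun q => v k q - ψ q) (q k) := (hqmax k).isLocalMax hkB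
    -- Since `v k` is differentiable, the full equation holds with the derivatives of `ψ`: contact
    -- from above loses neither inequality.
    have h0 := hloc.fderiv_eq_zero
    rw [fderiv_fun_sub hvd (hψd _), sub_eq_zero] at h0
    rw [← (hvn k).hamiltonJacobi _ (hballO (hqB k)), dx_eq_fderiv hvd, dt_eq_fderiv hvd,
      dx_eq_fderiv (hψd _), dt_eq_fderiv (hψd _), h0]
  have hcd : Continuous (fderiv ℝ ψ) := hψ1.continuous_fderiv one_ne_zero
  have hdxc : Continuous (dx ψ) := by
    rw [show dx ψ = fun q => fderiv ℝ ψ q (1, 0) from funext fun q => dx_eq_fderiv (hψd q)]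
    fun_prop
  have hdtc : Continuous (dt ψ) := by
    rw [show dt ψ = fun q => fderiv ℝ ψ q (0, 1) from funext fun q => dt_eq_fderiv (hψd q)]
    fun_prop
  have hφd : DifferentiableAt ℝ φ p := hφ.differentiable one_ne_zero p
  have hsd : DifferentiableAt ℝ (fun q => sqDist p q / (2 * 1)) p :=
    (contDiff_sqDist_div p _).differentiable one_ne_zero p
  have e1 : dx ψ p = dx φ p := by
    have := (hasDerivAt_fst_slice hφd).add (hasDerivAt_fst_slice hsd)
    have h2 := dx_sqDist_div p p 1
    rw [dx_eq_fderiv hsd] at h2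
    rw [h2] at this
    rw [dx_eq_fderiv hφd]
    rw [sub_self, zero_div, neg_zero, add_zero] at this
    exact this.deriv
  have e2 : dt ψ p = dt φ p := by
    have := (hasDerivAt_snd_slice hφd).add (hasDerivAt_snd_slice hsd)
    have h2 := dt_sqDist_div p p 1
    rw [dt_eq_fderiv hsd] at h2
    rw [h2] at this
    rw [dt_eq_fderiv hφd]
    rw [sub_self, zero_div, neg_zero, add_zero] at this
    exact this.deriv
  have hl1 : Tendsto (fun k => n k (q k) ^ θ) atTop (𝓝 (m p ^ θ)) :=
    (hn.tendsto_comp hmc.continuousWithinAt (tendsto_nhdsWithin_iff.2 ⟨hqp,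
      Eventually.of_forall fun k => hOR (hballO (hqB k))⟩)).rpow_const (Or.inr hθ.le)
  have hl2 : Tendsto (fun k => -dt ψ (q k) + (dx ψ (q k)) ^ 2 / 2) atTop
      (𝓝 (-dt ψ p + (dx ψ p) ^ 2 / 2)) :=
    ((hdtc.tendsto p).comp hqp).neg.add ((((hdxc.tendsto p).comp hqp).pow 2).div_const 2)
  rw [← e1, ← e2]
  exact tendsto_nhds_unique hl1 (hl2.congr' (by filter_upwards [hev] with k hk; exact hk.symm))

/-- In a vacuum region where `u` does not depend on `x`, it does not depend on `t` either. -/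
lemma eq_of_vacuum {T : ℝ} {F u : ℝ × ℝ → ℝ} {Λ : NNReal} (hsub : SubLine T F u)
    (hF0 : ∀ p, 0 ≤ F p)
    (hfwd : ∀ z ∈ openStrip T, ∃ γ, IsCalibrated F u Λ γ z.2 T ∧ γ z.2 = z.1)
    {S : Set ℝ} (hS : ∀ M : ℝ, ∃ x ∈ S, ∀ y, |y - x| ≤ M → y ∈ S)
    (hFS : ∀ x ∈ S, ∀ t ∈ Ioo 0 T, F (x, t) = 0)
    (huS : ∀ x ∈ S, ∀ y ∈ S, ∀ t ∈ Ioo 0 T, u (x, t) = u (y, t)) {x s t : ℝ}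
    (hx : x ∈ S) (hs : s ∈ Ioo 0 T) (ht : t ∈ Ioo 0 T) : u (x, s) = u (x, t) := by
  have key : ∀ s t, s ∈ Ioo 0 T → t ∈ Ioo 0 T → s < t → u (x, s) = u (x, t) := by
    intro s t hs ht hst
    refine le_antisymm ?_ ?_
    · have := hsub x 0 s t 0 hs.1.le hst.le ht.2.le fun r hr => by
        rw [zero_mul, add_zero, hFS x hx r ⟨hs.1.trans_le hr.1, hr.2.trans_lt ht.2⟩]
      simpa using this
    -- Start a minimizing curve so deep inside `S` that it is still in `S` at time `t`. Its cost is
    -- nonnegative and `u` does not depend on the point of `S`.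
    · obtain ⟨y, hy, hyS⟩ := hS (Λ * (t - s))
      obtain ⟨γ, hγ, hγy⟩ := hfwd (y, s) ⟨mem_univ _, hs⟩
      simp only at hγ hγy
      have h1 := hγ.le s t le_rfl hst ht.2.le 0 fun r _ => hF0 _
      have h2 := hγ.abs_sub_le t s
      rw [hγy, abs_of_pos (show 0 < t - s by linarith)] at h2
      have h3 : 0 ≤ (γ t - γ s) ^ 2 / (2 * (t - s)) :=
        div_nonneg (sq_nonneg _) (by linarith)
      rw [huS x hx (γ t) (hyS _ h2) t ht, huS x hx y hy s hs]
      rw [hγy] at h1 h3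
      linarith
  rcases lt_trichotomy s t with h | rfl | h
  · exact key s t hs ht h
  · rfl
  · exact (key t s ht hs h).symm

/-- Only the time direction is used, so the conclusion also holds on the boundary of the vacuum
region. -/
lemma nonneg_of_touching_above_of_vacuum {u φ : ℝ × ℝ → ℝ} {T : ℝ} {p : ℝ × ℝ}
    (hp : p ∈ openStrip T) (hu : ∀ t ∈ Ioo 0 T, u (p.1, p.2) = u (p.1, t))
    (hmax : IsLocalMax (fun q => u q - φ q) p) : 0 ≤ -dt φ p + (dx φ p) ^ 2 / 2 := by
  have hmin : IsLocalMin (fun s => φ (p.1, s)) p.2 := by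
    have hc : Tendsto (fun s : ℝ => (p.1, s)) (𝓝 p.2) (𝓝 p) :=
      (show Continuous fun s : ℝ => (p.1, s) by fun_prop).tendsto' _ _ rfl
    filter_upwards [hc.eventually hmax, isOpen_Ioo.mem_nhds hp.2] with s hs hsT
    have := hu s hsT
    change φ (p.1, p.2) ≤ φ (p.1, s)
    change u (p.1, s) - φ (p.1, s) ≤ u (p.1, p.2) - φ (p.1, p.2) at hs
    linarith
  have h0 : dt φ p = 0 := hmin.deriv_eq_zero
  rw [h0]
  positivity

/-! ### Almost conservation of mass between two lines -/

section Flux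

open MeasureTheory Real

lemma continuous_deriv_smoothTransition : Continuous (deriv smoothTransition) :=
  (smoothTransition.contDiff (n := 1)).continuous_deriv le_rfl

lemma hasDerivAt_smoothTransition (x : ℝ) :
    HasDerivAt smoothTransition (deriv smoothTransition x) x :=
  ((smoothTransition.contDiff (n := 1)).differentiable one_ne_zero x).hasDerivAt

lemma deriv_smoothTransition_nonneg (x : ℝ) : 0 ≤ deriv smoothTransition x :=
  smoothTransition.monotone.deriv_nonneg

lemma deriv_smoothTransition_of_notMem {x : ℝ} (hx : x ∉ Icc (0 : ℝ) 1) :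
    deriv smoothTransition x = 0 := by
  rw [mem_Icc, not_and_or, not_le, not_le] at hx
  have hconst : ∃ c : ℝ, smoothTransition =ᶠ[𝓝 x] fun _ => c := by
    rcases hx with hx | hx
    · refine ⟨0, ?_⟩
      filter_upwards [Iio_mem_nhds hx] with y hy
      exact smoothTransition.zero_of_nonpos (le_of_lt hy)
    · refine ⟨1, ?_⟩
      filter_upwards [Ioi_mem_nhds hx] with y hy
      exact smoothTransition.one_of_one_le (le_of_lt hy)
  obtain ⟨c, hc⟩ := hconst
  rw [hc.deriv_eq, deriv_const]

lemma integral_deriv_smoothTransition : ∫ x in (0 : ℝ)..1, deriv smoothTransition x = 1 := by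
  rw [intervalIntegral.integral_deriv_eq_sub
    (fun x _ => (hasDerivAt_smoothTransition x).differentiableAt)
    (continuous_deriv_smoothTransition.intervalIntegrable _ _)]
  simp

lemma integral_eq_interval_of_support {g : ℝ → ℝ} {a b : ℝ} (hab : a ≤ b)
    (hg : ∀ x, x ∉ Icc a b → g x = 0) : ∫ x, g x = ∫ x in a..b, g x := by
  rw [intervalIntegral.integral_of_le hab, ← integral_Icc_eq_integral_Ioc]
  exact (setIntegral_eq_integral_of_forall_compl_eq_zero hg).symm

/-- A rescaled derivative of the smooth transition acts as an average. -/
lemma integral_deriv_smoothTransition_mul (g : ℝ → ℝ) (a : ℝ) {κ : ℝ} (hκ : 0 < κ) :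
    ∫ r, deriv smoothTransition ((r - a) / κ) / κ * g r =
      ∫ y in (0 : ℝ)..1, deriv smoothTransition y * g (a + κ * y) := by
  have h1 : ∀ r, deriv smoothTransition ((r - a) / κ) / κ * g r =
      (fun r => deriv smoothTransition (r / κ) / κ * g (a + κ * (r / κ))) (r - a) := by
    intro r
    have : a + κ * ((r - a) / κ) = r := by field_simp; ring
    simp only [this]
  simp_rw [h1]
  rw [integral_sub_right_eq_self (fun r => deriv smoothTransition (r / κ) / κ *
    g (a + κ * (r / κ))) a]
  have h2 := Measure.integral_comp_div (fun y => deriv smoothTransition y / κ * g (a + κ * y)) κ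
  rw [h2, abs_of_pos hκ, smul_eq_mul, ← integral_const_mul,
    ← integral_eq_interval_of_support zero_le_one (g := fun y => deriv smoothTransition y *
      g (a + κ * y)) (fun x hx => by rw [deriv_smoothTransition_of_notMem hx, zero_mul])]
  congr 1
  funext y
  field_simp

lemma hasDerivAt_smoothTransition_line (x a v r δ : ℝ) :
    HasDerivAt (fun r => smoothTransition ((x - (a + v * r)) / δ))
      (-v * (deriv smoothTransition ((x - (a + v * r)) / δ) / δ)) r := by
  have h : HasDerivAt (fun r => (x - (a + v * r)) / δ) (-(v * 1) / δ) r :=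
    ((((hasDerivAt_id' r).const_mul v).const_add a).const_sub x).div_const δ
  exact ((hasDerivAt_smoothTransition _).comp r h).congr_deriv (by ring)

lemma hasDerivAt_smoothTransition_shift (x a δ : ℝ) :
    HasDerivAt (fun x => smoothTransition ((x - a) / δ))
      (deriv smoothTransition ((x - a) / δ) / δ) x := by
  have h : HasDerivAt (fun x => (x - a) / δ) (1 / δ) x :=
    ((hasDerivAt_id' x).sub_const a).div_const δ
  exact ((hasDerivAt_smoothTransition _).comp x h).congr_deriv (by ring)

/-- The smoothed signed indicator of the region between two lines. -/
noncomputable def strip (a₁ v₁ a₂ v₂ δ : ℝ) (p : ℝ × ℝ) : ℝ :=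
  smoothTransition ((p.1 - (a₁ + v₁ * p.2)) / δ) - smoothTransition ((p.1 - (a₂ + v₂ * p.2)) / δ)

lemma strip_eq_zero {a₁ v₁ a₂ v₂ δ B : ℝ} {p : ℝ × ℝ} (hδ : 0 < δ)
    (h1 : |a₁ + v₁ * p.2| + δ ≤ B) (h2 : |a₂ + v₂ * p.2| + δ ≤ B) (hp : p.1 ∉ Icc (-B) B) :
    strip a₁ v₁ a₂ v₂ δ p = 0 := by
  have h1' := abs_le.1 (show |a₁ + v₁ * p.2| ≤ B - δ by linarith)
  have h2' := abs_le.1 (show |a₂ + v₂ * p.2| ≤ B - δ by linarith)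
  rw [mem_Icc, not_and_or, not_le, not_le] at hp
  unfold strip
  rcases hp with hp | hp
  · rw [smoothTransition.zero_of_nonpos (div_nonpos_of_nonpos_of_nonneg (by linarith) hδ.le),
      smoothTransition.zero_of_nonpos (div_nonpos_of_nonpos_of_nonneg (by linarith) hδ.le),
      sub_zero]
  · rw [smoothTransition.one_of_one_le ((one_le_div hδ).2 (by linarith)),
      smoothTransition.one_of_one_le ((one_le_div hδ).2 (by linarith)), sub_self]

lemma continuous_strip (a₁ v₁ a₂ v₂ δ : ℝ) : Continuous (strip a₁ v₁ a₂ v₂ δ) := by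
  have := smoothTransition.continuous
  unfold strip
  fun_prop

lemma measurable_dx {w : ℝ × ℝ → ℝ} (hw : Continuous w) : Measurable (dx w) := by
  have h := measurable_deriv_with_param (𝕜 := ℝ) (f := fun t y => w (y, t))
    (by unfold Function.uncurry; fun_prop)
  exact h.comp (measurable_snd.prodMk measurable_fst)

lemma abs_dx_le {w : ℝ × ℝ → ℝ} {L : NNReal} (hw : LipschitzWith L w) (p : ℝ × ℝ) :
    |dx w p| ≤ L := by
  have : LipschitzWith L (fun y => w (y, p.2)) := LipschitzWith.of_dist_le_mul fun y z => by
    simpa [Prod.dist_eq] using hw.dist_le_mul (y, p.2) (z, p.2)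
  exact norm_deriv_le_of_lipschitz this

/-- The continuity equation tested with the smoothed indicator of the region between two lines
along which `u_x` almost equals minus the velocity. -/
lemma abs_integral_deriv_mul_le {T M s₁ s₂ a₁ v₁ a₂ v₂ δ η B : ℝ} {u m : ℝ × ℝ → ℝ} {L : NNReal}
    (hu : LipschitzWith L u) (hm : Continuous m) (hm0 : ∀ p, 0 ≤ m p) (hmM : ∀ p, m p ≤ M)
    (hc : IsContinuitySolution T u m) (hs₁ : 0 < s₁) (hs : s₁ ≤ s₂) (hs₂ : s₂ < T)
    (hδ : 0 < δ) (hη : 0 ≤ η)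
    (hB₁ : ∀ r ∈ Icc s₁ s₂, |a₁ + v₁ * r| + δ ≤ B)
    (hB₂ : ∀ r ∈ Icc s₁ s₂, |a₂ + v₂ * r| + δ ≤ B)
    (h₁ : ∀ᵐ p : ℝ × ℝ, p.2 ∈ Icc s₁ s₂ → |p.1 - (a₁ + v₁ * p.2)| ≤ δ → |v₁ + dx u p| ≤ η)
    (h₂ : ∀ᵐ p : ℝ × ℝ, p.2 ∈ Icc s₁ s₂ → |p.1 - (a₂ + v₂ * p.2)| ≤ δ → |v₂ + dx u p| ≤ η)
    {χ : ℝ → ℝ} (hχ : ContDiff ℝ ∞ χ) (hχ0 : ∀ r, 0 ≤ χ r) (hχ1 : ∀ r, χ r ≤ 1)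
    (hχs : ∀ r, r ∉ Icc s₁ s₂ → χ r = 0) (hχs' : ∀ r, r ∉ Icc s₁ s₂ → deriv χ r = 0) :
    |∫ r, deriv χ r * ∫ x in (-B)..B, m (x, r) * strip a₁ v₁ a₂ v₂ δ (x, r)| ≤
      2 * M * η * (s₂ - s₁) := by
  have hM : 0 ≤ M := (hm0 0).trans (hmM 0)
  have hB : -B ≤ B := by
    have := hB₁ s₁ ⟨le_rfl, hs⟩
    have := abs_nonneg (a₁ + v₁ * s₁)
    linarith
  set W := strip a₁ v₁ a₂ v₂ δ with hW
  have hWc : Continuous W := continuous_strip _ _ _ _ _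
  let S₁ : ℝ × ℝ → ℝ := fun p => deriv smoothTransition ((p.1 - (a₁ + v₁ * p.2)) / δ) / δ
  let S₂ : ℝ × ℝ → ℝ := fun p => deriv smoothTransition ((p.1 - (a₂ + v₂ * p.2)) / δ) / δ
  have hdc := continuous_deriv_smoothTransition
  have hS₁c : Continuous S₁ := by fun_prop
  have hS₂c : Continuous S₂ := by fun_prop
  have hS₁0 : ∀ p, 0 ≤ S₁ p := fun p => div_nonneg (deriv_smoothTransition_nonneg _) hδ.le
  have hS₂0 : ∀ p, 0 ≤ S₂ p := fun p => div_nonneg (deriv_smoothTransition_nonneg _) hδ.le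
  have hSz : ∀ a v : ℝ, (∀ r ∈ Icc s₁ s₂, |a + v * r| + δ ≤ B) → ∀ p : ℝ × ℝ,
      p.2 ∈ Icc s₁ s₂ → p.1 ∉ Icc (-B) B →
      deriv smoothTransition ((p.1 - (a + v * p.2)) / δ) / δ = 0 := by
    intro a v hav p hp2 hp1
    have h1' := abs_le.1 (show |a + v * p.2| ≤ B - δ by linarith [hav p.2 hp2])
    rw [deriv_smoothTransition_of_notMem, zero_div]
    rintro ⟨h3, h4⟩
    rw [div_le_one hδ] at h4
    have h5 : 0 ≤ p.1 - (a + v * p.2) := by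
      by_contra hneg
      exact absurd h3 (not_le.2 (div_neg_of_neg_of_pos (not_le.1 hneg) hδ))
    exact hp1 ⟨by linarith, by linarith⟩
  set box : Set (ℝ × ℝ) := Icc (-B) B ×ˢ Icc s₁ s₂ with hbox
  have hboxc : IsCompact box := isCompact_Icc.prod isCompact_Icc
  have hnot : ∀ p : ℝ × ℝ, p ∉ box → p.2 ∉ Icc s₁ s₂ ∨ (p.2 ∈ Icc s₁ s₂ ∧ p.1 ∉ Icc (-B) B) := by
    intro p hp
    by_cases h : p.2 ∈ Icc s₁ s₂
    · exact Or.inr ⟨h, fun h' => hp ⟨h', h⟩⟩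
    · exact Or.inl h
  have hWz : ∀ p : ℝ × ℝ, p.2 ∈ Icc s₁ s₂ → p.1 ∉ Icc (-B) B → W p = 0 := fun p h2 h1 =>
    strip_eq_zero hδ (hB₁ _ h2) (hB₂ _ h2) h1
  have hχ'c : Continuous (deriv χ) := hχ.continuous_deriv (by simp)
  have hχc : Continuous χ := hχ.continuous
  -- Mass is transported with velocity `-u_x`. The derivative of the strip function along the flow
  -- lives near its two lines, where it is proportional to `v + u_x` and hence small.
  let φ : ℝ × ℝ → ℝ := fun p => χ p.2 * W p
  have hφz : ∀ p, p ∉ box → φ p = 0 := by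
    intro p hp
    rcases hnot p hp with h | ⟨h, h'⟩
    · simp only [φ, hχs _ h, zero_mul]
    · simp only [φ, hWz p h h', mul_zero]
  have hφs : ContDiff ℝ ∞ φ := by
    have hS : ContDiff ℝ ∞ smoothTransition := smoothTransition.contDiff
    refine (hχ.comp contDiff_snd).mul (ContDiff.sub (hS.comp ?_) (hS.comp ?_)) <;> fun_prop
  have hdtφ : ∀ p, dt φ p = deriv χ p.2 * W p + χ p.2 * (-v₁ * S₁ p + v₂ * S₂ p) := by
    intro p
    have h1 : HasDerivAt (fun r => W (p.1, r)) (-v₁ * S₁ p - -v₂ * S₂ p) p.2 :=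
      (hasDerivAt_smoothTransition_line p.1 a₁ v₁ p.2 δ).fun_sub
        (hasDerivAt_smoothTransition_line p.1 a₂ v₂ p.2 δ)
    have h2 := ((hχ.differentiable (by simp) p.2).hasDerivAt.fun_mul h1).deriv
    unfold dt
    rw [h2]
    ring
  have hdxφ : ∀ p, dx φ p = χ p.2 * (S₁ p - S₂ p) := by
    intro p
    have h1 : HasDerivAt (fun x => W (x, p.2)) (S₁ p - S₂ p) p.1 :=
      (hasDerivAt_smoothTransition_shift p.1 (a₁ + v₁ * p.2) δ).fun_sub
        (hasDerivAt_smoothTransition_shift p.1 (a₂ + v₂ * p.2) δ)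
    exact (h1.const_mul (χ p.2)).deriv
  have hzero := hc φ hφs (HasCompactSupport.intro hboxc hφz)
    ((closure_minimal (fun p hp => by
      by_contra h
      exact hp (hφz p h)) hboxc.isClosed).trans fun p hp =>
        ⟨mem_univ _, hs₁.trans_le hp.2.1, hp.2.2.trans_lt hs₂⟩)
  have int_of : ∀ f : ℝ × ℝ → ℝ, Continuous f → (∀ p, p ∉ box → f p = 0) → Integrable f :=
    fun f hf hz => hf.integrable_of_hasCompactSupport (HasCompactSupport.intro hboxc hz)
  have i1 : Integrable fun p : ℝ × ℝ => deriv χ p.2 * (m p * W p) := by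
    refine int_of _ (by fun_prop) fun p hp => ?_
    rcases hnot p hp with h | ⟨h, h'⟩
    · rw [hχs' _ h, zero_mul]
    · rw [hWz p h h', mul_zero, mul_zero]
  have i2 : Integrable fun p : ℝ × ℝ => m p * dt φ p := by
    simp_rw [hdtφ]
    refine int_of _ (by fun_prop) fun p hp => ?_
    rcases hnot p hp with h | ⟨h, h'⟩
    · rw [hχs' _ h, hχs _ h]; ring
    · rw [hWz p h h']
      simp only [S₁, S₂, hSz a₁ v₁ hB₁ p h h', hSz a₂ v₂ hB₂ p h h']
      ring
  have i3' : Integrable fun p : ℝ × ℝ => m p * dx φ p := by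
    simp_rw [hdxφ]
    refine int_of _ (by fun_prop) fun p hp => ?_
    rcases hnot p hp with h | ⟨h, h'⟩
    · rw [hχs _ h]; ring
    · simp only [S₁, S₂, hSz a₁ v₁ hB₁ p h h', hSz a₂ v₂ hB₂ p h h']
      ring
  have i3 : Integrable fun p : ℝ × ℝ => m p * dx u p * dx φ p := by
    have := i3'.bdd_mul (c := L) (measurable_dx hu.continuous).aestronglyMeasurable
      (Eventually.of_forall fun p => abs_dx_le hu p)
    refine this.congr (Eventually.of_forall fun p => ?_)
    simp only
    ring
  have i4 : Integrable fun p : ℝ × ℝ => M * η * (χ p.2 * (S₁ p + S₂ p)) := by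
    refine int_of _ (by fun_prop) fun p hp => ?_
    rcases hnot p hp with h | ⟨h, h'⟩
    · rw [hχs _ h]; ring
    · simp only [S₁, S₂, hSz a₁ v₁ hB₁ p h h', hSz a₂ v₂ hB₂ p h h']
      ring
  have hA : ∫ p : ℝ × ℝ, deriv χ p.2 * (m p * W p) =
      ∫ r, deriv χ r * ∫ x in (-B)..B, m (x, r) * W (x, r) := by
    rw [Measure.volume_eq_prod, integral_prod_symm _ i1]
    congr 1
    funext r
    simp only
    rw [integral_const_mul]
    by_cases hr : r ∈ Icc s₁ s₂
    · rw [integral_eq_interval_of_support hB fun x hx => by rw [hWz (x, r) hr hx, mul_zero]]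
    · rw [hχs' r hr, zero_mul, zero_mul]
  rw [← hA]
  have hA2 : ∫ p : ℝ × ℝ, deriv χ p.2 * (m p * W p) =
      ∫ p : ℝ × ℝ, (deriv χ p.2 * (m p * W p) - (m p * dt φ p - m p * dx u p * dx φ p)) := by
    have i5 : Integrable fun p : ℝ × ℝ => m p * dt φ p - m p * dx u p * dx φ p := i2.sub i3
    rw [integral_sub i1 i5, hzero, sub_zero]
  rw [hA2, ← Real.norm_eq_abs]
  refine (norm_integral_le_of_norm_le i4 ?_).trans ?_
  · filter_upwards [h₁, h₂] with p hp₁ hp₂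
    have e : deriv χ p.2 * (m p * W p) - (m p * dt φ p - m p * dx u p * dx φ p) =
        m p * (χ p.2 * ((v₁ + dx u p) * S₁ p - (v₂ + dx u p) * S₂ p)) := by
      rw [hdtφ, hdxφ]; ring
    have side : ∀ a v : ℝ, (p.2 ∈ Icc s₁ s₂ → |p.1 - (a + v * p.2)| ≤ δ → |v + dx u p| ≤ η) →
        p.2 ∈ Icc s₁ s₂ →
        |(v + dx u p) * (deriv smoothTransition ((p.1 - (a + v * p.2)) / δ) / δ)| ≤
          η * (deriv smoothTransition ((p.1 - (a + v * p.2)) / δ) / δ) := by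
      intro a v hav hr
      have h0 : 0 ≤ deriv smoothTransition ((p.1 - (a + v * p.2)) / δ) / δ :=
        div_nonneg (deriv_smoothTransition_nonneg _) hδ.le
      rw [abs_mul, abs_of_nonneg h0]
      by_cases hin : (p.1 - (a + v * p.2)) / δ ∈ Icc (0 : ℝ) 1
      · refine mul_le_mul_of_nonneg_right (hav hr ?_) h0
        have h3 := hin.1
        have h4 := (div_le_one hδ).1 hin.2
        rw [le_div_iff₀ hδ, zero_mul] at h3
        rwa [abs_of_nonneg h3]
      · rw [deriv_smoothTransition_of_notMem hin]
        simp
    rw [e, norm_mul, norm_mul, Real.norm_eq_abs, Real.norm_eq_abs, Real.norm_eq_abs,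
      abs_of_nonneg (hm0 p), abs_of_nonneg (hχ0 _)]
    by_cases hr : p.2 ∈ Icc s₁ s₂
    · have k1 := side a₁ v₁ hp₁ hr
      have k2 := side a₂ v₂ hp₂ hr
      have k3 : |(v₁ + dx u p) * S₁ p - (v₂ + dx u p) * S₂ p| ≤ η * (S₁ p + S₂ p) := by
        refine (abs_sub _ _).trans ?_
        rw [mul_add]
        exact add_le_add k1 k2
      have hsum : 0 ≤ χ p.2 * (η * (S₁ p + S₂ p)) :=
        mul_nonneg (hχ0 _) (mul_nonneg hη (add_nonneg (hS₁0 p) (hS₂0 p)))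
      calc m p * (χ p.2 * |(v₁ + dx u p) * S₁ p - (v₂ + dx u p) * S₂ p|)
          ≤ m p * (χ p.2 * (η * (S₁ p + S₂ p))) := by
            refine mul_le_mul_of_nonneg_left ?_ (hm0 p)
            exact mul_le_mul_of_nonneg_left k3 (hχ0 _)
        _ ≤ M * (χ p.2 * (η * (S₁ p + S₂ p))) := by
            refine mul_le_mul_of_nonneg_right (hmM p) hsum
        _ = _ := by ring
    · rw [hχs _ hr]
      simp
  · rw [Measure.volume_eq_prod, integral_prod_symm _ i4]
    have hone : ∀ r a v : ℝ,
        ∫ x, deriv smoothTransition ((x - (a + v * r)) / δ) / δ = 1 := by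
      intro r a v
      have := integral_deriv_smoothTransition_mul (fun _ => 1) (a + v * r) hδ
      simpa [integral_deriv_smoothTransition] using this
    -- A nonintegrable function has integral `0` by convention, so the value `1` already proves
    -- integrability.
    have hint : ∀ r a v : ℝ,
        Integrable fun x => deriv smoothTransition ((x - (a + v * r)) / δ) / δ := fun r a v =>
      not_imp_comm.1 integral_undef (by rw [hone]; exact one_ne_zero)
    have hin : ∀ r, ∫ x, M * η * (χ r * (S₁ (x, r) + S₂ (x, r))) = M * η * (χ r * 2) := by
      intro r
      rw [integral_const_mul, integral_const_mul, integral_add (hint r a₁ v₁) (hint r a₂ v₂),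
        hone, hone]
      norm_num
    simp only [hin]
    rw [integral_const_mul, integral_mul_const, integral_eq_interval_of_support hs hχs]
    have hle : ∫ r in s₁..s₂, χ r ≤ s₂ - s₁ := by
      have := intervalIntegral.integral_mono_on (μ := volume) (g := fun _ => (1 : ℝ)) hs
        (hχc.intervalIntegrable s₁ s₂) intervalIntegrable_const fun r _ => hχ1 r
      simpa using this
    have : 0 ≤ M * η := mul_nonneg hM hη
    nlinarith

/-- The smooth cutoff differs from the sharp one only on `[l, l + δ]`. -/
lemma abs_integral_mul_smoothTransition_sub_le {f : ℝ → ℝ} (hf : Continuous f) {M : ℝ}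
    (hfM : ∀ x, |f x| ≤ M) {l δ B : ℝ} (hδ : 0 < δ) (hl : |l| + δ ≤ B) :
    |(∫ x in (-B)..B, f x * smoothTransition ((x - l) / δ)) - ∫ x in l..B, f x| ≤ M * δ := by
  have hl' := abs_le.1 (show |l| ≤ B - δ by linarith)
  have hSc := smoothTransition.continuous
  have hg : Continuous fun x => f x * smoothTransition ((x - l) / δ) := by fun_prop
  rw [← intervalIntegral.integral_add_adjacent_intervals (hg.intervalIntegrable (-B) l)
      (hg.intervalIntegrable l B),
    ← intervalIntegral.integral_add_adjacent_intervals (hg.intervalIntegrable l (l + δ))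
      (hg.intervalIntegrable (l + δ) B),
    ← intervalIntegral.integral_add_adjacent_intervals (hf.intervalIntegrable l (l + δ))
      (hf.intervalIntegrable (l + δ) B)]
  have e1 : ∫ x in (-B)..l, f x * smoothTransition ((x - l) / δ) = 0 := by
    rw [intervalIntegral.integral_congr (g := fun _ => 0), intervalIntegral.integral_zero]
    intro x hx
    rw [uIcc_of_le (by linarith)] at hx
    change f x * smoothTransition ((x - l) / δ) = _
    rw [smoothTransition.zero_of_nonpos
      (div_nonpos_of_nonpos_of_nonneg (by linarith [hx.2]) hδ.le), mul_zero]
  have e2 : ∫ x in (l + δ)..B, f x * smoothTransition ((x - l) / δ) = ∫ x in (l + δ)..B, f x := by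
    refine intervalIntegral.integral_congr fun x hx => ?_
    rw [uIcc_of_le (by linarith)] at hx
    rw [smoothTransition.one_of_one_le ((one_le_div hδ).2 (by linarith [hx.1])), mul_one]
  rw [e1, e2, zero_add, add_sub_add_right_eq_sub, ← intervalIntegral.integral_sub
    (hg.intervalIntegrable _ _) (hf.intervalIntegrable _ _)]
  have := intervalIntegral.norm_integral_le_of_norm_le_const (a := l) (b := l + δ) (C := M)
    (f := fun x => f x * smoothTransition ((x - l) / δ) - f x) (by
      intro x _
      have e : f x * smoothTransition ((x - l) / δ) - f x =
          f x * (smoothTransition ((x - l) / δ) - 1) := by ring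
      rw [e, norm_mul, Real.norm_eq_abs, Real.norm_eq_abs]
      have h1 := smoothTransition.le_one ((x - l) / δ)
      have h2 := smoothTransition.nonneg ((x - l) / δ)
      have h3 : |smoothTransition ((x - l) / δ) - 1| ≤ 1 := by
        rw [abs_le]; constructor <;> linarith
      have := hfM x
      nlinarith [abs_nonneg (f x)])
  rwa [add_sub_cancel_left, abs_of_pos hδ] at this

/-- Almost conservation of the mass between two lines along which `u_x` almost equals minus the
velocity. -/
theorem abs_mass_sub_le {T M s₁ s₂ a₁ v₁ a₂ v₂ δ η : ℝ} {u m : ℝ × ℝ → ℝ} {L : NNReal}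
    (hu : LipschitzWith L u) (hm : Continuous m) (hm0 : ∀ p, 0 ≤ m p) (hmM : ∀ p, m p ≤ M)
    (hc : IsContinuitySolution T u m) (hs₁ : 0 < s₁) (hs : s₁ < s₂) (hs₂ : s₂ < T)
    (hδ : 0 < δ) (hη : 0 ≤ η)
    (h₁ : ∀ᵐ p : ℝ × ℝ, p.2 ∈ Icc s₁ s₂ → |p.1 - (a₁ + v₁ * p.2)| ≤ δ → |v₁ + dx u p| ≤ η)
    (h₂ : ∀ᵐ p : ℝ × ℝ, p.2 ∈ Icc s₁ s₂ → |p.1 - (a₂ + v₂ * p.2)| ≤ δ → |v₂ + dx u p| ≤ η) :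
    |(∫ x in (a₁ + v₁ * s₁)..(a₂ + v₂ * s₁), m (x, s₁)) -
      ∫ x in (a₁ + v₁ * s₂)..(a₂ + v₂ * s₂), m (x, s₂)| ≤ 2 * M * η * (s₂ - s₁) := by
  have hM : 0 ≤ M := (hm0 0).trans (hmM 0)
  refine le_of_forall_pos_le_add_mul (K := 4 * M) fun δ' hδ' => ?_
  -- The smoothing width must tend to `0`, whereas `δ` is the fixed width on which the velocity is
  -- controlled.
  set ε := min δ δ' with hε
  have hε0 : 0 < ε := lt_min hδ hδ'
  set B := |a₁| + |v₁| * T + (|a₂| + |v₂| * T) + ε with hBdef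
  have hT : 0 ≤ T := by linarith
  have hBb : ∀ r ∈ Icc s₁ s₂, |a₁ + v₁ * r| + ε ≤ B ∧ |a₂ + v₂ * r| + ε ≤ B := by
    intro r hr
    have hb : ∀ a v : ℝ, |a + v * r| ≤ |a| + |v| * T := fun a v => by
      refine (abs_add_le _ _).trans ?_
      rw [abs_mul]
      gcongr
      rw [abs_le]
      constructor <;> linarith [hr.1, hr.2]
    have k1 := hb a₁ v₁
    have k2 := hb a₂ v₂
    have k3 : ∀ a v : ℝ, 0 ≤ |a| + |v| * T := fun a v => by positivity
    exact ⟨by linarith [k3 a₂ v₂], by linarith [k3 a₁ v₁]⟩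
  let G : ℝ → ℝ := fun r => ∫ x in (-B)..B, m (x, r) * strip a₁ v₁ a₂ v₂ ε (x, r)
  have hGc : Continuous G := by
    have := continuous_strip a₁ v₁ a₂ v₂ ε
    exact intervalIntegral.continuous_parametric_intervalIntegral_of_continuous'
      (by unfold Function.uncurry; fun_prop) _ _
  have hbound : ∀ κ : ℝ, 0 < κ → 2 * κ ≤ s₂ - s₁ →
      |(∫ y in (0 : ℝ)..1, deriv smoothTransition y * G (s₁ + κ * y)) -
        ∫ y in (0 : ℝ)..1, deriv smoothTransition y * G (s₂ - κ + κ * y)| ≤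
        2 * M * η * (s₂ - s₁) := by
    intro κ hκ hκ2
    -- A time cutoff rising on `[s₁, s₁ + κ]` and falling on `[s₂ - κ, s₂]`; its derivative averages
    -- `G` near the two times, and `κ → 0` gives the difference of the values of `G`.
    let χ : ℝ → ℝ := fun r => smoothTransition ((r - s₁) / κ) -
      smoothTransition ((r - (s₂ - κ)) / κ)
    have hS : ContDiff ℝ ∞ smoothTransition := smoothTransition.contDiff
    have hχd : ∀ r, deriv χ r = deriv smoothTransition ((r - s₁) / κ) / κ -
        deriv smoothTransition ((r - (s₂ - κ)) / κ) / κ := fun r =>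
      ((hasDerivAt_smoothTransition_shift r s₁ κ).fun_sub
        (hasDerivAt_smoothTransition_shift r (s₂ - κ) κ)).deriv
    have hχz : ∀ r, r ∉ Icc s₁ s₂ → χ r = 0 := by
      intro r hr
      rw [mem_Icc, not_and_or, not_le, not_le] at hr
      simp only [χ]
      rcases hr with hr | hr
      · rw [smoothTransition.zero_of_nonpos (div_nonpos_of_nonpos_of_nonneg (by linarith) hκ.le),
          smoothTransition.zero_of_nonpos (div_nonpos_of_nonpos_of_nonneg (by linarith) hκ.le),
          sub_zero]
      · rw [smoothTransition.one_of_one_le ((one_le_div hκ).2 (by linarith)),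
          smoothTransition.one_of_one_le ((one_le_div hκ).2 (by linarith)), sub_self]
    have hmain := abs_integral_deriv_mul_le (a₁ := a₁) (v₁ := v₁) (a₂ := a₂) (v₂ := v₂) (B := B)
      hu hm hm0 hmM hc hs₁ hs.le hs₂ hε0 hη
      (fun r hr => (hBb r hr).1) (fun r hr => (hBb r hr).2)
      (by filter_upwards [h₁] with p hp hp2 hd using hp hp2 (hd.trans (min_le_left _ _)))
      (by filter_upwards [h₂] with p hp hp2 hd using hp hp2 (hd.trans (min_le_left _ _)))
      (χ := χ) (ContDiff.sub (hS.comp (by fun_prop)) (hS.comp (by fun_prop)))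
      (fun r => sub_nonneg.2 (smoothTransition.monotone (by gcongr; linarith)))
      (fun r => by
        have := smoothTransition.le_one ((r - s₁) / κ)
        have := smoothTransition.nonneg ((r - (s₂ - κ)) / κ)
        simp only [χ]
        linarith) hχz
      (fun r hr => by
        have : χ =ᶠ[𝓝 r] fun _ => 0 := by
          filter_upwards [isClosed_Icc.isOpen_compl.mem_nhds hr] with y hy using hχz y hy
        rw [this.deriv_eq, deriv_const])
    simp only [hχd] at hmain
    have hdc := continuous_deriv_smoothTransition
    have hi : ∀ a : ℝ, Integrable fun r => deriv smoothTransition ((r - a) / κ) / κ * G r := by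
      intro a
      refine Continuous.integrable_of_hasCompactSupport (by fun_prop)
        (HasCompactSupport.intro (isCompact_Icc (a := a) (b := a + κ)) fun r hr => ?_)
      rw [deriv_smoothTransition_of_notMem, zero_div, zero_mul]
      rintro ⟨h3, h4⟩
      rw [le_div_iff₀ hκ, zero_mul] at h3
      rw [div_le_one hκ] at h4
      exact hr ⟨by linarith, by linarith⟩
    have e : ∫ r, (deriv smoothTransition ((r - s₁) / κ) / κ -
        deriv smoothTransition ((r - (s₂ - κ)) / κ) / κ) * G r =
        (∫ r, deriv smoothTransition ((r - s₁) / κ) / κ * G r) -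
        ∫ r, deriv smoothTransition ((r - (s₂ - κ)) / κ) / κ * G r := by
      rw [← integral_sub (hi _) (hi _)]
      congr 1
      funext r
      ring
    change |∫ r, (deriv smoothTransition ((r - s₁) / κ) / κ -
        deriv smoothTransition ((r - (s₂ - κ)) / κ) / κ) * G r| ≤ _ at hmain
    rwa [e, integral_deriv_smoothTransition_mul _ _ hκ,
      integral_deriv_smoothTransition_mul _ _ hκ] at hmain
  have hlim : |G s₁ - G s₂| ≤ 2 * M * η * (s₂ - s₁) := by
    have hdc := continuous_deriv_smoothTransition
    have hcont : Continuous fun κ : ℝ =>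
        |(∫ y in (0 : ℝ)..1, deriv smoothTransition y * G (s₁ + κ * y)) -
          ∫ y in (0 : ℝ)..1, deriv smoothTransition y * G (s₂ - κ + κ * y)| := by
      refine ((intervalIntegral.continuous_parametric_intervalIntegral_of_continuous' ?_ _ _).sub
        (intervalIntegral.continuous_parametric_intervalIntegral_of_continuous' ?_ _ _)).abs <;>
      · unfold Function.uncurry
        fun_prop
    have ht := (hcont.tendsto 0).mono_left (nhdsWithin_le_nhds (s := Ioi 0))
    simp only [zero_mul, add_zero, sub_zero, intervalIntegral.integral_mul_const,
      integral_deriv_smoothTransition, one_mul] at ht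
    refine le_of_tendsto ht ?_
    filter_upwards [Ioo_mem_nhdsGT (show (0 : ℝ) < (s₂ - s₁) / 2 by linarith)] with κ hκ
    exact hbound κ hκ.1 (by linarith [hκ.2])
  have hGD : ∀ r ∈ Icc s₁ s₂,
      |G r - ∫ x in (a₁ + v₁ * r)..(a₂ + v₂ * r), m (x, r)| ≤ 2 * (M * ε) := by
    intro r hr
    have hmr : Continuous fun x => m (x, r) := by fun_prop
    have hSc := smoothTransition.continuous
    have hfM : ∀ x, |m (x, r)| ≤ M := fun x => by
      rw [abs_of_nonneg (hm0 _)]; exact hmM _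
    have k1 := abs_integral_mul_smoothTransition_sub_le hmr hfM hε0 (hBb r hr).1
    have k2 := abs_integral_mul_smoothTransition_sub_le hmr hfM hε0 (hBb r hr).2
    have e1 : G r = (∫ x in (-B)..B, m (x, r) * smoothTransition ((x - (a₁ + v₁ * r)) / ε)) -
        ∫ x in (-B)..B, m (x, r) * smoothTransition ((x - (a₂ + v₂ * r)) / ε) := by
      rw [← intervalIntegral.integral_sub (Continuous.intervalIntegrable (by fun_prop) _ _)
        (Continuous.intervalIntegrable (by fun_prop) _ _)]
      simp only [G, strip, mul_sub]
    have e2 := intervalIntegral.integral_add_adjacent_intervals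
      (hmr.intervalIntegrable (μ := volume) (a₁ + v₁ * r) (a₂ + v₂ * r))
      (hmr.intervalIntegrable (μ := volume) (a₂ + v₂ * r) B)
    rw [abs_le] at k1 k2 ⊢
    constructor <;> linarith [k1.1, k1.2, k2.1, k2.2]
  have d1 := abs_le.1 (hGD s₁ ⟨le_rfl, hs.le⟩)
  have d2 := abs_le.1 (hGD s₂ ⟨hs.le, le_rfl⟩)
  have d3 := abs_le.1 hlim
  have d4 : M * ε ≤ M * δ' := mul_le_mul_of_nonneg_left (min_le_right _ _) hM
  rw [abs_le]
  constructor <;> linarith [d1.1, d1.2, d2.1, d2.2, d3.1, d3.2]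

end Flux

/-! ### The mean field game: uniqueness of minimizing trajectories -/

open MeasureTheory

/-- Two minimizing trajectories with the same initial point coincide if the running and terminal
costs agree on them and on their mean: the kinetic energy is strictly convex. -/
lemma eq_of_calibrated {T a : ℝ} {F u : ℝ × ℝ → ℝ} {Λ : NNReal} {γ₁ γ₂ : ℝ → ℝ}
    (hFc : Continuous F) (hsub : SubLine T F u) (ha0 : 0 ≤ a) (haT : a < T)
    (hγ₁ : IsCalibrated F u Λ γ₁ a T) (hγ₂ : IsCalibrated F u Λ γ₂ a T) (haa : γ₁ a = γ₂ a)
    (hF₁ : ∀ s ∈ Icc a T, F (γ₁ s, s) = F ((γ₁ s + γ₂ s) / 2, s))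
    (hF₂ : ∀ s ∈ Icc a T, F (γ₂ s, s) = F ((γ₁ s + γ₂ s) / 2, s))
    (hu₁ : u (γ₁ T, T) = u ((γ₁ T + γ₂ T) / 2, T))
    (hu₂ : u (γ₂ T, T) = u ((γ₁ T + γ₂ T) / 2, T)) {s : ℝ} (hs : s ∈ Icc a T) :
    γ₁ s = γ₂ s := by
  have hΛ : (0 : ℝ) ≤ Λ := Λ.2
  have hτ : 0 < T - a := by linarith
  suffices h : |γ₁ s - γ₂ s| ≤ 0 by
    have := abs_nonpos_iff.1 h
    linarith
  refine le_of_forall_pos_le_add_mul (K := 2 + 4 * (T - a)) fun ε hε => ?_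
  set μ : ℝ → ℝ := fun r => (γ₁ r + γ₂ r) / 2 with hμ
  have hμlip : ∀ r t, |μ r - μ t| ≤ Λ * |r - t| := fun r t => by
    have h1 := abs_le.1 (hγ₁.abs_sub_le r t)
    have h2 := abs_le.1 (hγ₂.abs_sub_le r t)
    simp only [hμ]
    rw [abs_le]
    constructor <;> linarith
  have hμc : Continuous μ := by
    have := hγ₁.lipschitz.continuous
    have := hγ₂.lipschitz.continuous
    fun_prop
  have hunif : ∀ g : ℝ → ℝ, Continuous g → ∃ ρ > 0, ∀ r ∈ Icc a T, ∀ Q,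
      dist (g r, r) Q ≤ ρ → |F (g r, r) - F Q| ≤ ε ^ 2 := by
    intro g hg
    obtain ⟨ρ, hρ, h⟩ := exists_dist_le_imp_abs_sub_le hFc
      ((isCompact_Icc (a := a) (b := T)).image (hg.prodMk continuous_id))
      (show 0 < ε ^ 2 by positivity)
    exact ⟨ρ, hρ, fun r hr Q hQ => h _ ⟨r, hr, rfl⟩ Q hQ⟩
  obtain ⟨ρ₁, hρ₁, h₁⟩ := hunif γ₁ hγ₁.lipschitz.continuous
  obtain ⟨ρ₂, hρ₂, h₂⟩ := hunif γ₂ hγ₂.lipschitz.continuous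
  obtain ⟨ρ₃, hρ₃, h₃⟩ := hunif μ hμc
  set ρ := min (min ρ₁ ρ₂) (min ρ₃ ε) with hρdef
  have hρ : 0 < ρ := by
    simp only [hρdef, lt_min_iff]
    exact ⟨⟨hρ₁, hρ₂⟩, hρ₃, hε⟩
  have l1 : ρ ≤ ρ₁ := (min_le_left _ _).trans (min_le_left _ _)
  have l2 : ρ ≤ ρ₂ := (min_le_left _ _).trans (min_le_right _ _)
  have l3 : ρ ≤ ρ₃ := (min_le_right _ _).trans (min_le_left _ _)
  have l4 : ρ ≤ ε := (min_le_right _ _).trans (min_le_right _ _)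
  obtain ⟨N, hN⟩ := exists_nat_gt ((Λ + 1) * (T - a) / ρ)
  have hN0 : (0 : ℝ) < N := lt_of_le_of_lt (by positivity) hN
  set h := (T - a) / N with hh
  have hh0 : 0 < h := by positivity
  have hNh : N * h = T - a := by rw [hh]; field_simp
  have hsmall : Λ * h + h ≤ ρ := by
    rw [div_lt_iff₀ hρ] at hN
    have e : Λ * h + h = (Λ + 1) * (T - a) / N := by rw [hh]; ring
    rw [e, div_le_iff₀ hN0]
    linarith
  have hΛh : 0 ≤ Λ * h := by positivity
  let t : ℕ → ℝ := fun i => a + i * h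
  have hts : ∀ i, t (i + 1) = t i + h := fun i => by simp only [t]; push_cast; ring
  have ht_mem : ∀ i, i ≤ N → t i ∈ Icc a T := fun i hi => by
    have : (i : ℝ) * h ≤ N * h := by gcongr
    exact ⟨by simp only [t]; nlinarith [(Nat.cast_nonneg i : (0 : ℝ) ≤ i)],
      by simp only [t]; linarith⟩
  have cal : ∀ γ : ℝ → ℝ, IsCalibrated F u Λ γ a T → (∀ r ∈ Icc a T, F (γ r, r) = F (μ r, r)) →
      (∀ r ∈ Icc a T, ∀ Q, dist (γ r, r) Q ≤ ρ → |F (γ r, r) - F Q| ≤ ε ^ 2) → ∀ i, i < N →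
      u (γ (t (i + 1)), t (i + 1)) + (γ (t (i + 1)) - γ (t i)) ^ 2 / (2 * h) +
        (F (μ (t i), t i) - ε ^ 2) * h ≤ u (γ (t i), t i) := by
    intro γ hγ hγF hγu i hi
    have m1 := ht_mem i hi.le
    have m2 := ht_mem (i + 1) hi
    have h1 := hγ.le (t i) (t (i + 1)) m1.1 (by rw [hts]; linarith) m2.2
      (F (μ (t i), t i) - ε ^ 2) (by
        intro r hr
        have hr2 := hr.2
        rw [hts] at hr2
        have habs : |t i - r| ≤ h := by
          rw [abs_le]; constructor <;> linarith [hr.1]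
        have h2 := hγ.abs_sub_le (t i) r
        have h2' : Λ * |t i - r| ≤ Λ * h := by gcongr
        have h3 := abs_le.1 (hγu (t i) m1 (γ r, r) (dist_le_of_abs (by simp only; linarith)
          (by simp only; linarith)))
        rw [hγF _ m1] at h3
        linarith)
    rwa [show t (i + 1) - t i = h by rw [hts]; ring] at h1
  have sub : ∀ i, i < N → u (μ (t i), t i) ≤ u (μ (t (i + 1)), t (i + 1)) +
      (μ (t (i + 1)) - μ (t i)) ^ 2 / (2 * h) + (F (μ (t i), t i) + ε ^ 2) * h := by
    intro i hi
    have m1 := ht_mem i hi.le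
    have m2 := ht_mem (i + 1) hi
    have h1 := hsub.segment (x := μ (t i)) (y := μ (t (i + 1))) (s := t i) (t := t (i + 1))
      (C := F (μ (t i), t i) + ε ^ 2) (ha0.trans m1.1) (by rw [hts]; linarith) m2.2 (by
        intro l hl
        have e : t (i + 1) - t i = h := by rw [hts]; ring
        have h2 := hμlip (t (i + 1)) (t i)
        rw [e, abs_of_pos hh0] at h2
        have h3 := abs_le.1 (h₃ (t i) m1 (μ (t i) + l * (μ (t (i + 1)) - μ (t i)),
          t i + l * (t (i + 1) - t i)) (dist_le_of_abs (by
            simp only [sub_add_cancel_left, abs_neg, abs_mul, abs_of_nonneg hl.1]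
            nlinarith [hl.2, abs_nonneg (μ (t (i + 1)) - μ (t i))]) (by
            simp only [sub_add_cancel_left, abs_neg, abs_mul, abs_of_nonneg hl.1, e,
              abs_of_pos hh0]
            nlinarith [hl.2])))
        linarith)
    rwa [show t (i + 1) - t i = h by rw [hts]; ring] at h1
  let d : ℕ → ℝ := fun i => γ₁ (t i) - γ₂ (t i)
  -- The second difference of `u` around the mean curve, zero at both ends. In each step it loses
  -- the energy of `d`, by the parallelogram identity, up to `4 * ε ^ 2 * h`: one `ε ^ 2 * h` for
  -- each curve and two for the mean.
  let E : ℕ → ℝ := fun i => u (γ₁ (t i), t i) + u (γ₂ (t i), t i) - 2 * u (μ (t i), t i)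
  have hE : ∀ i, i < N → E (i + 1) + (d (i + 1) - d i) ^ 2 / (4 * h) - 4 * ε ^ 2 * h ≤ E i := by
    intro i hi
    have c1 := cal γ₁ hγ₁ hF₁ (fun r hr Q hQ => h₁ r hr Q (hQ.trans l1)) i hi
    have c2 := cal γ₂ hγ₂ hF₂ (fun r hr Q hQ => h₂ r hr Q (hQ.trans l2)) i hi
    have c3 := sub i hi
    have e : (γ₁ (t (i + 1)) - γ₁ (t i)) ^ 2 / (2 * h) + (γ₂ (t (i + 1)) - γ₂ (t i)) ^ 2 / (2 * h) -
        2 * ((μ (t (i + 1)) - μ (t i)) ^ 2 / (2 * h)) = (d (i + 1) - d i) ^ 2 / (4 * h) := by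
      simp only [hμ, d]
      field_simp
      ring
    simp only [E]
    linarith
  have hsum : ∀ k, k ≤ N → E k + ∑ i ∈ Finset.range k, (d (i + 1) - d i) ^ 2 / (4 * h) -
      k * (4 * ε ^ 2 * h) ≤ E 0 := by
    intro k
    induction k with
    | zero => intro _; simp
    | succ k ih =>
      intro hk
      have k1 := ih (by omega)
      have k2 := hE k (by omega)
      rw [Finset.sum_range_succ]
      push_cast
      linarith
  have hE0 : E 0 = 0 := by
    simp only [E, t, hμ, Nat.cast_zero, zero_mul, add_zero, haa]
    ring_nf
  have htN : t N = T := by simp only [t]; linarith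
  have hEN : E N = 0 := by
    simp only [E, htN, hu₁, hu₂, hμ]
    ring
  have htot := hsum N le_rfl
  rw [hE0, hEN, ← Finset.sum_div] at htot
  have htot2 : ∑ i ∈ Finset.range N, (d (i + 1) - d i) ^ 2 ≤ 16 * ε ^ 2 * (T - a) * h := by
    have : (∑ i ∈ Finset.range N, (d (i + 1) - d i) ^ 2) / (4 * h) ≤ 4 * ε ^ 2 * (T - a) := by
      rw [← hNh]; linarith
    rw [div_le_iff₀ (by positivity)] at this
    linarith
  have hd : ∀ k, k ≤ N → |d k| ≤ 4 * (T - a) * ε := by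
    intro k hk
    have hd0 : d 0 = 0 := by simp [d, t, haa]
    have e : d k = ∑ i ∈ Finset.range k, (d (i + 1) - d i) := by
      rw [Finset.sum_range_sub, hd0, sub_zero]
    -- By Cauchy-Schwarz, small energy and equal starting points force the curves to be close.
    have k1 := sq_sum_le_card_mul_sum_sq (s := Finset.range k) (f := fun i => d (i + 1) - d i)
    rw [← e, Finset.card_range] at k1
    have k2 : ∑ i ∈ Finset.range k, (d (i + 1) - d i) ^ 2 ≤
        ∑ i ∈ Finset.range N, (d (i + 1) - d i) ^ 2 :=
      Finset.sum_le_sum_of_subset_of_nonneg (Finset.range_subset_range.2 hk)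
        fun _ _ _ => sq_nonneg _
    have k3 : d k ^ 2 ≤ (4 * (T - a) * ε) ^ 2 := by
      calc d k ^ 2 ≤ k * ∑ i ∈ Finset.range k, (d (i + 1) - d i) ^ 2 := k1
        _ ≤ N * (16 * ε ^ 2 * (T - a) * h) := by
          gcongr
          exact k2.trans htot2
        _ = 16 * ε ^ 2 * (T - a) * (N * h) := by ring
        _ = _ := by rw [hNh]; ring
    exact abs_le_of_sq_le_sq k3 (by positivity)
  have hs0 : 0 ≤ (s - a) / h := div_nonneg (by linarith [hs.1]) hh0.le
  have hk1 := Nat.floor_le hs0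
  have hk2 := (Nat.lt_floor_add_one ((s - a) / h)).le
  rw [le_div_iff₀ hh0] at hk1
  rw [div_le_iff₀ hh0] at hk2
  set k := ⌊(s - a) / h⌋₊
  have hkN : k ≤ N := by
    have : (k : ℝ) * h ≤ N * h := by rw [hNh]; linarith [hs.2]
    exact_mod_cast le_of_mul_le_mul_right this hh0
  have habs : |s - t k| ≤ h := by
    simp only [t]
    rw [abs_le]
    constructor <;> linarith
  have q1 := abs_le.1 (hγ₁.abs_sub_le s (t k))
  have q2 := abs_le.1 (hγ₂.abs_sub_le s (t k))
  have q3 := abs_le.1 (hd k hkN)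
  have q4 : Λ * |s - t k| ≤ Λ * h := by gcongr
  simp only [d] at q3
  rw [abs_le]
  constructor <;> linarith [q1.1, q1.2, q2.1, q2.2, q3.1, q3.2]

/-- Uniqueness of minimizing trajectories forward in time gives their existence backward in
time. -/
lemma exists_calibrated_of_unique {T a : ℝ} {F u : ℝ × ℝ → ℝ} {Λ : NNReal}
    (huc : Continuous u) (hFc : Continuous F) {z : ℝ × ℝ} (hz : z ∈ openStrip T)
    (ha : a ∈ Ioo 0 z.2)
    (hfwd : ∀ z ∈ openStrip T, ∃ γ, IsCalibrated F u Λ γ z.2 T ∧ γ z.2 = z.1)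
    (huniq : ∀ γ₁ γ₂, IsCalibrated F u Λ γ₁ a T → IsCalibrated F u Λ γ₂ a T → γ₁ a = γ₂ a →
      γ₁ z.2 = γ₂ z.2) :
    ∃ γ, IsCalibrated F u Λ γ a z.2 ∧ γ z.2 = z.1 := by
  have haT : a ≤ T := (ha.2.trans hz.2.2).le
  have hex : ∀ y, ∃ γ, IsCalibrated F u Λ γ a T ∧ γ a = y := fun y =>
    hfwd (y, a) ⟨mem_univ _, ha.1, ha.2.trans hz.2.2⟩
  -- Limits of calibrated curves are calibrated, so this set of starting points is closed.
  have hclosed : ∀ S : Set ℝ, IsClosed S →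
      IsClosed {y | ∃ γ, IsCalibrated F u Λ γ a T ∧ γ a = y ∧ γ z.2 ∈ S} := by
    intro S hS
    refine IsSeqClosed.isClosed fun y y₀ hy hlim => ?_
    choose γ hγ hγa hγS using hy
    obtain ⟨γ', φ, -, h1, h2, h3⟩ := exists_calibrated_of_approx huc hFc haT
      (fun n => (hγ n).lipschitz) (x := y₀) (by simpa [hγa] using hlim)
      (tendsto_const_nhds (x := (0 : ℝ))) fun n => (hγ n).approx le_rfl
    exact ⟨γ', h1, h2, hS.mem_of_tendsto (h3 z.2 ⟨ha.2.le, hz.2.2.le⟩)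
      (Eventually.of_forall fun n => hγS _)⟩
  have hne : ∀ y, ∃ γ, IsCalibrated F u Λ γ a T ∧ γ a = y ∧
      |γ z.2 - y| ≤ Λ * (z.2 - a) := fun y => by
    obtain ⟨γ, h1, h2⟩ := hex y
    refine ⟨γ, h1, h2, ?_⟩
    have := h1.abs_sub_le z.2 a
    rwa [h2, abs_of_pos (show 0 < z.2 - a by linarith [ha.2])] at this
  -- The starting points with a curve to the left of `z.1` and those with one to the right form two
  -- nonempty closed sets covering the line. A common starting point has a curve of each kind; by
  -- uniqueness they agree at time `z.2`, so both pass through `z`.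
  obtain ⟨y, -, ⟨γ₁, h1, h1a, h1z⟩, γ₂, h2, h2a, h2z⟩ :=
    isPreconnected_closed_iff.1 isPreconnected_univ _ _ (hclosed (Iic z.1) isClosed_Iic)
      (hclosed (Ici z.1) isClosed_Ici) (fun y _ => by
        obtain ⟨γ, h1, h2⟩ := hex y
        rcases le_total (γ z.2) z.1 with h | h
        · exact Or.inl ⟨γ, h1, h2, h⟩
        · exact Or.inr ⟨γ, h1, h2, h⟩) (by
        obtain ⟨γ, h1, h2, h3⟩ := hne (z.1 - Λ * (z.2 - a))
        have := abs_le.1 h3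
        exact ⟨_, mem_univ _, γ, h1, h2, by simp only [mem_Iic]; linarith⟩) (by
        obtain ⟨γ, h1, h2, h3⟩ := hne (z.1 + Λ * (z.2 - a))
        have := abs_le.1 h3
        exact ⟨_, mem_univ _, γ, h1, h2, by simp only [mem_Ici]; linarith⟩)
  have h12 := huniq γ₁ γ₂ h1 h2 (h1a.trans h2a.symm)
  exact ⟨γ₁, h1.mono le_rfl hz.2.2.le, le_antisymm h1z (by rw [h12]; exact h2z)⟩

/-- A minimizing trajectory has velocity `-u_x` wherever `u` is differentiable on it. -/
lemma IsCalibrated.velocity {T a b s : ℝ} {F u : ℝ × ℝ → ℝ} {Λ : NNReal} {γ : ℝ → ℝ}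
    {A : ℝ × ℝ →L[ℝ] ℝ} (hFc : Continuous F) (hsub : SubLine T F u)
    (hγ : IsCalibrated F u Λ γ a b) (ha0 : 0 ≤ a) (hbT : b ≤ T) (hs : s ∈ Ico a b)
    (hA : HasFDerivAt u A (γ s, s)) {η : ℝ} (hη : 0 < η) :
    ∃ τ₀ > 0, ∀ τ, 0 < τ → τ ≤ τ₀ → |(γ (s + τ) - γ s) / τ + A (1, 0)| ≤ η := by
  have hΛ : (0 : ℝ) ≤ Λ := Λ.2
  set α := A (1, 0) with hα
  set κ := A (0, 1) with hκ
  have hAy : ∀ y : ℝ × ℝ, A y = α * y.1 + κ * y.2 := fun y => by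
    have e : y = y.1 • (1, 0) + y.2 • (0, 1) := by ext <;> simp
    conv_lhs => rw [e]
    rw [map_add, map_smul, map_smul, smul_eq_mul, smul_eq_mul]
    ring
  set K := Λ + |α| + 1 with hK
  have hK0 : 0 < K := by positivity
  -- Optimality of `γ` and comparison with the line of velocity `-α` each cost `ζ * (1 + K)`; their
  -- sum bounds `(v + α) ^ 2 / 2`.
  set ζ := η ^ 2 / (4 * (1 + K)) with hζdef
  have hζ : 0 < ζ := by positivity
  obtain ⟨ρ₁, hρ₁, h₁⟩ := exists_dist_le_imp_abs_sub_le hFc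
    (isCompact_singleton (x := (γ s, s))) hζ
  have hlo := (hasFDerivAt_iff_isLittleO_nhds_zero.1 hA).def hζ
  obtain ⟨ρ₂, hρ₂, h₂⟩ := Metric.nhds_basis_closedBall.mem_iff.1 hlo
  have hexp : ∀ y : ℝ × ℝ, ‖y‖ ≤ ρ₂ → |u ((γ s, s) + y) - u (γ s, s) - A y| ≤ ζ * ‖y‖ :=
    fun y hy => h₂ (by simpa using hy)
  set τ₀ := min (b - s) (min ρ₁ ρ₂ / K) with hτ₀
  have hτ₀0 : 0 < τ₀ := lt_min (by linarith [hs.2]) (div_pos (lt_min hρ₁ hρ₂) hK0)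
  refine ⟨τ₀, hτ₀0, fun τ hτ hττ => ?_⟩
  have hτb : s + τ ≤ b := by linarith [min_le_left (b - s) (min ρ₁ ρ₂ / K)]
  have hKτ : K * τ ≤ min ρ₁ ρ₂ := by
    have : τ ≤ min ρ₁ ρ₂ / K := hττ.trans (min_le_right _ _)
    rw [le_div_iff₀ hK0] at this
    linarith
  have hKτ1 : K * τ ≤ ρ₁ := hKτ.trans (min_le_left _ _)
  have hKτ2 : K * τ ≤ ρ₂ := hKτ.trans (min_le_right _ _)
  have hKe : K * τ = Λ * τ + |α| * τ + τ := by rw [hK]; ring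
  have hΛτ : 0 ≤ Λ * τ := by positivity
  have hατ : 0 ≤ |α| * τ := by positivity
  set v := (γ (s + τ) - γ s) / τ with hv
  have hvτ : γ (s + τ) - γ s = v * τ := by rw [hv]; field_simp
  have hγl : |γ (s + τ) - γ s| ≤ Λ * τ := by
    have := hγ.abs_sub_le (s + τ) s
    rwa [add_sub_cancel_left, abs_of_pos hτ] at this
  -- lower bound along the trajectory
  have hlow : α * v + κ + v ^ 2 / 2 + F (γ s, s) ≤ ζ + ζ * K := by
    have k1 := hγ.le s (s + τ) hs.1 (by linarith) hτb (F (γ s, s) - ζ) (by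
      intro r hr
      have k2 := hγ.abs_sub_le (γ := γ) s r
      have k3 : |s - r| ≤ τ := by rw [abs_le]; constructor <;> linarith [hr.1, hr.2]
      have k4 : Λ * |s - r| ≤ Λ * τ := by gcongr
      have k5 := abs_le.1 (h₁ _ rfl (γ r, r) (dist_le_of_abs (by simp only; linarith)
        (by simp only; linarith)))
      linarith)
    have hy : ‖((v * τ, τ) : ℝ × ℝ)‖ ≤ K * τ := by
      rw [Prod.norm_def]
      refine max_le ?_ ?_
      · rw [Real.norm_eq_abs, ← hvτ]; linarith
      · rw [Real.norm_eq_abs, abs_of_pos hτ]; linarith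
    have k6 := abs_le.1 (hexp (v * τ, τ) (hy.trans hKτ2))
    have e : ((γ s, s) : ℝ × ℝ) + (v * τ, τ) = (γ (s + τ), s + τ) := by
      rw [← hvτ]; ext <;> simp
    rw [e, hAy] at k6
    rw [hvτ, add_sub_cancel_left] at k1
    have k7 : ζ * ‖((v * τ, τ) : ℝ × ℝ)‖ ≤ ζ * (K * τ) := by gcongr
    have k8 : (v * τ) ^ 2 / (2 * τ) = v ^ 2 / 2 * τ := by field_simp
    rw [k8] at k1
    have : (α * v + κ + v ^ 2 / 2 + F (γ s, s)) * τ ≤ (ζ + ζ * K) * τ := by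
      simp only at k6
      linarith [k6.1]
    exact le_of_mul_le_mul_right this hτ
  have hup : 0 ≤ -(α ^ 2) / 2 + κ + F (γ s, s) + (ζ + ζ * K) := by
    have k1 := hsub.segment (x := γ s) (y := γ s + -α * τ) (s := s) (t := s + τ)
      (C := F (γ s, s) + ζ) (ha0.trans hs.1) (by linarith) (hτb.trans hbT) (by
        intro l hl
        have k5 := abs_le.1 (h₁ _ rfl (γ s + l * (γ s + -α * τ - γ s), s + l * (s + τ - s))
          (dist_le_of_abs (by
            simp only [sub_add_cancel_left, add_sub_cancel_left, abs_neg, abs_mul,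
              abs_of_nonneg hl.1, abs_of_pos hτ]
            nlinarith [hl.2]) (by
            simp only [sub_add_cancel_left, add_sub_cancel_left, abs_neg, abs_mul,
              abs_of_nonneg hl.1, abs_of_pos hτ]
            nlinarith [hl.2])))
        linarith)
    have hy : ‖((-α * τ, τ) : ℝ × ℝ)‖ ≤ K * τ := by
      rw [Prod.norm_def]
      refine max_le ?_ ?_
      · rw [Real.norm_eq_abs, abs_mul, abs_neg, abs_of_pos hτ]; linarith
      · rw [Real.norm_eq_abs, abs_of_pos hτ]; linarith
    have k6 := abs_le.1 (hexp (-α * τ, τ) (hy.trans hKτ2))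
    have e : ((γ s, s) : ℝ × ℝ) + (-α * τ, τ) = (γ s + -α * τ, s + τ) := rfl
    rw [e, hAy] at k6
    rw [add_sub_cancel_left, add_sub_cancel_left] at k1
    have k7 : ζ * ‖((-α * τ, τ) : ℝ × ℝ)‖ ≤ ζ * (K * τ) := by gcongr
    have k8 : (-α * τ) ^ 2 / (2 * τ) = α ^ 2 / 2 * τ := by field_simp
    rw [k8] at k1
    have : 0 * τ ≤ (-(α ^ 2) / 2 + κ + F (γ s, s) + (ζ + ζ * K)) * τ := by
      simp only at k6
      linarith [k6.2]
    exact le_of_mul_le_mul_right this hτ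
  have hsq : (v + α) ^ 2 ≤ η ^ 2 := by
    have e : 4 * (ζ + ζ * K) = η ^ 2 := by rw [hζdef]; field_simp
    linarith [show (v + α) ^ 2 = 2 * (α * v + v ^ 2 / 2 + α ^ 2 / 2) by ring]
  exact abs_le_of_sq_le_sq hsq hη.le

/-- At interior points of minimizing trajectories `u` is differentiable, and nearby
derivatives are close. -/
lemma IsCalibrated.exists_hasFDerivAt {T β a b s : ℝ} {F u : ℝ × ℝ → ℝ} {L Λ : NNReal}
    {γ : ℝ → ℝ} (hu : LipschitzWith L u) (hsub : SubLine T F u) (hβ : 0 < β) (hβ' : β < 1)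
    (hF : IsLocHolder (openStrip T) β F)
    (hfwd : ∀ z ∈ openStrip T, ∃ γ, IsCalibrated F u Λ γ z.2 T ∧ γ z.2 = z.1)
    (hγ : IsCalibrated F u Λ γ a b) (ha0 : 0 ≤ a) (hbT : b ≤ T) (hs : s ∈ Ioo a b) :
    ∃ A : ℝ × ℝ →L[ℝ] ℝ, HasFDerivAt u A (γ s, s) ∧ ∀ η > 0, ∃ ρ > 0, ∀ p,
      dist p (γ s, s) ≤ ρ → DifferentiableAt ℝ u p → |dx u p - A (1, 0)| ≤ η := by
  set z : ℝ × ℝ := (γ s, s) with hz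
  have hzT : z ∈ openStrip T := ⟨mem_univ _, ha0.trans_lt hs.1, hs.2.trans_le hbT⟩
  have hα0 : 0 < β / 2 := half_pos hβ
  have hα1 : β / 2 ≤ 1 := by linarith
  obtain ⟨r, hr, hball⟩ := Metric.nhds_basis_closedBall.mem_iff.1
    ((isOpen_openStrip T).mem_nhds hzT)
  have hcb : IsCompact (Metric.closedBall z r) := isCompact_closedBall z r
  obtain ⟨τ, hτ, hτz⟩ := exists_uniform_time hcb hball
  obtain ⟨C₁, hC₁, h₁⟩ := exists_second_diff_le Λ hu hsub hβ hβ' hF hcb hball hτ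
  -- The lower bound is available at `z` because the part of `γ` before `s` arrives there. At nearby
  -- points only the upper bound is known, which still controls the gradient wherever it exists.
  obtain ⟨C₂, hC₂, h₂⟩ := exists_second_diff_ge Λ hu hsub hβ hβ' hF
    (isCompact_singleton (x := z)) (by simpa using hzT) (show 0 < s - a by linarith [hs.1])
  have hm := midpointConst_nonneg hα0
  set C := midpointConst (β / 2) * C₁ + C₂ with hC
  have hC0 : 0 ≤ C := by positivity
  have hsemi : SemiconcaveOn (Metric.closedBall z r) (β / 2) C u := by
    intro p hp q hq l hl
    have hseg : segment ℝ p q ⊆ Metric.closedBall z r :=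
      (convex_closedBall z r).segment_subset hp hq
    refine (semiconcave_of_midpoint hu.continuous hα0 hC₁ (fun x hx e => ?_) hl).trans ?_
    · obtain ⟨γ', hγ', hγx⟩ := hfwd x (hball (hseg hx))
      exact h₁ x (hseg hx) γ' (hγ'.mono le_rfl (hτz x (hseg hx)).2) hγx e
    · have := hl.1
      have : 0 ≤ 1 - l := by linarith [hl.2]
      gcongr
      linarith
  obtain ⟨A, hA⟩ := hsemi.exists_expansion hα1 hα0 hC0 hr (fun y _ => by
    refine le_trans ?_ (h₂ z rfl γ (hγ.mono (by simp [hz]) hs.2.le) rfl y)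
    rw [neg_le_neg_iff]
    gcongr
    have : 0 ≤ midpointConst (β / 2) * C₁ := by positivity
    linarith)
  refine ⟨A, hasFDerivAt_of_expansion hα0 (half_pos hr) hA, fun η hη => ?_⟩
  have hlim : Tendsto (fun d : ℝ => 6 * (30 * C) * d ^ (β / 2)) (𝓝[>] 0) (𝓝 0) := by
    have := ((Real.continuousAt_rpow_const 0 (β / 2) (Or.inr hα0.le)).tendsto.const_mul
      (6 * (30 * C))).mono_left (nhdsWithin_le_nhds (s := Ioi 0))
    simpa [Real.zero_rpow hα0.ne'] using this
  obtain ⟨d, hd1, hd2⟩ := ((hlim.eventually_le_const hη).and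
    (Ioo_mem_nhdsGT (show (0 : ℝ) < r / 4 by linarith))).exists
  refine ⟨d, hd2.1, fun p hp hpd => ?_⟩
  have hsub' : Metric.closedBall p (r / 2) ⊆ Metric.closedBall z r :=
    Metric.closedBall_subset_closedBall' (by linarith [hd2.2])
  have hsemip : SemiconcaveOn (Metric.closedBall p (r / 2)) (β / 2) (30 * C) u := by
    intro x hx y hy l hl
    refine (hsemi x (hsub' hx) y (hsub' hy) l hl).trans ?_
    have := hl.1
    have : 0 ≤ 1 - l := by linarith [hl.2]
    gcongr
    linarith
  have key := norm_sub_le_of_expansions (x := p) (z := z) (A := A) (A' := fderiv ℝ u p) hα1 hα0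
    (by positivity) hA (fun y hy => hsemip.le_of_hasFDerivAt (by positivity) hpd.hasFDerivAt hy)
    hd2.1 (by linarith [hd2.2]) (by rwa [← dist_eq_norm])
  rw [dx_eq_fderiv hpd, abs_sub_comm]
  have h3 := (A - fderiv ℝ u p).le_opNorm (1, 0)
  have h4 : ‖((1, 0) : ℝ × ℝ)‖ = 1 := by simp [Prod.norm_def]
  rw [h4, mul_one] at h3
  exact (h3.trans key).trans hd1

/-- No mass lies between two minimizing trajectories with the same initial point. -/
lemma mass_between_eq_zero {T M β a : ℝ} {F u m : ℝ × ℝ → ℝ} {L Λ : NNReal} {γ₁ γ₂ : ℝ → ℝ}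
    (hu : LipschitzWith L u) (hFc : Continuous F) (hsub : SubLine T F u) (hβ : 0 < β)
    (hβ' : β < 1) (hF : IsLocHolder (openStrip T) β F)
    (hfwd : ∀ z ∈ openStrip T, ∃ γ, IsCalibrated F u Λ γ z.2 T ∧ γ z.2 = z.1)
    (hm : Continuous m) (hm0 : ∀ p, 0 ≤ m p) (hmM : ∀ p, m p ≤ M)
    (hc : IsContinuitySolution T u m) (ha0 : 0 ≤ a) (haT : a < T)
    (hγ₁ : IsCalibrated F u Λ γ₁ a T) (hγ₂ : IsCalibrated F u Λ γ₂ a T) (haa : γ₁ a = γ₂ a)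
    {s : ℝ} (hs : s ∈ Icc a T) : ∫ x in γ₁ s..γ₂ s, m (x, s) = 0 := by
  have hM : 0 ≤ M := (hm0 0).trans (hmM 0)
  have hΛ : (0 : ℝ) ≤ Λ := Λ.2
  let D : ℝ → ℝ := fun s => ∫ x in γ₁ s..γ₂ s, m (x, s)
  have hDc : Continuous D := by
    have hf : Continuous (Function.uncurry fun s x : ℝ => m (x, s)) := by
      unfold Function.uncurry
      fun_prop
    have h1 := intervalIntegral.continuous_parametric_intervalIntegral_of_continuous (a₀ := 0)
      (μ := volume) hf hγ₁.lipschitz.continuous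
    have h2 := intervalIntegral.continuous_parametric_intervalIntegral_of_continuous (a₀ := 0)
      (μ := volume) hf hγ₂.lipschitz.continuous
    have e : D = fun s => (∫ x in 0..γ₂ s, m (x, s)) - ∫ x in 0..γ₁ s, m (x, s) := by
      funext s
      have hms : Continuous fun x => m (x, s) := by fun_prop
      exact (intervalIntegral.integral_interval_sub_left (hms.intervalIntegrable _ _)
        (hms.intervalIntegrable _ _)).symm
    rw [e]
    exact h2.sub h1
  have hDa : D a = 0 := by simp [D, haa]
  -- Right derivatives suffice, and they are what `IsCalibrated.velocity` controls. At `a` and `T`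
  -- the differentiability of `u` on the curves is unknown, so these times are reached by
  -- continuity.
  have hderiv : ∀ s ∈ Ioo a T, HasDerivWithinAt D 0 (Ici s) s := by
    intro s hs
    rw [hasDerivWithinAt_iff_isLittleO]
    refine Asymptotics.IsLittleO.of_bound fun c hc0 => ?_
    set η := c / (2 * M + 1) with hη
    have hη0 : 0 < η := by positivity
    have side : ∀ γ, IsCalibrated F u Λ γ a T → ∃ τ₀ > 0, ∀ τ, 0 < τ → τ ≤ τ₀ →
        ∀ p : ℝ × ℝ, DifferentiableAt ℝ u p → p.2 ∈ Icc s (s + τ) →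
          |p.1 - ((γ s - (γ (s + τ) - γ s) / τ * s) + (γ (s + τ) - γ s) / τ * p.2)| ≤ τ →
          |(γ (s + τ) - γ s) / τ + dx u p| ≤ η := by
      intro γ hγ
      obtain ⟨A, hA, hnear⟩ := hγ.exists_hasFDerivAt hu hsub hβ hβ' hF hfwd ha0 le_rfl hs
      obtain ⟨τ₁, hτ₁, hv⟩ := hγ.velocity hFc hsub ha0 le_rfl ⟨hs.1.le, hs.2⟩ hA (half_pos hη0)
      obtain ⟨ρ, hρ, hd⟩ := hnear (η / 2) (half_pos hη0)
      refine ⟨min τ₁ (ρ / (Λ + 1)), lt_min hτ₁ (by positivity), fun τ hτ hττ p hp hp2 hp1 => ?_⟩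
      have k1 := hv τ hτ (hττ.trans (min_le_left _ _))
      have hρτ : (Λ + 1) * τ ≤ ρ := by
        have : τ ≤ ρ / (Λ + 1) := hττ.trans (min_le_right _ _)
        rw [le_div_iff₀ (by positivity)] at this
        linarith
      have hvb : |(γ (s + τ) - γ s) / τ| ≤ Λ := by
        have := hγ.abs_sub_le (s + τ) s
        rw [add_sub_cancel_left, abs_of_pos hτ] at this
        rw [abs_div, abs_of_pos hτ, div_le_iff₀ hτ]
        exact this
      set v := (γ (s + τ) - γ s) / τ
      have hp2' : |p.2 - s| ≤ τ := by rw [abs_le]; constructor <;> linarith [hp2.1, hp2.2]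
      have k2 : |v * (p.2 - s)| ≤ Λ * τ := by
        rw [abs_mul]
        exact mul_le_mul hvb hp2' (abs_nonneg _) hΛ
      have k3 : |p.1 - γ s| ≤ (Λ + 1) * τ := by
        have e : p.1 - γ s = (p.1 - (γ s - v * s + v * p.2)) + v * (p.2 - s) := by ring
        rw [e]
        refine (abs_add_le _ _).trans ?_
        linarith
      have k4 := hd p (dist_le_of_abs (by simp only; linarith) (by
        simp only
        nlinarith)) hp
      have e : v + dx u p = (v + A (1, 0)) + (dx u p - A (1, 0)) := by ring
      rw [e]
      refine (abs_add_le _ _).trans ?_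
      linarith
    obtain ⟨τ₁, hτ₁, h₁⟩ := side γ₁ hγ₁
    obtain ⟨τ₂, hτ₂, h₂⟩ := side γ₂ hγ₂
    set τ₀ := min (min τ₁ τ₂) ((T - s) / 2) with hτ₀
    have hτ₀0 : 0 < τ₀ := lt_min (lt_min hτ₁ hτ₂) (by linarith [hs.2])
    have hnhds : Ico s (s + τ₀) ∈ 𝓝[≥] s := Ico_mem_nhdsGE (by linarith)
    filter_upwards [hnhds] with t ht
    simp only [smul_zero, sub_zero]
    rcases ht.1.eq_or_lt with rfl | hst
    · simp
    have hτ : 0 < t - s := by linarith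
    have hττ : t - s ≤ τ₀ := by linarith [ht.2]
    have e : s + (t - s) = t := by ring
    have ae := hu.ae_differentiableAt (μ := volume)
    -- The lines are the chords of the curves over `[s, t]` with control width `t - s`, so both
    -- neighbourhoods shrink to the points of the curves at time `s`.
    have key := abs_mass_sub_le (a₁ := γ₁ s - (γ₁ t - γ₁ s) / (t - s) * s)
      (v₁ := (γ₁ t - γ₁ s) / (t - s)) (a₂ := γ₂ s - (γ₂ t - γ₂ s) / (t - s) * s)
      (v₂ := (γ₂ t - γ₂ s) / (t - s)) hu hm hm0 hmM hc (ha0.trans_lt hs.1) hst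
      (by linarith [min_le_right (min τ₁ τ₂) ((T - s) / 2), hs.2]) hτ hη0.le
      (by
        filter_upwards [ae] with p hp hp2 hp1
        have := h₁ (t - s) hτ (hττ.trans ((min_le_left _ _).trans (min_le_left _ _))) p hp
        rw [e] at this
        exact this hp2 hp1)
      (by
        filter_upwards [ae] with p hp hp2 hp1
        have := h₂ (t - s) hτ (hττ.trans ((min_le_left _ _).trans (min_le_right _ _))) p hp
        rw [e] at this
        exact this hp2 hp1)
    have ends : ∀ x y : ℝ, x - (y - x) / (t - s) * s + (y - x) / (t - s) * s = x ∧
        x - (y - x) / (t - s) * s + (y - x) / (t - s) * t = y := by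
      intro x y
      constructor
      · ring
      · field_simp; ring
    rw [(ends _ _).1, (ends _ _).1, (ends _ _).2, (ends _ _).2] at key
    rw [Real.norm_eq_abs, Real.norm_eq_abs, abs_of_pos hτ, abs_sub_comm]
    refine key.trans ?_
    have : 2 * M * η ≤ c := by
      rw [hη, mul_div_assoc', div_le_iff₀ (by positivity)]
      nlinarith
    gcongr
  have hconst : ∀ s₁ s₂, a < s₁ → s₁ ≤ s₂ → s₂ < T → D s₂ = D s₁ := by
    intro s₁ s₂ h1 h12 h2
    exact constant_of_has_deriv_right_zero hDc.continuousOn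
      (fun x hx => hderiv x ⟨h1.trans_le hx.1, hx.2.trans h2⟩) s₂ ⟨h12, le_rfl⟩
  have hint : ∀ s ∈ Ioo a T, D s = 0 := by
    intro s hs
    have hl := (hDc.tendsto a).mono_left (nhdsWithin_le_nhds (s := Ioi a))
    rw [hDa] at hl
    have hl2 : Tendsto D (𝓝[>] a) (𝓝 (D s)) := by
      refine tendsto_const_nhds.congr' ?_
      filter_upwards [Ioo_mem_nhdsGT hs.1] with r hr
      exact hconst r s hr.1 hr.2.le hs.2
    exact tendsto_nhds_unique hl2 hl
  change D s = 0
  have hcl : closure (Ioo a T) ⊆ {s | D s = 0} :=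
    closure_minimal hint (isClosed_eq hDc continuous_const)
  rw [closure_Ioo haT.ne] at hcl
  exact hcl hs

lemma eq_zero_of_integral_eq_zero {f : ℝ → ℝ} (hf : Continuous f) (hf0 : ∀ x, 0 ≤ f x) {a b : ℝ}
    (hab : a ≠ b) (h : ∫ x in a..b, f x = 0) : ∀ x ∈ uIcc a b, f x = 0 := by
  have key : ∀ a b : ℝ, a < b → ∫ x in a..b, f x = 0 → ∀ x ∈ Icc a b, f x = 0 := by
    intro a b hab h x hx
    by_contra hne
    have := intervalIntegral.integral_pos hab hf.continuousOn (fun x _ => hf0 x)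
      ⟨x, hx, lt_of_le_of_ne (hf0 x) (Ne.symm hne)⟩
    linarith
  rcases hab.lt_or_gt with hlt | hlt
  · rw [uIcc_of_le hlt.le]
    exact key a b hlt h
  · rw [uIcc_of_ge hlt.le]
    refine key b a hlt ?_
    rw [intervalIntegral.integral_symm, h, neg_zero]

/-! ### Extension to all times and locality of the notions -/

/-- The time coordinate is replaced by the nearest point of `[0, T]`. -/
noncomputable def clampTime (T : ℝ) (p : ℝ × ℝ) : ℝ × ℝ := (p.1, max 0 (min p.2 T))

lemma lipschitzWith_clampTime (T : ℝ) : LipschitzWith 1 (clampTime T) := by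
  have h : LipschitzWith 1 fun p : ℝ × ℝ => max 0 (min p.2 T) :=
    (LipschitzWith.prod_snd.min_const T).const_max 0
  have h1 := LipschitzWith.prod_fst.prodMk h
  rwa [max_self] at h1

lemma clampTime_mem {T : ℝ} (hT : 0 ≤ T) (p : ℝ × ℝ) : clampTime T p ∈ closedStrip T :=
  ⟨mem_univ _, le_max_left _ _, max_le hT (min_le_right _ _)⟩

lemma clampTime_eq {T : ℝ} {p : ℝ × ℝ} (hp : p ∈ closedStrip T) : clampTime T p = p := by
  have h := hp.2
  ext
  · rfl
  · simp [clampTime, h.1, h.2]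

lemma openStrip_subset (T : ℝ) : openStrip T ⊆ closedStrip T :=
  prod_mono Subset.rfl Ioo_subset_Icc_self

lemma IsLocHolder.congr {Ω : Set (ℝ × ℝ)} {r : ℝ} {v w : ℝ × ℝ → ℝ} (h : IsLocHolder Ω r v)
    (hvw : EqOn v w Ω) : IsLocHolder Ω r w := by
  intro K hK hKc
  obtain ⟨C, hC⟩ := h K hK hKc
  refine ⟨C, fun p hp q hq => ?_⟩
  rw [← hvw (hK hp), ← hvw (hK hq)]
  exact hC p hp q hq

lemma IsLocC1Holder.congr {Ω : Set (ℝ × ℝ)} (hΩ : IsOpen Ω) {r : ℝ} {v w : ℝ × ℝ → ℝ}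
    (h : IsLocC1Holder Ω r v) (hvw : EqOn v w Ω) : IsLocC1Holder Ω r w := by
  refine ⟨h.1.congr fun p hp => (hvw hp).symm, fun K hK hKc => ?_⟩
  have hd : ∀ p ∈ Ω, fderiv ℝ w p = fderiv ℝ v p := fun p hp =>
    (hvw.symm.eventuallyEq_of_mem (hΩ.mem_nhds hp)).fderiv_eq
  obtain ⟨C, hC⟩ := h.2 K hK hKc
  refine ⟨C, fun p hp q hq => ?_⟩
  rw [hd p (hK hp), hd q (hK hq)]
  exact hC p hp q hq

lemma IsLocSemiconcave.congr {Ω : Set (ℝ × ℝ)} {r : ℝ} {v w : ℝ × ℝ → ℝ}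
    (h : IsLocSemiconcave Ω r v) (hvw : EqOn v w Ω) : IsLocSemiconcave Ω r w := by
  intro K hK hKc
  obtain ⟨C, hC⟩ := h K hK hKc
  refine ⟨C, fun p q hpq l hl => ?_⟩
  rw [← hvw (hK (hpq (left_mem_segment ℝ p q))), ← hvw (hK (hpq (right_mem_segment ℝ p q))),
    ← hvw (hK (hpq ⟨l, 1 - l, hl.1, by linarith [hl.2], by ring, rfl⟩))]
  exact hC p q hpq l hl

lemma IsViscositySolution.congr {T : ℝ} {F F' u u' : ℝ × ℝ → ℝ} (h : IsViscositySolution T F u)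
    (hF : EqOn F F' (openStrip T)) (hu : EqOn u u' (openStrip T)) :
    IsViscositySolution T F' u' := by
  intro φ hφ p hp
  have he : (fun q => u' q - φ q) =ᶠ[𝓝 p] fun q => u q - φ q := by
    filter_upwards [(isOpen_openStrip T).mem_nhds hp] with q hq
    rw [hu hq]
  rw [← hF hp]
  exact ⟨fun hmax => (h φ hφ p hp).1 (hmax.congr he), fun hmin => (h φ hφ p hp).2 (hmin.congr he)⟩

lemma IsContinuitySolution.congr {T : ℝ} {u u' m m' : ℝ × ℝ → ℝ} (h : IsContinuitySolution T u m)
    (hu : EqOn u u' (openStrip T)) (hm : EqOn m m' (openStrip T)) :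
    IsContinuitySolution T u' m' := by
  intro φ hφ hφc hφs
  rw [← h φ hφ hφc hφs]
  congr 1 with p
  by_cases hp : p ∈ openStrip T
  · have he : dx u p = dx u' p := by
      refine EventuallyEq.deriv_eq ?_
      have hc : Tendsto (fun y : ℝ => (y, p.2)) (𝓝 p.1) (𝓝 p) :=
        (show Continuous fun y : ℝ => (y, p.2) by fun_prop).tendsto' _ _ rfl
      filter_upwards [hc.eventually ((isOpen_openStrip T).mem_nhds hp)] with y hy
      exact hu hy
    rw [hm hp, he]
  -- Outside the strip `u_x` may change, but the derivatives of the test function vanish there.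
  · have hd : DifferentiableAt ℝ φ p := (hφ.differentiable (by simp)).differentiableAt
    have h0 : fderiv ℝ φ p = 0 := image_eq_zero_of_notMem_tsupport fun hmem =>
      hp (hφs (tsupport_fderiv_subset ℝ hmem))
    rw [dt_eq_fderiv hd, dx_eq_fderiv hd, h0]
    simp

/-! ### Backward trajectories in the two problems -/

/-- For the mean field game minimizing trajectories can be continued backward in time. -/
lemma exists_calibrated_backward_of_terminal {T M β θ c : ℝ} (hθ : 0 < θ) {u m : ℝ × ℝ → ℝ}
    {L Λ : NNReal} (hu : LipschitzWith L u) (hm : Continuous m) (hm0 : ∀ p, 0 ≤ m p)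
    (hmM : ∀ p, m p ≤ M) (hsub : SubLine T (fun p => m p ^ θ) u) (hβ : 0 < β) (hβ' : β < 1)
    (hF : IsLocHolder (openStrip T) β fun p => m p ^ θ)
    (hfwd : ∀ z ∈ openStrip T, ∃ γ, IsCalibrated (fun p => m p ^ θ) u Λ γ z.2 T ∧ γ z.2 = z.1)
    (hc : IsContinuitySolution T u m) (hterm : ∀ x, m (x, T) = 0 → u (x, T) = c)
    {z : ℝ × ℝ} (hz : z ∈ openStrip T) {a : ℝ} (ha : a ∈ Ioo 0 z.2) :
    ∃ γ, IsCalibrated (fun p => m p ^ θ) u Λ γ a z.2 ∧ γ z.2 = z.1 := by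
  have hFc : Continuous fun p => m p ^ θ := hm.rpow_const fun _ => Or.inr hθ.le
  have haT : a < T := ha.2.trans hz.2.2
  refine exists_calibrated_of_unique hu.continuous hFc hz ha hfwd fun γ₁ γ₂ h₁ h₂ haa => ?_
  have hvac : ∀ s ∈ Icc a T, γ₁ s ≠ γ₂ s → ∀ x ∈ uIcc (γ₁ s) (γ₂ s), m (x, s) = 0 :=
    fun s hs hne => eq_zero_of_integral_eq_zero (f := fun x => m (x, s)) (by fun_prop)
      (fun x => hm0 _) hne
      (mass_between_eq_zero hu hFc hsub hβ hβ' hF hfwd hm hm0 hmM hc ha.1.le haT h₁ h₂ haa hs)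
  have hmid : ∀ x y : ℝ, (x + y) / 2 ∈ uIcc x y := fun x y => by
    rw [mem_uIcc]
    rcases le_total x y with h | h
    · exact Or.inl ⟨by linarith, by linarith⟩
    · exact Or.inr ⟨by linarith, by linarith⟩
  have hT : T ∈ Icc a T := ⟨haT.le, le_rfl⟩
  -- Where the curves differ, they and their mean lie in the vacuum, so any cost determined there
  -- takes the same value on all three. This applies to `m ^ θ` at all times and to `u` at time `T`.
  have key : ∀ w : ℝ × ℝ → ℝ, ∀ s ∈ Icc a T, (∀ x y, m (x, s) = 0 → m (y, s) = 0 →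
      w (x, s) = w (y, s)) → w (γ₁ s, s) = w ((γ₁ s + γ₂ s) / 2, s) ∧
        w (γ₂ s, s) = w ((γ₁ s + γ₂ s) / 2, s) := by
    intro w s hs hw
    rcases eq_or_ne (γ₁ s) (γ₂ s) with h | h
    · simp [h]
    · have h0 := hvac s hs h
      exact ⟨hw _ _ (h0 _ left_mem_uIcc) (h0 _ (hmid _ _)),
        hw _ _ (h0 _ right_mem_uIcc) (h0 _ (hmid _ _))⟩
  have hFk : ∀ s ∈ Icc a T, _ := fun s hs => key (fun p => m p ^ θ) s hs fun x y hx hy => by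
    simp only [hx, hy]
  have huk := key u T hT fun x y hx hy => (hterm x hx).trans (hterm y hy).symm
  exact eq_of_calibrated hFc hsub ha.1.le haT h₁ h₂ haa (fun s hs => (hFk s hs).1)
    (fun s hs => (hFk s hs).2) huk.1 huk.2 ⟨ha.2.le, hz.2.2.le⟩

/-- A selected solution of the planning problem solves the Hamilton-Jacobi equation also after
reversal of time. -/
lemma isSupersolution_timeReversal_of_selected {R T θ : ℝ} (hθ : 0 < θ)
    {u m : ℝ × ℝ → ℝ} {Λ : NNReal} (hm : Continuous m) (hm0 : ∀ p, 0 ≤ m p)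
    (hsub : SubLine T (fun p => m p ^ θ) u)
    (hfwd : ∀ z ∈ openStrip T, ∃ γ, IsCalibrated (fun p => m p ^ θ) u Λ γ z.2 T ∧ γ z.2 = z.1)
    {v n : ℕ → ℝ × ℝ → ℝ} (hvn : ∀ k, IsNeumannSolution R T θ (v k) (n k))
    (hv : TendstoUniformlyOn v u atTop (rect R T)) (hn : TendstoUniformlyOn n m atTop (rect R T))
    (hmR : ∀ p ∈ openStrip T, R ≤ |p.1| → m p = 0)
    (hul : ∀ p ∈ openStrip T, p.1 < -R → u p = u (-R, p.2))
    (hur : ∀ p ∈ openStrip T, R < p.1 → u p = u (R, p.2)) :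
    IsSupersolution T (fun p => m (p.1, T - p.2) ^ θ) (timeReversal T u) := by
  refine isSupersolution_timeReversal (F := fun p => m p ^ θ) fun φ hφ p hp hmax => ?_
  have hF0 : ∀ p, 0 ≤ m p ^ θ := fun p => Real.rpow_nonneg (hm0 p) θ
  have hvac : ∀ x, R ≤ |x| → ∀ t ∈ Ioo 0 T, m (x, t) ^ θ = 0 := fun x hx t ht => by
    rw [hmR (x, t) ⟨mem_univ _, ht⟩ hx, Real.zero_rpow hθ.ne']
  have hout : ∀ S : Set ℝ, p.1 ∈ S → (∀ M : ℝ, ∃ x ∈ S, ∀ y, |y - x| ≤ M → y ∈ S) →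
      (∀ x ∈ S, R ≤ |x|) → (∀ x ∈ S, ∀ y ∈ S, ∀ t ∈ Ioo 0 T, u (x, t) = u (y, t)) →
      m p ^ θ ≤ -dt φ p + (dx φ p) ^ 2 / 2 := by
    intro S hpS hS hSR hSu
    rw [show m p ^ θ = 0 from hvac p.1 (hSR _ hpS) p.2 hp.2]
    exact nonneg_of_touching_above_of_vacuum hp (fun t ht =>
      eq_of_vacuum hsub hF0 hfwd hS (fun x hx => hvac x (hSR x hx)) hSu hpS hp.2 ht) hmax
  -- For `|x| < R` the classical approximations decide; on each closed outer half-line there is no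
  -- mass and `u` depends on time only.
  rcases lt_or_ge (-R) p.1 with h1 | h1
  · rcases lt_or_ge p.1 R with h2 | h2
    · exact (eq_of_touching_above_of_tendsto hθ hm hvn hv hn hφ ⟨⟨h1, h2⟩, hp.2⟩ hmax).le
    · have e : ∀ x ∈ Ici R, ∀ t ∈ Ioo 0 T, u (x, t) = u (R, t) := fun x hx t ht => by
        rcases (mem_Ici.1 hx).eq_or_lt with rfl | hlt
        · rfl
        · exact hur (x, t) ⟨mem_univ _, ht⟩ hlt
      refine hout (Ici R) h2 (fun M => ⟨R + |M|, by simp, fun y hy => ?_⟩)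
        (fun x hx => (mem_Ici.1 hx).trans (le_abs_self x))
        fun x hx y hy t ht => (e x hx t ht).trans (e y hy t ht).symm
      rw [mem_Ici]
      linarith [(abs_le.1 hy).1, le_abs_self M]
  · have e : ∀ x ∈ Iic (-R), ∀ t ∈ Ioo 0 T, u (x, t) = u (-R, t) := fun x hx t ht => by
      rcases (mem_Iic.1 hx).eq_or_lt with rfl | hlt
      · rfl
      · exact hul (x, t) ⟨mem_univ _, ht⟩ hlt
    refine hout (Iic (-R)) h1 (fun M => ⟨-R - |M|, by simp, fun y hy => ?_⟩)
      (fun x hx => by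
        have := mem_Iic.1 hx
        linarith [neg_le_abs x])
      fun x hx y hy t ht => (e x hx t ht).trans (e y hy t ht).symm
    rw [mem_Iic]
    linarith [(abs_le.1 hy).2, le_abs_self M]

end MFG

theorem theorem4p18 (T θ θ₁ c₁ β : ℝ) (hT : 0 < T) (hθ : 0 < θ) (hθ₁ : 0 < θ₁) (hc₁ : 0 ≤ c₁)
    (hβ : 0 < β) (hβ' : β < 1)
    (m₀ : ℝ → ℝ) (hm₀ : MFG.IsDensity m₀) (u m : ℝ × ℝ → ℝ)
    (hsol : MFG.IsMFGSolution T θ (fun s => c₁ * T * s ^ θ₁) m₀ u m ∨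
      ∃ mT : ℝ → ℝ, MFG.IsDensity mT ∧ MFG.IsSelectedPlanningSolution T θ m₀ mT u m)
    (hf : MFG.IsLocHolder (MFG.openStrip T) β (fun p => m p ^ θ)) :
    MFG.IsLocC1Holder (MFG.openStrip T) (β / 2) u ∧
      MFG.IsLocSemiconcave (MFG.openStrip T) (β / 2) u ∧
      MFG.IsLocSemiconcave (MFG.openStrip T) (β / 2) (fun p => -u p) := by
  open MFG Set Filter in
  have hsys : IsSystemSolution T θ m₀ u m := by
    rcases hsol with h | ⟨mT, -, h⟩
    · exact h.toIsSystemSolution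
    · exact h.toIsSystemSolution
  obtain ⟨L, hL⟩ := hsys.u_lipschitz
  obtain ⟨M, hM⟩ := hsys.m_bounded
  -- Freezing `u` and `m` beyond `[0, T]` makes them globally Lipschitz and continuous, as the
  -- convolutions require; all hypotheses and conclusions concern the strip only.
  set u' : ℝ × ℝ → ℝ := fun p => u (clampTime T p) with hu'
  set m' : ℝ × ℝ → ℝ := fun p => m (clampTime T p) with hm'
  have hmem := clampTime_mem hT.le
  have huC : EqOn u u' (closedStrip T) := fun p hp => by simp only [hu', clampTime_eq hp]
  have hmC : EqOn m m' (closedStrip T) := fun p hp => by simp only [hm', clampTime_eq hp]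
  have huO := huC.mono (openStrip_subset T)
  have hmO := hmC.mono (openStrip_subset T)
  have hFO : EqOn (fun p => m p ^ θ) (fun p => m' p ^ θ) (openStrip T) := fun p hp => by
    simp only [hmO hp]
  have hu : LipschitzWith L u' := by
    refine LipschitzWith.of_dist_le_mul fun p q => ?_
    refine (hL.dist_le_mul _ (hmem p) _ (hmem q)).trans ?_
    gcongr
    simpa using (lipschitzWith_clampTime T).dist_le_mul p q
  have hmc : Continuous m' := hsys.m_continuous.comp_continuous
    (lipschitzWith_clampTime T).continuous hmem
  have hm0 : ∀ p, 0 ≤ m' p := fun p => hsys.m_nonneg _ (hmem p)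
  have hmM : ∀ p, m' p ≤ M := fun p => hM _ (hmem p)
  have hFc : Continuous fun p => m' p ^ θ := hmc.rpow_const fun _ => Or.inr hθ.le
  have hF := hf.congr hFO
  have hHJ := hsys.hamiltonJacobi.congr hFO huO
  have hsub : SubLine T (fun p => m' p ^ θ) u' :=
    IsSubsolution.subLine hu hFc fun φ hφ p hp => (hHJ φ hφ p hp).1
  have hsup : IsSupersolution T (fun p => m' p ^ θ) u' := fun φ hφ p hp => (hHJ φ hφ p hp).2
  have hfwd : ∀ z ∈ openStrip T, ∃ γ,
      IsCalibrated (fun p => m' p ^ θ) u' (2 * L) γ z.2 T ∧ γ z.2 = z.1 :=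
    fun z hz => hsup.exists_calibrated hu hFc hz
  have hbwd : ∀ z ∈ openStrip T, ∀ a ∈ Ioo 0 z.2, ∃ γ,
      IsCalibrated (fun p => m' p ^ θ) u' (2 * L) γ a z.2 ∧ γ z.2 = z.1 := by
    intro z hz a ha
    rcases hsol with h | ⟨mT, -, h⟩
    -- The terminal cost vanishes where `m` does, since `θ₁ > 0`.
    · refine exists_calibrated_backward_of_terminal (c := 0) hθ hu hmc hm0 hmM hsub hβ hβ' hF hfwd
        (hsys.continuity.congr huO hmO) (fun x hx => ?_) hz ha
      have hxT : (x, T) ∈ closedStrip T := ⟨mem_univ _, hT.le, le_rfl⟩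
      rw [← hmC hxT] at hx
      rw [← huC hxT, h.terminal, hx, Real.zero_rpow hθ₁.ne', mul_zero]
    · obtain ⟨R, -, ⟨v, n, hvn, hv, hn⟩, hmR, hul, hur⟩ := h.selected
      have hrect : rect R T ⊆ closedStrip T := prod_mono (subset_univ _) Subset.rfl
      have hrev := isSupersolution_timeReversal_of_selected hθ hmc hm0 hsub hfwd hvn
        (hv.congr_right (huC.mono hrect)) (hn.congr_right (hmC.mono hrect))
        (fun p hp h => by rw [← hmO hp]; exact hmR p (openStrip_subset T hp) h)
        (fun p hp h => by
          rw [← huO hp, ← huO (show (-R, p.2) ∈ openStrip T from ⟨mem_univ _, hp.2⟩)]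
          exact hul p (openStrip_subset T hp) h)
        (fun p hp h => by
          rw [← huO hp, ← huO (show (R, p.2) ∈ openStrip T from ⟨mem_univ _, hp.2⟩)]
          exact hur p (openStrip_subset T hp) h)
      obtain ⟨γ, hγ, hγz⟩ := exists_calibrated_backward hu hFc hrev hz
      exact ⟨γ, hγ.mono ha.1.le le_rfl, hγz⟩
  obtain ⟨h1, h2, h3⟩ := regularity_of_calibrated hu hsub hβ hβ' hF hfwd hbwd
  exact ⟨h1.congr (isOpen_openStrip T) huO.symm, h2.congr huO.symm,
    h3.congr fun p hp => by rw [huO hp]⟩
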